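/- Let $p,q\ge 1$ and $a\in\mathbb C$. Let $$X^0=\{(x,y)\in\mathbb R^p\oplus\mathbb R^q : (x,y)\ne 0,\ r_p^2(x)=r_q^2(y)\},\qquad r_p^2(x)=\sum_i x_i^2,\quad r_q^2(y)=\sum_i y_i^2,$$ be the light cone, and let $S^a(X^0)$ be the space of smooth functions $f:X^0\to\mathbb C$ with $f(tw)=t^af(w)$ for all $t>0$ and $w\in X^0$, with the topology induced by the usual topology of $C^\infty(X^0)$ (locally uniform convergence of all derivatives). The group $O(p)\times O(q)$ acts on $S^a(X^0)$ by $(\rho(g)f)(w)=f(g^{-1}w)$. For $m,n\ge 0$ let $\mathcal H^m(\mathbb R^p)$ be the space of complex harmonic polynomials on $\mathbb R^p$ that are homogeneous of degree $m$, similarly $\mathcal H^n(\mathbb R^q)$, and let $$j_a:\mathcal H^m(\mathbb R^p)\otimes\mathcal H^n(\mathbb R^q)\to S^a(X^0),\qquad j_a(h_1\otimes h_2)(x,y)=h_1(x)\,h_2(y)\,\big(r_p^2(x)\big)^{b},\qquad m+n+2b=a.$$ Lemma 2.2. Each subspace $V_{m,n}=j_a(\mathcal H^m(\mathbb R^p)\otimes\mathcal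 H^n(\mathbb R^q))$ is $O(p)\times O(q)$-invariant, and as an $O(p)\times O(q)$-module $S^a(X^0)$ is the topological direct sum of the $V_{m,n}$, $m,n\ge 0$: every $f\in S^a(X^0)$ has exactly one expansion $f=\sum_{m,n}f_{m,n}$ with $f_{m,n}\in V_{m,n}$ that converges unconditionally in $S^a(X^0)$, and each projection $f\mapsto f_{m,n}$ is linear and continuous. The summands are mutually inequivalent irreducible representations of $O(p)\times O(q)$, where for $p=1$ only $m\in\{0,1\}$ and for $q=1$ only $n\in\{0,1\}$ are counted (the remaining $V_{m,n}$ are $0$). -/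

import Mathlib

open scoped ContDiff Topology TensorProduct UniformConvergence

noncomputable section

namespace LightCone

/-- Euclidean space `ℝ^p`. -/
abbrev E (p : ℕ) : Type := EuclideanSpace ℝ (Fin p)

/-- The compact group `O(p) × O(q)`, a product of groups of linear isometries. -/
abbrev K (p q : ℕ) : Type := (E p ≃ₗᵢ[ℝ] E p) × (E q ≃ₗᵢ[ℝ] E q)

/-- The light cone `X⁰`: nonzero `w = (x, y)` in `ℝ^p ⊕ ℝ^q` with `r_p²(x) = r_q²(y)`. -/
def X0 (p q : ℕ) : Set (E p × E q) := {w | w ≠ 0 ∧ ‖w.1‖ ^ 2 = ‖w.2‖ ^ 2}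

variable {p q : ℕ}

lemma fst_ne_zero {w : E p × E q} (hw : w ∈ X0 p q) : w.1 ≠ 0 := by
  intro h
  have h2 := hw.2
  rw [h] at h2
  have h3 : w.2 = 0 := by simpa using h2.symm
  exact hw.1 (Prod.ext h h3)

/-- Dilation of the cone by a positive scalar. -/
def dil (t : ℝ) (ht : 0 < t) (w : X0 p q) : X0 p q :=
  ⟨t • w.1, smul_ne_zero ht.ne' w.2.1, by
    have := w.2.2
    simp only [Prod.smul_fst, Prod.smul_snd, norm_smul, mul_pow, this]⟩

/-- The natural action of `O(p) × O(q)` on the cone. -/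
def act (g : K p q) (w : X0 p q) : X0 p q :=
  ⟨(g.1 w.1.1, g.2 w.1.2), by
    intro h
    have h1 : g.1 w.1.1 = 0 := congrArg Prod.fst h
    exact fst_ne_zero w.2 (by simpa using h1), by
    simpa using w.2.2⟩

/-- A complex function on the (embedded submanifold) `X⁰` is smooth if it is locally the
restriction of a smooth function on an open subset of the ambient space `ℝ^(p+q)`. -/
def IsSmooth (f : X0 p q → ℂ) : Prop :=
  ∀ w : X0 p q, ∃ (U : Set (E p × E q)) (F : E p × E q → ℂ),
    IsOpen U ∧ w.1 ∈ U ∧ ContDiffOn ℝ ∞ F U ∧ ∀ z : X0 p q, z.1 ∈ U → F z.1 = f z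

variable (p q) in
/-- The smooth functions as a linear subspace of all complex functions on `X⁰`. -/
def smoothSubmodule : Submodule ℂ (X0 p q → ℂ) where
  carrier := {f | IsSmooth f}
  zero_mem' := fun _ => ⟨Set.univ, fun _ => 0, isOpen_univ, trivial, contDiffOn_const,
    fun _ _ => rfl⟩
  add_mem' := by
    intro f g hf hg w
    obtain ⟨U, F, hU, hwU, hF, hFf⟩ := hf w
    obtain ⟨V, G, hV, hwV, hG, hGg⟩ := hg w
    refine ⟨U ∩ V, fun z => F z + G z, hU.inter hV, ⟨hwU, hwV⟩,
      (hF.mono Set.inter_subset_left).add (hG.mono Set.inter_subset_right), ?_⟩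
    intro z hz
    simp [hFf z hz.1, hGg z hz.2]
  smul_mem' := by
    intro c f hf w
    obtain ⟨U, F, hU, hwU, hF, hFf⟩ := hf w
    refine ⟨U, fun z => c * F z, hU, hwU, contDiffOn_const.mul hF, ?_⟩
    intro z hz
    simp [hFf z hz]

variable (p q) in
/-- The space `C^∞(X⁰)` of smooth complex-valued functions on the cone. It is a type of its own, so
that it does not carry the topology of pointwise convergence. -/
def Smooth : Type := smoothSubmodule p q

instance : AddCommGroup (Smooth p q) := inferInstanceAs (AddCommGroup (smoothSubmodule p q))
instance : Module ℂ (Smooth p q) := inferInstanceAs (Module ℂ (smoothSubmodule p q))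

/-- The underlying function of an element of `C^∞(X⁰)`. -/
def Smooth.fn (f : Smooth p q) : X0 p q → ℂ := f.1

/-- The standard topology of `C^∞(X⁰)`: locally uniform convergence of all derivatives in smooth
coordinates. It is the coarsest topology such that for every smooth map `φ : ℝ^d → X⁰` (these
include the local parametrizations of `X⁰` by open balls, the balls being diffeomorphic to `ℝ^d`)
and every order `k` the map `f ↦ D^k (f ∘ φ)` is continuous into the functions on `ℝ^d` with
uniform convergence on compact sets. -/
instance : TopologicalSpace (Smooth p q) :=
  ⨅ (d : ℕ) (φ : E d → X0 p q) (_ : ContDiff ℝ ∞ (fun u => (φ u).1)) (k : ℕ),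
    TopologicalSpace.induced
      (fun f : Smooth p q =>
        UniformOnFun.ofFun {C : Set (E d) | IsCompact C} (iteratedFDeriv ℝ k (f.fn ∘ φ)))
      inferInstance

variable (p q) in
/-- `S^a(X⁰)`: the smooth functions with `f (t w) = t^a f w` for all `t > 0`, with the topology
induced by `C^∞(X⁰)`. -/
def S (a : ℂ) : Submodule ℂ (Smooth p q) where
  carrier := {f | ∀ (t : ℝ) (ht : 0 < t) (w : X0 p q), f.fn (dil t ht w) = (t : ℂ) ^ a * f.fn w}
  zero_mem' := by
    intro t ht w
    change (0 : ℂ) = (t : ℂ) ^ a * 0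
    simp
  add_mem' := by
    intro f g hf hg t ht w
    change f.fn _ + g.fn _ = (t : ℂ) ^ a * (f.fn w + g.fn w)
    rw [hf t ht w, hg t ht w, mul_add]
  smul_mem' := by
    intro c f hf t ht w
    change c * f.fn _ = (t : ℂ) ^ a * (c * f.fn w)
    rw [hf t ht w]
    ring

lemma act_one (w : X0 p q) : act 1 w = w := rfl

lemma act_mul (g h : K p q) (w : X0 p q) : act (g * h) w = act g (act h w) := rfl

lemma act_dil (g : K p q) (t : ℝ) (ht : 0 < t) (w : X0 p q) :
    act g (dil t ht w) = dil t ht (act g w) := by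
  apply Subtype.ext
  simp [act, dil]

lemma isSmooth_act (g : K p q) {f : X0 p q → ℂ} (hf : IsSmooth f) :
    IsSmooth (fun w => f (act g w)) := by
  intro w
  obtain ⟨U, F, hU, hwU, hF, hFf⟩ := hf (act g w)
  let L : E p × E q → E p × E q := fun z => (g.1 z.1, g.2 z.2)
  have hL : ContDiff ℝ ∞ L :=
    (g.1.contDiff.comp contDiff_fst).prodMk (g.2.contDiff.comp contDiff_snd)
  exact ⟨L ⁻¹' U, F ∘ L, hU.preimage hL.continuous, hwU,
    hF.comp hL.contDiffOn (fun _ hz => hz), fun z hz => hFf (act g z) hz⟩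

/-- Left translation `(ρ(g) f)(w) = f (g⁻¹ w)` on `S^a(X⁰)`. -/
def translate (a : ℂ) (g : K p q) : S p q a →ₗ[ℂ] S p q a where
  toFun f := ⟨⟨fun w => f.1.fn (act g⁻¹ w), isSmooth_act g⁻¹ f.1.2⟩, by
    intro t ht w
    change f.1.fn (act g⁻¹ (dil t ht w)) = (t : ℂ) ^ a * f.1.fn (act g⁻¹ w)
    rw [act_dil]
    exact f.2 t ht _⟩
  map_add' _ _ := rfl
  map_smul' _ _ := rfl

variable (p q) in
/-- The representation `ρ` of `O(p) × O(q)` on `S^a(X⁰)`. -/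
def rho (a : ℂ) : Representation ℂ (K p q) (S p q a) where
  toFun := translate a
  map_one' := by
    ext f
    rfl
  map_mul' g h := by
    refine LinearMap.ext fun f => Subtype.ext (Subtype.ext (funext fun w => ?_))
    change f.1.fn (act (g * h)⁻¹ w) = f.1.fn (act h⁻¹ (act g⁻¹ w))
    rw [mul_inv_rev, act_mul]

/-- The Laplace operator on complex-valued polynomials on `ℝ^p`. -/
def laplacian (p : ℕ) : MvPolynomial (Fin p) ℂ →ₗ[ℂ] MvPolynomial (Fin p) ℂ :=
  ∑ j : Fin p, (MvPolynomial.pderiv j).toLinearMap ∘ₗ (MvPolynomial.pderiv j).toLinearMap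

/-- `H^m(ℝ^p)`: the harmonic polynomials on `ℝ^p`, homogeneous of degree `m`. -/
def H (p m : ℕ) : Submodule ℂ (MvPolynomial (Fin p) ℂ) :=
  MvPolynomial.homogeneousSubmodule (Fin p) ℂ m ⊓ LinearMap.ker (laplacian p)

/-- The value of a complex polynomial at a point of `ℝ^p`. -/
def evalAt (h : MvPolynomial (Fin p) ℂ) (x : E p) : ℂ :=
  MvPolynomial.eval (fun i => (x i : ℂ)) h

lemma contDiff_evalAt (h : MvPolynomial (Fin p) ℂ) : ContDiff ℝ ∞ (evalAt h) := by
  induction h using MvPolynomial.induction_on with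
  | C c =>
    have : evalAt (MvPolynomial.C c : MvPolynomial (Fin p) ℂ) = fun _ => c := by
      ext x; simp [evalAt]
    rw [this]
    exact contDiff_const
  | add f g hf hg =>
    have : evalAt (f + g) = fun x => evalAt f x + evalAt g x := by
      ext x; simp [evalAt]
    rw [this]
    exact hf.add hg
  | mul_X f i hf =>
    have : evalAt (f * MvPolynomial.X i) = fun x => evalAt f x * ((x i : ℝ) : ℂ) := by
      ext x; simp [evalAt]
    rw [this]
    refine hf.mul (Complex.ofRealCLM.contDiff.comp ?_)
    fun_prop

lemma evalAt_smul {m : ℕ} {h : MvPolynomial (Fin p) ℂ} (hh : h ∈ H p m) (t : ℝ) (x : E p) :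
    evalAt h (t • x) = (t : ℂ) ^ m * evalAt h x := by
  have h1 : MvPolynomial.IsHomogeneous h m := (MvPolynomial.mem_homogeneousSubmodule _ _).1 hh.1
  simp only [evalAt, MvPolynomial.eval_eq']
  rw [Finset.mul_sum]
  refine Finset.sum_congr rfl fun d hd => ?_
  have hdeg : ∑ i, d i = m := by
    have h2 := h1 (MvPolynomial.mem_support_iff.1 hd)
    rw [Finsupp.weight_apply, Finsupp.sum_fintype _ _ (by simp)] at h2
    simpa using h2
  simp only [PiLp.smul_apply, smul_eq_mul, Complex.ofReal_mul, mul_pow]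
  rw [Finset.prod_mul_distrib, Finset.prod_pow_eq_pow_sum, hdeg]
  ring

/-- The function `(x, y) ↦ h₁(x) h₂(y) (r_p²(x))^b` with `m + n + 2 b = a`. -/
def jFun (a : ℂ) (m n : ℕ) (h₁ : MvPolynomial (Fin p) ℂ) (h₂ : MvPolynomial (Fin q) ℂ)
    (w : E p × E q) : ℂ :=
  evalAt h₁ w.1 * evalAt h₂ w.2 * ((‖w.1‖ ^ 2 : ℝ) : ℂ) ^ ((a - m - n) / 2)

lemma isSmooth_jFun (a : ℂ) (m n : ℕ) (h₁ : MvPolynomial (Fin p) ℂ)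
    (h₂ : MvPolynomial (Fin q) ℂ) :
    IsSmooth (fun w : X0 p q => jFun a m n h₁ h₂ w.1) := by
  intro w
  have hU : IsOpen {z : E p × E q | z.1 ≠ 0} := isOpen_ne.preimage continuous_fst
  refine ⟨{z | z.1 ≠ 0}, jFun a m n h₁ h₂, hU, fst_ne_zero w.2, ?_, fun z _ => rfl⟩
  have h1 : ContDiff ℝ ∞ (fun z : E p × E q => evalAt h₁ z.1) :=
    (contDiff_evalAt h₁).comp contDiff_fst
  have h2 : ContDiff ℝ ∞ (fun z : E p × E q => evalAt h₂ z.2) :=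
    (contDiff_evalAt h₂).comp contDiff_snd
  have h3 : ContDiffOn ℝ ∞ (fun z : E p × E q => Real.log (‖z.1‖ ^ 2)) {z | z.1 ≠ 0} := by
    refine ContDiffOn.log ?_ ?_
    · exact ((contDiff_norm_sq ℝ).comp contDiff_fst).contDiffOn
    · intro z hz
      exact pow_ne_zero 2 (norm_ne_zero_iff.2 hz)
  have h4 : ContDiffOn ℝ ∞ (fun z : E p × E q =>
      ((‖z.1‖ ^ 2 : ℝ) : ℂ) ^ ((a - m - n) / 2)) {z | z.1 ≠ 0} := by
    have h5 : ContDiffOn ℝ ∞ (fun z : E p × E q =>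
        Complex.exp ((Real.log (‖z.1‖ ^ 2) : ℂ) * ((a - m - n) / 2))) {z | z.1 ≠ 0} :=
      ((Complex.ofRealCLM.contDiff.comp_contDiffOn h3).mul contDiffOn_const).cexp
    refine h5.congr fun z hz => ?_
    have hz' : (0 : ℝ) < ‖z.1‖ ^ 2 := pow_pos (norm_pos_iff.2 hz) 2
    rw [Complex.cpow_def_of_ne_zero (by exact_mod_cast hz'.ne'), Complex.ofReal_log hz'.le]
  exact ((h1.mul h2).contDiffOn).mul h4

lemma jFun_dil (a : ℂ) (m n : ℕ) (h₁ : H p m) (h₂ : H q n) (t : ℝ) (ht : 0 < t)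
    (w : X0 p q) :
    jFun a m n h₁.1 h₂.1 (dil t ht w).1 = (t : ℂ) ^ a * jFun a m n h₁.1 h₂.1 w.1 := by
  have ht' : (t : ℂ) ≠ 0 := by exact_mod_cast ht.ne'
  have hp : ((‖t • w.1.1‖ ^ 2 : ℝ) : ℂ) ^ ((a - m - n) / 2)
      = (t : ℂ) ^ (a - m - n) * ((‖w.1.1‖ ^ 2 : ℝ) : ℂ) ^ ((a - m - n) / 2) := by
    rw [norm_smul, mul_pow, Complex.ofReal_mul,
      Complex.mul_cpow_ofReal_nonneg (by positivity) (by positivity)]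
    congr 1
    rw [Real.norm_of_nonneg ht.le, sq, Complex.ofReal_mul,
      Complex.mul_cpow_ofReal_nonneg ht.le ht.le, ← Complex.cpow_add _ _ ht', add_halves]
  have hta : (t : ℂ) ^ a = (t : ℂ) ^ m * (t : ℂ) ^ n * (t : ℂ) ^ (a - m - n) := by
    rw [← Complex.cpow_natCast, ← Complex.cpow_natCast, ← Complex.cpow_add _ _ ht',
      ← Complex.cpow_add _ _ ht']
    congr 1
    ring
  simp only [jFun, dil, Prod.smul_fst, Prod.smul_snd]
  rw [evalAt_smul h₁.2, evalAt_smul h₂.2, hp, hta]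
  ring

variable (p q) in
/-- The map `j_a = j_{a,m,n} : H^m(ℝ^p) ⊗ H^n(ℝ^q) → S^a(X⁰)`, with
`j_a(h₁ ⊗ h₂)(x, y) = h₁(x) h₂(y) (r_p²(x))^b` on `X⁰`, where `m + n + 2 b = a`. -/
def j (a : ℂ) (m n : ℕ) : H p m ⊗[ℂ] H q n →ₗ[ℂ] S p q a :=
  TensorProduct.lift <| LinearMap.mk₂ ℂ
    (fun h₁ h₂ => ⟨⟨fun w => jFun a m n h₁.1 h₂.1 w.1, isSmooth_jFun a m n h₁.1 h₂.1⟩,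
      jFun_dil a m n h₁ h₂⟩)
    (fun h h' k => Subtype.ext (Subtype.ext (funext fun w => by
      change jFun a m n (h.1 + h'.1) k.1 w.1 = jFun a m n h.1 k.1 w.1 + jFun a m n h'.1 k.1 w.1
      simp [jFun, evalAt]; ring)))
    (fun c h k => Subtype.ext (Subtype.ext (funext fun w => by
      change jFun a m n (c • h.1) k.1 w.1 = c * jFun a m n h.1 k.1 w.1
      simp [jFun, evalAt]; ring)))
    (fun h k k' => Subtype.ext (Subtype.ext (funext fun w => by
      change jFun a m n h.1 (k.1 + k'.1) w.1 = jFun a m n h.1 k.1 w.1 + jFun a m n h.1 k'.1 w.1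
      simp [jFun, evalAt]; ring)))
    (fun c h k => Subtype.ext (Subtype.ext (funext fun w => by
      change jFun a m n h.1 (c • k.1) w.1 = c * jFun a m n h.1 k.1 w.1
      simp [jFun, evalAt]; ring)))

lemma j_tmul (a : ℂ) (m n : ℕ) (h₁ : H p m) (h₂ : H q n) (w : X0 p q) :
    (j p q a m n (h₁ ⊗ₜ[ℂ] h₂)).1.fn w
      = evalAt h₁.1 w.1.1 * evalAt h₂.1 w.1.2 *
        ((‖w.1.1‖ ^ 2 : ℝ) : ℂ) ^ ((a - m - n) / 2) := rfl

/-- The topological vector space `V` is the topological direct sum of the subspaces `W i`: every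
`v` is in exactly one way the sum of an (unconditionally) convergent family of vectors
`w i ∈ W i`, and each component `w i` depends continuously and linearly on `v`. -/
def IsTopologicalDirectSum {ι V : Type*} [AddCommGroup V] [Module ℂ V] [TopologicalSpace V]
    (W : ι → Submodule ℂ V) : Prop :=
  ∃ P : ι → V →L[ℂ] V, ∀ v : V, (∀ i, P i v ∈ W i) ∧ HasSum (fun i => P i v) v ∧
    ∀ w : ι → V, (∀ i, w i ∈ W i) → HasSum w v → ∀ i, w i = P i v

end LightCone

end

/-! ### Harmonic polynomials: the Laplacian, linear isometries, examples -/

namespace LightCone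

open MvPolynomial

variable {p q : ℕ}

/-! Every ray of the cone meets the product Ω of the two unit spheres exactly once, so a function in
S^a is determined by its restriction to Ω. The restriction `resOm` is injective and equivariant, and
since r = 1 on Ω it maps V_{m,n} onto the products of spherical harmonics `biharm p q m n`, whatever
a is. The algebraic part of the theorem is thus a statement about C(Ω).

Irreducibility (`biharm_irreducible`): in a nonzero invariant subspace the function representing
evaluation at a pole is bizonal and nonzero at that pole. Bizonal elements of `biharm p q m n` are
determined by their value at the pole, because harmonicity is a two-term recursion for their
coefficients. Two orthogonal nonzero invariant subspaces would therefore share a line.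

Inequivalence (`le_of_equivariant`): (x_i + I x_j)^m is harmonic of weight m under rotations of the
(i, j)-plane, and a polynomial of degree less than m has no such weight. Hence an injective
equivariant map can only raise degrees, and an equivalence preserves them. With irreducibility this
also makes distinct components orthogonal (`inner_eq_zero_of_ne`). Their span is dense in C(Ω), by
the Stone-Weierstrass theorem and the decomposition of a polynomial into products r^(2j) h with h
harmonic (`mem_radialHarmonic`).

Convergence in S^a needs two estimates. First, the components of f decay faster than any power of m
+ n: f on Ω extends to a Schwartz function, hence is a superposition of plane waves by Fourier
inversion. A component of degree (m, n) is orthogonal to all polynomials of degree less than m + n,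
so the Taylor polynomial of the plane wave may be subtracted. The remainder is exponentially small
unless the frequency is comparable to m + n, and there the Fourier transform is small. Second,
derivatives of a component exceed its maximum by a factor polynomial in m + n at most, by a weak
Bernstein inequality (`norm_iteratedFDeriv_le_of_mem_bihom`). The expansion can then be
differentiated term by term along every parametrization. Uniqueness follows by applying the
continuous map `resOm` and the orthogonality in L². -/

lemma laplacian_apply (P : MvPolynomial (Fin p) ℂ) :
    laplacian p P = ∑ i, pderiv i (pderiv i P) := by
  simp [laplacian]

lemma mem_H {m : ℕ} {P : MvPolynomial (Fin p) ℂ} :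
    P ∈ H p m ↔ P.IsHomogeneous m ∧ laplacian p P = 0 := by
  simp [H]

/-- The polynomial `∑ x_i²`. -/
noncomputable def rsq (p : ℕ) : MvPolynomial (Fin p) ℂ := ∑ i, X i ^ 2

lemma isHomogeneous_rsq (p : ℕ) : (rsq p).IsHomogeneous 2 :=
  IsHomogeneous.sum _ _ _ fun i _ => isHomogeneous_X_pow i 2

lemma laplacian_mul (P Q : MvPolynomial (Fin p) ℂ) :
    laplacian p (P * Q) =
      laplacian p P * Q + 2 * ∑ i, pderiv i P * pderiv i Q + P * laplacian p Q := by
  simp only [laplacian_apply, Finset.mul_sum, Finset.sum_mul, ← Finset.sum_add_distrib]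
  refine Finset.sum_congr rfl fun i _ => ?_
  simp only [Derivation.leibniz, smul_eq_mul, map_add]
  ring

lemma pderiv_rsq (i : Fin p) : pderiv i (rsq p) = 2 * X i := by
  classical
  simp only [rsq, map_sum, pderiv_pow, pderiv_X]
  rw [Finset.sum_eq_single i]
  · simp
  · intro j _ hj
    simp [hj]
  · simp

lemma laplacian_rsq : laplacian p (rsq p) = C ((2 * p : ℕ) : ℂ) := by
  simp only [laplacian_apply, pderiv_rsq]
  have : ∀ i : Fin p, pderiv i ((2 : MvPolynomial (Fin p) ℂ) * X i) = C 2 := by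
    intro i
    have h2 : (2 : MvPolynomial (Fin p) ℂ) = C 2 := (map_ofNat C 2).symm
    rw [h2, pderiv_C_mul, pderiv_X_self, mul_one]
  simp only [this, Finset.sum_const, Finset.card_univ, Fintype.card_fin, nsmul_eq_mul]
  simp [mul_comm]

/-- The gradient of r² is 2x, so the cross term of the product rule is four times Euler's operator,
which is k on degree k. -/
lemma laplacian_rsq_mul {k : ℕ} {P : MvPolynomial (Fin p) ℂ} (hP : P.IsHomogeneous k) :
    laplacian p (rsq p * P) = C ((2 * p + 4 * k : ℕ) : ℂ) * P + rsq p * laplacian p P := by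
  rw [laplacian_mul, laplacian_rsq]
  have h := hP.sum_X_mul_pderiv
  have h2 : ∑ i, pderiv i (rsq p) * pderiv i P = 2 * (k • P) := by
    rw [← h, Finset.mul_sum]
    refine Finset.sum_congr rfl fun i _ => ?_
    rw [pderiv_rsq]; ring
  rw [h2]
  simp only [nsmul_eq_mul, Nat.cast_add, Nat.cast_mul, map_add, map_mul, map_natCast]
  simp
  ring

lemma IsHomogeneous.laplacian {k : ℕ} {P : MvPolynomial (Fin p) ℂ} (hP : P.IsHomogeneous k) :
    (laplacian p P).IsHomogeneous (k - 2) := by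
  rw [laplacian_apply]
  refine IsHomogeneous.sum _ _ _ fun i _ => ?_
  have := (hP.pderiv (i := i)).pderiv (i := i)
  simpa [Nat.sub_sub] using this

lemma laplacian_eq_zero_of_lt {k : ℕ} {P : MvPolynomial (Fin p) ℂ} (hP : P.IsHomogeneous k)
    (hk : k < 2) : laplacian p P = 0 := by
  rw [laplacian_apply]
  refine Finset.sum_eq_zero fun i _ => ?_
  have h1 := hP.pderiv (i := i)
  have h0 : k - 1 = 0 := by omega
  rw [h0] at h1
  rw [← totalDegree_zero_iff_isHomogeneous, totalDegree_eq_zero_iff_eq_C] at h1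
  rw [h1, pderiv_C]

/-- The products of powers of `r²` with harmonic polynomials, of total degree `k`. -/
noncomputable def radialHarmonic (p k : ℕ) : Submodule ℂ (MvPolynomial (Fin p) ℂ) :=
  Submodule.span ℂ {P | ∃ j d : ℕ, 2 * j + d = k ∧ ∃ h ∈ H p d, P = rsq p ^ j * h}

/-- The Laplacian lowers the power of r² by one. Only the nonvanishing of the factor matters: it is
a sum of terms 2p + 4k, positive because p ≥ 1. -/
lemma exists_laplacian_rsq_pow_mul {d : ℕ} {h : MvPolynomial (Fin p) ℂ} (hp : 1 ≤ p)
    (hh : h ∈ H p d) (j : ℕ) :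
    ∃ c : ℕ, c ≠ 0 ∧ laplacian p (rsq p ^ (j + 1) * h) = C (c : ℂ) * (rsq p ^ j * h) := by
  have hhom : ∀ j : ℕ, (rsq p ^ j * h).IsHomogeneous (2 * j + d) := fun j =>
    ((isHomogeneous_rsq p).pow j).mul (mem_H.1 hh).1
  induction j with
  | zero =>
    refine ⟨2 * p + 4 * d, by omega, ?_⟩
    rw [zero_add, pow_one, laplacian_rsq_mul (mem_H.1 hh).1, (mem_H.1 hh).2]
    simp
  | succ j ih =>
    obtain ⟨c, hc, h1⟩ := ih
    refine ⟨2 * p + 4 * (2 * (j + 1) + d) + c, by omega, ?_⟩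
    rw [pow_succ' _ (j + 1), mul_assoc, laplacian_rsq_mul (hhom (j + 1)), h1]
    simp only [Nat.cast_add, map_add]
    ring

/-- The Laplacian of P has degree k - 2, so by induction it lies in the span. There the Laplacian
has explicit preimages, obtained by raising the power of r², and P minus such a preimage is
harmonic. -/
lemma mem_radialHarmonic (hp : 1 ≤ p) (k : ℕ) :
    ∀ P : MvPolynomial (Fin p) ℂ, P.IsHomogeneous k → P ∈ radialHarmonic p k := by
  induction k using Nat.strong_induction_on with
  | _ k ih =>
    intro P hP
    by_cases hk : k < 2
    · exact Submodule.subset_span ⟨0, k, by omega, P,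
        mem_H.2 ⟨hP, laplacian_eq_zero_of_lt hP hk⟩, by simp⟩
    · have key : ∀ Q ∈ radialHarmonic p (k - 2), ∃ R ∈ radialHarmonic p k,
          R.IsHomogeneous k ∧ laplacian p R = Q := by
        intro Q hQ
        induction hQ using Submodule.span_induction with
        | mem Q hQ =>
          obtain ⟨j, d, hjd, h, hh, rfl⟩ := hQ
          obtain ⟨c, hc, h1⟩ := exists_laplacian_rsq_pow_mul hp hh j
          have hc' : (c : ℂ) ≠ 0 := by exact_mod_cast hc
          refine ⟨(c : ℂ)⁻¹ • (rsq p ^ (j + 1) * h), Submodule.smul_mem _ _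
            (Submodule.subset_span ⟨j + 1, d, by omega, h, hh, rfl⟩), ?_, ?_⟩
          · rw [smul_eq_C_mul]
            have h2 := ((isHomogeneous_rsq p).pow (j + 1)).mul (mem_H.1 hh).1
            have h3 : 2 * (j + 1) + d = k := by omega
            rw [h3] at h2
            exact h2.C_mul _
          · rw [map_smul, h1, ← smul_eq_C_mul, smul_smul, inv_mul_cancel₀ hc', one_smul]
        | zero => exact ⟨0, zero_mem _, isHomogeneous_zero _ _ _, map_zero _⟩
        | add Q Q' _ _ h h' =>
          obtain ⟨R, h1, h2, rfl⟩ := h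
          obtain ⟨R', h1', h2', rfl⟩ := h'
          exact ⟨R + R', add_mem h1 h1', h2.add h2', map_add _ _ _⟩
        | smul a Q _ h =>
          obtain ⟨R, h1, h2, rfl⟩ := h
          exact ⟨a • R, Submodule.smul_mem _ _ h1, by rw [smul_eq_C_mul]; exact h2.C_mul _,
            map_smul _ _ _⟩
      obtain ⟨R, h1, h2, h3⟩ := key _ (ih (k - 2) (by omega) _ (IsHomogeneous.laplacian hP))
      have h4 : P - R ∈ radialHarmonic p k := Submodule.subset_span ⟨0, k, by omega, P - R,
        mem_H.2 ⟨hP.sub h2, by rw [map_sub, h3, sub_self]⟩, by simp⟩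
      simpa using add_mem h4 h1

lemma evalAt_eq (P : MvPolynomial (Fin p) ℂ) (x : E p) :
    evalAt P x = aeval (fun i => (x i : ℂ)) P := by
  simp [evalAt, aeval_eq_eval]

lemma evalAt_add (P Q : MvPolynomial (Fin p) ℂ) (x : E p) :
    evalAt (P + Q) x = evalAt P x + evalAt Q x := by simp [evalAt]

lemma evalAt_mul (P Q : MvPolynomial (Fin p) ℂ) (x : E p) :
    evalAt (P * Q) x = evalAt P x * evalAt Q x := by simp [evalAt]

lemma evalAt_rsq (x : E p) : evalAt (rsq p) x = ((‖x‖ ^ 2 : ℝ) : ℂ) := by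
  simp [evalAt, rsq, EuclideanSpace.norm_sq_eq]

/-- The reals are infinite in ℂ, so a complex polynomial is determined by its real points. -/
lemma evalAt_injective {P Q : MvPolynomial (Fin p) ℂ} (h : ∀ x, evalAt P x = evalAt Q x) :
    P = Q := by
  refine MvPolynomial.funext_set (fun _ => Set.range ((↑) : ℝ → ℂ))
    (fun _ => Set.infinite_range_of_injective Complex.ofReal_injective) ?_
  intro y hy
  choose x hx using fun i => hy i (Set.mem_univ i)
  have := h (WithLp.toLp 2 x)
  simpa [evalAt, hx] using this

lemma evalAt_smul_of_isHomogeneous {m : ℕ} {P : MvPolynomial (Fin p) ℂ} (hP : P.IsHomogeneous m)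
    (t : ℝ) (x : E p) : evalAt P (t • x) = (t : ℂ) ^ m * evalAt P x := by
  simp only [evalAt, MvPolynomial.eval_eq']
  rw [Finset.mul_sum]
  refine Finset.sum_congr rfl fun d hd => ?_
  have hdeg : ∑ i, d i = m := by
    have h2 := hP (MvPolynomial.mem_support_iff.1 hd)
    rw [Finsupp.weight_apply, Finsupp.sum_fintype _ _ (by simp)] at h2
    simpa using h2
  simp only [PiLp.smul_apply, smul_eq_mul, Complex.ofReal_mul, mul_pow]
  rw [Finset.prod_mul_distrib, Finset.prod_pow_eq_pow_sum, hdeg]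
  ring

/-- The chain rule for the substitution of polynomials. -/
lemma pderiv_aeval_eq (f : Fin p → MvPolynomial (Fin p) ℂ) (j : Fin p)
    (P : MvPolynomial (Fin p) ℂ) :
    pderiv j (aeval f P) = ∑ i, aeval f (pderiv i P) * pderiv j (f i) := by
  classical
  induction P using MvPolynomial.induction_on with
  | C c => simp [algebraMap_eq]
  | add P Q hP hQ => simp only [map_add, hP, hQ, add_mul, Finset.sum_add_distrib]
  | mul_X P i hP =>
    simp only [map_mul, aeval_X, Derivation.leibniz, hP, smul_eq_mul, map_add, pderiv_X, add_mul,
      Finset.sum_add_distrib, Finset.mul_sum]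
    congr 1
    · rw [Finset.sum_eq_single i]
      · simp
      · intro k _ hk
        simp [hk.symm]
      · simp
    · refine Finset.sum_congr rfl fun k _ => ?_
      ring

/-- The substitution of a linear isometry into a polynomial. -/
noncomputable def rotate (g : E p ≃ₗᵢ[ℝ] E p) :
    MvPolynomial (Fin p) ℂ →ₐ[ℂ] MvPolynomial (Fin p) ℂ :=
  aeval fun i => ∑ j, C ((g (EuclideanSpace.single j 1) i : ℝ) : ℂ) * X j

lemma evalAt_rotate (g : E p ≃ₗᵢ[ℝ] E p) (P : MvPolynomial (Fin p) ℂ) (x : E p) :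
    evalAt (rotate g P) x = evalAt P (g x) := by
  have hx : ∀ i, (g x) i = ∑ j, g (EuclideanSpace.single j 1) i * x j := by
    intro i
    have h1 : x = ∑ j, x j • EuclideanSpace.single j (1 : ℝ) := by
      ext k
      simp [Finset.sum_apply, Pi.single_apply]
    conv_lhs => rw [h1]
    simp [mul_comm]
  simp only [evalAt_eq, rotate]
  rw [comp_aeval_apply]
  congr 2
  ext i
  simp [hx]

/-- The rows of an orthogonal matrix are orthonormal: row i is the image of a basis vector under the
inverse isometry. -/
lemma sum_isometry_mul (g : E p ≃ₗᵢ[ℝ] E p) (i k : Fin p) :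
    ∑ j, g (EuclideanSpace.single j 1) i * g (EuclideanSpace.single j 1) k =
      if i = k then 1 else 0 := by
  have h1 : ∀ j i, g (EuclideanSpace.single j (1 : ℝ)) i =
      g.symm (EuclideanSpace.single i 1) j := by
    intro j i
    have h2 := g.inner_map_map (EuclideanSpace.single j (1 : ℝ))
      (g.symm (EuclideanSpace.single i 1))
    rw [g.apply_symm_apply] at h2
    simpa [EuclideanSpace.inner_single_left, EuclideanSpace.inner_single_right] using h2
  simp only [h1]
  have h3 := g.symm.inner_map_map (EuclideanSpace.single k (1 : ℝ)) (EuclideanSpace.single i 1)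
  rw [PiLp.inner_apply] at h3
  simpa [EuclideanSpace.inner_single_left, Pi.single_apply, eq_comm] using h3

/-- The chain rule, applied twice, yields all second derivatives of P, weighted with inner products
of matrix rows. Orthonormality leaves the diagonal ones. -/
lemma laplacian_rotate (g : E p ≃ₗᵢ[ℝ] E p) (P : MvPolynomial (Fin p) ℂ) :
    laplacian p (rotate g P) = rotate g (laplacian p P) := by
  classical
  set f : Fin p → MvPolynomial (Fin p) ℂ :=
    fun i => ∑ j, C ((g (EuclideanSpace.single j 1) i : ℝ) : ℂ) * X j with hf
  have hd : ∀ i j, pderiv j (f i) = C ((g (EuclideanSpace.single j 1) i : ℝ) : ℂ) := by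
    intro i j
    simp only [hf, map_sum, pderiv_C_mul, pderiv_X]
    rw [Finset.sum_eq_single j]
    · simp
    · intro k _ hk
      simp [hk]
    · simp
  have h1 : ∀ j, pderiv j (pderiv j (rotate g P)) = ∑ i, ∑ k,
      aeval f (pderiv k (pderiv i P)) *
        C ((g (EuclideanSpace.single j 1) i * g (EuclideanSpace.single j 1) k : ℝ) : ℂ) := by
    intro j
    rw [rotate, pderiv_aeval_eq f, map_sum]
    refine Finset.sum_congr rfl fun i _ => ?_
    rw [Derivation.leibniz, hd, pderiv_C, smul_zero, zero_add, pderiv_aeval_eq f, smul_eq_mul,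
      Finset.mul_sum]
    refine Finset.sum_congr rfl fun k _ => ?_
    rw [hd, Complex.ofReal_mul, map_mul]
    ring
  rw [laplacian_apply, laplacian_apply]
  simp only [h1]
  rw [Finset.sum_comm, map_sum]
  refine Finset.sum_congr rfl fun i _ => ?_
  rw [Finset.sum_comm, Finset.sum_eq_single i]
  · rw [← Finset.mul_sum, ← map_sum, ← Complex.ofReal_sum, sum_isometry_mul]
    simp [rotate, hf]
  · intro k _ hk
    rw [← Finset.mul_sum, ← map_sum, ← Complex.ofReal_sum, sum_isometry_mul]
    simp [hk.symm]
  · simp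

lemma rotate_mem_H (g : E p ≃ₗᵢ[ℝ] E p) {m : ℕ} {P : MvPolynomial (Fin p) ℂ} (hP : P ∈ H p m) :
    rotate g P ∈ H p m := by
  rw [mem_H] at hP ⊢
  refine ⟨?_, by rw [laplacian_rotate, hP.2, map_zero]⟩
  have := hP.1.aeval (n := 1) (fun i => ∑ j, C ((g (EuclideanSpace.single j 1) i : ℝ) : ℂ) * X j)
    (fun i => IsHomogeneous.sum _ _ _ fun j _ => isHomogeneous_C_mul_X _ _)
  rwa [one_mul] at this

/-- In one variable harmonic means P'' = 0. Euler's identity for P', of degree m - 1 ≥ 1, gives P' =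
0, and then for P gives P = 0. -/
lemma H_one_eq_bot {m : ℕ} (hm : 2 ≤ m) : H 1 m = ⊥ := by
  rw [eq_bot_iff]
  intro P hP
  rw [mem_H, laplacian_apply] at hP
  obtain ⟨h1, h2⟩ := hP
  simp only [Finset.univ_unique, Finset.sum_singleton] at h2
  have h3 := (h1.pderiv (i := default)).sum_X_mul_pderiv
  have h4 := h1.sum_X_mul_pderiv
  simp only [Finset.univ_unique, Finset.sum_singleton, h2, mul_zero] at h3
  have h5 : pderiv (default : Fin 1) P = 0 := by
    have := h3.symm
    rw [nsmul_eq_mul] at this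
    rcases mul_eq_zero.1 this with h | h
    · exact absurd h (by exact_mod_cast (by omega : m - 1 ≠ 0))
    · exact h
  simp only [Finset.univ_unique, Finset.sum_singleton, h5, mul_zero] at h4
  have := h4.symm
  rw [nsmul_eq_mul] at this
  rcases mul_eq_zero.1 this with h | h
  · exact absurd h (by exact_mod_cast (by omega : m ≠ 0))
  · exact h

/-- The gradient of the linear form is isotropic (1 + I² = 0), so all its powers are harmonic. They
serve as weight vectors for the rotations of the (i, j)-plane. -/
lemma X_add_I_mul_X_pow_mem_H {i j : Fin p} (hij : i ≠ j) (m : ℕ) :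
    (X i + C Complex.I * X j) ^ m ∈ H p m := by
  classical
  rw [mem_H]
  constructor
  · have := (((isHomogeneous_X ℂ i).add (isHomogeneous_C_mul_X Complex.I j)).pow m)
    simpa using this
  · set z : MvPolynomial (Fin p) ℂ := X i + C Complex.I * X j with hz
    set d : Fin p → ℂ := fun k => (if k = i then 1 else 0) + Complex.I * if k = j then 1 else 0
    have hd : ∀ k, pderiv k z = C (d k) := by
      intro k
      simp only [hz, d, map_add, pderiv_C_mul, pderiv_X, Pi.single_apply, map_mul]
      congr 1
      · rw [apply_ite C, map_one, map_zero]
        simp only [eq_comm]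
      · rw [apply_ite C, map_one, map_zero]
        simp only [eq_comm]
    have hdd : ∑ k, d k * d k = 0 := by
      have : ∀ k, d k * d k = (if k = i then 1 else 0) - (if k = j then 1 else 0) := by
        intro k
        simp only [d]
        split_ifs with h1 h2
        · exact absurd (h1.symm.trans h2) hij
        all_goals simp
      simp [this]
    rw [laplacian_apply]
    have : ∀ k, pderiv k (pderiv k (z ^ m)) = C (m * ((m - 1 : ℕ) : ℂ)) * z ^ (m - 1 - 1) * C (d k * d k) := by
      intro k
      rw [pderiv_pow, hd, Derivation.leibniz, pderiv_C, smul_zero, zero_add, Derivation.leibniz,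
        pderiv_pow, hd]
      simp only [smul_eq_mul, map_mul, map_natCast]
      have : pderiv k ((m : MvPolynomial (Fin p) ℂ)) = 0 := by
        rw [← map_natCast C, pderiv_C]
      rw [this]
      ring
    simp only [this]
    rw [← Finset.mul_sum, ← map_sum, hdd]
    simp

end LightCone

/-! ### Zonal harmonics are determined by their value at the pole -/

namespace LightCone

open MvPolynomial

variable {p q : ℕ}

/-- The reflection that exchanges u and v fixes the pole, which is orthogonal to u - v. One
reflection suffices in every dimension. -/
lemma exists_isometry_fixing (i₀ : Fin p) {u v : E p} (h₀ : u i₀ = v i₀) (hn : ‖u‖ = ‖v‖) :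
    ∃ g : E p ≃ₗᵢ[ℝ] E p,
      g (EuclideanSpace.single i₀ 1) = EuclideanSpace.single i₀ 1 ∧ g u = v := by
  refine ⟨(ℝ ∙ (u - v))ᗮ.reflection, ?_, Submodule.reflection_sub hn⟩
  rw [Submodule.reflection_eq_self_iff, Submodule.mem_orthogonal_singleton_iff_inner_right]
  simp [EuclideanSpace.inner_single_right, h₀]

/-- The polynomial `∑ x_i²`, the sum over all `i ≠ i₀`. -/
noncomputable def rsqErase (i₀ : Fin p) : MvPolynomial (Fin p) ℂ :=
  ∑ i ∈ Finset.univ.erase i₀, X i ^ 2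

lemma pderiv_rsqErase (i₀ i : Fin p) :
    pderiv i (rsqErase i₀) = if i = i₀ then 0 else C 2 * X i := by
  classical
  have h : rsqErase i₀ = rsq p - X i₀ ^ 2 := by
    rw [rsqErase, rsq, ← Finset.add_sum_erase _ _ (Finset.mem_univ i₀)]
    ring
  rw [h, map_sub, pderiv_rsq, pderiv_pow]
  have h2 : (2 : MvPolynomial (Fin p) ℂ) = C 2 := (map_ofNat C 2).symm
  split_ifs with hi
  · subst hi
    simp
  · rw [pderiv_X_of_ne (Ne.symm hi), h2]
    ring

/-- The two factors involve disjoint sets of variables, so there is no cross term. Where an exponent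
is truncated at zero, its coefficient vanishes. -/
lemma laplacian_X_pow_mul_rsqErase_pow (i₀ : Fin p) (a k : ℕ) :
    laplacian p (X i₀ ^ a * rsqErase i₀ ^ k) =
      C ((a * (a - 1) : ℕ) : ℂ) * (X i₀ ^ (a - 2) * rsqErase i₀ ^ k) +
        C ((4 * k * (k - 1) + 2 * k * (p - 1) : ℕ) : ℂ) *
          (X i₀ ^ a * rsqErase i₀ ^ (k - 1)) := by
  classical
  set R := rsqErase i₀ with hR
  have hnat : ∀ (i : Fin p) (n : ℕ), pderiv i ((n : MvPolynomial (Fin p) ℂ)) = 0 := by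
    intro i n
    rw [← map_natCast C, pderiv_C]
  have h1 : ∀ i, pderiv i (R ^ k) = if i = i₀ then 0 else C (2 * k : ℂ) * (R ^ (k - 1) * X i) := by
    intro i
    rw [pderiv_pow, hR, pderiv_rsqErase]
    split_ifs
    · simp
    · rw [map_mul, map_natCast]; ring
  have h2 : laplacian p (R ^ k) =
      C ((4 * k * (k - 1) + 2 * k * (p - 1) : ℕ) : ℂ) * R ^ (k - 1) := by
    rw [laplacian_apply, ← Finset.add_sum_erase _ _ (Finset.mem_univ i₀), h1, if_pos rfl, map_zero,
      zero_add]
    have h3 : ∀ i ∈ Finset.univ.erase i₀, pderiv i (pderiv i (R ^ k)) =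
        C (4 * k * ((k - 1 : ℕ) : ℂ)) * (R ^ (k - 1 - 1) * X i ^ 2) + C (2 * k : ℂ) * R ^ (k - 1) := by
      intro i hi
      have hi' := Finset.ne_of_mem_erase hi
      rw [h1, if_neg hi', pderiv_C_mul, Derivation.leibniz, pderiv_pow, pderiv_X_self, hR,
        pderiv_rsqErase, if_neg hi']
      simp only [smul_eq_mul, map_mul, map_natCast]
      have h2 : (C 4 : MvPolynomial (Fin p) ℂ) = C 2 * C 2 := by rw [← map_mul]; norm_num
      rw [h2]
      ring
    rw [Finset.sum_congr rfl h3, Finset.sum_add_distrib, ← Finset.mul_sum, ← Finset.mul_sum]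
    have h4 : ∑ i ∈ Finset.univ.erase i₀, (X i : MvPolynomial (Fin p) ℂ) ^ 2 = R := rfl
    rw [h4, Finset.sum_const, Finset.card_erase_of_mem (Finset.mem_univ _), Finset.card_univ,
      Fintype.card_fin, Nat.cast_add, map_add, add_mul]
    congr 1
    · rcases k with _ | _ | k
      · simp
      · simp
      · simp only [Nat.add_sub_cancel, pow_succ R k]
        push_cast
        ring
    · simp only [nsmul_eq_mul]
      push_cast
      simp only [map_mul, map_natCast]
      ring
  have h3 : laplacian p (X i₀ ^ a : MvPolynomial (Fin p) ℂ) =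
      C ((a * (a - 1) : ℕ) : ℂ) * X i₀ ^ (a - 2) := by
    rw [laplacian_apply, Finset.sum_eq_single i₀]
    · rw [pderiv_pow, pderiv_X_self, mul_one, Derivation.leibniz, pderiv_pow, pderiv_X_self, hnat]
      simp only [Nat.cast_mul, map_mul, map_natCast, smul_eq_mul, Nat.sub_sub]
      ring
    · intro i _ hi
      rw [pderiv_pow, pderiv_X_of_ne hi.symm, mul_zero, map_zero]
    · simp
  have h4 : ∑ i, pderiv i (X i₀ ^ a : MvPolynomial (Fin p) ℂ) * pderiv i (R ^ k) = 0 := by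
    refine Finset.sum_eq_zero fun i _ => ?_
    by_cases hi : i = i₀
    · rw [h1, if_pos hi, mul_zero]
    · rw [pderiv_pow, pderiv_X_of_ne (Ne.symm hi), mul_zero, zero_mul]
  rw [laplacian_mul, h2, h3, h4]
  ring

lemma evalAt_sum {ι : Type*} (s : Finset ι) (f : ι → MvPolynomial (Fin p) ℂ) (x : E p) :
    evalAt (∑ i ∈ s, f i) x = ∑ i ∈ s, evalAt (f i) x := by simp [evalAt]

lemma evalAt_pow (P : MvPolynomial (Fin p) ℂ) (n : ℕ) (x : E p) :
    evalAt (P ^ n) x = evalAt P x ^ n := by simp [evalAt]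

@[simp] lemma evalAt_C (c : ℂ) (x : E p) : evalAt (C c) x = c := by simp [evalAt]

@[simp] lemma evalAt_X (i : Fin p) (x : E p) : evalAt (X i) x = x i := by simp [evalAt]

lemma evalAt_sub (P Q : MvPolynomial (Fin p) ℂ) (x : E p) :
    evalAt (P - Q) x = evalAt P x - evalAt Q x := by simp [evalAt]

lemma norm_single_add_single_sq {i₀ i₁ : Fin p} (h01 : i₁ ≠ i₀) (t : ℝ) :
    ‖EuclideanSpace.single i₀ (1 : ℝ) + EuclideanSpace.single i₁ t‖ ^ 2 = 1 + t ^ 2 := by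
  rw [norm_add_sq_real]
  simp [EuclideanSpace.inner_single_left, h01.symm]

lemma evalAt_rsqErase (i₀ : Fin p) (x : E p) :
    evalAt (rsqErase i₀) x = ((‖x‖ ^ 2 - x i₀ ^ 2 : ℝ) : ℂ) := by
  rw [EuclideanSpace.real_norm_sq_eq, ← Finset.add_sum_erase _ _ (Finset.mem_univ i₀)]
  simp [rsqErase, evalAt_sum, evalAt_pow, evalAt_sub]

/-- The coefficients of a polynomial invariant under the stabilizer of a unit vector, as a
polynomial in the distance from the axis. -/
lemma exists_zonal_expansion {i₀ i₁ : Fin p} (h01 : i₁ ≠ i₀) {m : ℕ}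
    {h : MvPolynomial (Fin p) ℂ} (hh : h.IsHomogeneous m)
    (hinv : ∀ g : E p ≃ₗᵢ[ℝ] E p,
      g (EuclideanSpace.single i₀ 1) = EuclideanSpace.single i₀ 1 →
        ∀ x, evalAt h (g x) = evalAt h x) :
    ∃ c : ℕ → ℂ, c 0 = evalAt h (EuclideanSpace.single i₀ 1) ∧
      h = ∑ k ∈ Finset.range (m / 2 + 1), C (c k) * (X i₀ ^ (m - 2 * k) * rsqErase i₀ ^ k) := by
  classical
  -- The restriction of h to the line through the pole in direction i₁. The coefficients c are read
  -- off from it.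
  set g : Polynomial ℂ :=
    aeval (fun i => if i = i₀ then 1 else if i = i₁ then Polynomial.X else 0) h with hg
  have hgdeg : g.natDegree ≤ m := by
    have := MvPolynomial.aeval_natDegree_le h hh.totalDegree_le
      (fun i => if i = i₀ then 1 else if i = i₁ then Polynomial.X else 0) (n := 1) (by
        intro i
        split_ifs <;> simp)
    simpa using this
  set pt : ℝ → E p := fun t => EuclideanSpace.single i₀ 1 + EuclideanSpace.single i₁ t with hpt
  have hpt0 : ∀ t, pt t i₀ = 1 := by
    intro t; simp [hpt, h01.symm]
  have hptn : ∀ t, ‖pt t‖ ^ 2 = 1 + t ^ 2 := by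
    exact fun t => norm_single_add_single_sq h01 t
  have hgev : ∀ t : ℝ, g.eval (t : ℂ) = evalAt h (pt t) := by
    intro t
    rw [evalAt_eq, hg, ← Polynomial.coe_aeval_eq_eval, comp_aeval_apply]
    congr 2
    ext i
    simp only [hpt, PiLp.add_apply, PiLp.single_apply]
    by_cases h0 : i = i₀
    · subst h0
      simp [h01.symm]
    · by_cases h1 : i = i₁
      · subst h1
        simp [h01]
      · simp [h0, h1]
  have hsame : ∀ u v : E p, u i₀ = v i₀ → ‖u‖ = ‖v‖ → evalAt h u = evalAt h v := by
    intro u v h0 hn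
    obtain ⟨r, hr, hruv⟩ := exists_isometry_fixing i₀ h0 hn
    rw [← hruv, hinv r hr]
  -- The points with parameters t and -t have equal norm and equal height over the axis, so the
  -- stabilizer identifies them. Hence g is a polynomial in t².
  have heven : g.comp (-Polynomial.X) = g := by
    refine Polynomial.eq_of_infinite_eval_eq _ _
      ((Set.infinite_range_of_injective Complex.ofReal_injective).mono ?_)
    rintro _ ⟨t, rfl⟩
    have : ((-t : ℝ) : ℂ) = -(t : ℂ) := by push_cast; ring
    simp only [Set.mem_ofPred_eq, Polynomial.eval_comp, Polynomial.eval_neg, Polynomial.eval_X]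
    rw [← this, hgev, hgev]
    refine hsame _ _ (by rw [hpt0, hpt0]) ?_
    rw [← sq_eq_sq₀ (norm_nonneg _) (norm_nonneg _), hptn, hptn, neg_sq]
  have hodd : ∀ n, ¬ 2 ∣ n → g.coeff n = 0 := by
    intro n hn
    have h1 := congrArg (fun P => Polynomial.coeff P n) heven
    have h2 : (-Polynomial.X : Polynomial ℂ) = Polynomial.C (-1) * Polynomial.X := by simp
    simp only [h2, Polynomial.comp_C_mul_X_coeff] at h1
    rw [Odd.neg_one_pow (Nat.odd_iff.2 (by omega))] at h1
    linear_combination (-1 / 2 : ℂ) * h1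
  set c := Polynomial.contract 2 g with hc
  have hgc : g = Polynomial.expand ℂ 2 c := by
    ext n
    rw [Polynomial.coeff_expand (by norm_num)]
    split_ifs with hn
    · rw [hc, Polynomial.coeff_contract (by norm_num), Nat.div_mul_cancel hn]
    · exact hodd n hn
  have hcdeg : c.natDegree < m / 2 + 1 := by
    have : g.natDegree = c.natDegree * 2 := by rw [hgc, Polynomial.natDegree_expand]
    omega
  refine ⟨c.coeff, ?_, ?_⟩
  · rw [hc, Polynomial.coeff_contract (by norm_num), zero_mul, Polynomial.coeff_zero_eq_eval_zero]
    have := hgev 0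
    rw [Complex.ofReal_zero] at this
    rw [this]
    congr 1
    simp [hpt]
  · have hX : (X i₀ : MvPolynomial (Fin p) ℂ) ≠ 0 := X_ne_zero i₀
    -- The extra factor X i₀ makes the hyperplane x i₀ = 0 trivial, so that division by x i₀ is
    -- allowed elsewhere.
    refine mul_left_cancel₀ hX (evalAt_injective fun x => ?_)
    rw [evalAt_mul, evalAt_mul, evalAt_X]
    by_cases hx : x i₀ = 0
    · simp [hx]
    congr 1
    have hle : 0 ≤ ‖x‖ ^ 2 - x i₀ ^ 2 := by
      rw [EuclideanSpace.real_norm_sq_eq, ← Finset.add_sum_erase _ _ (Finset.mem_univ i₀)]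
      have : 0 ≤ ∑ i ∈ Finset.univ.erase i₀, x i ^ 2 := Finset.sum_nonneg fun i _ => sq_nonneg _
      linarith
    -- Scaling to height 1 and rotating about the axis moves x to the test line; t is the distance
    -- from the axis divided by the height.
    have h1 : evalAt h x = (x i₀ : ℂ) ^ m *
        evalAt h (pt (Real.sqrt (‖x‖ ^ 2 - x i₀ ^ 2) / x i₀)) := by
      have h2 : x = x i₀ • ((x i₀)⁻¹ • x) := by rw [smul_smul, mul_inv_cancel₀ hx, one_smul]
      conv_lhs => rw [h2, evalAt_smul_of_isHomogeneous hh]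
      congr 1
      refine hsame _ _ (by rw [hpt0]; simp [hx]) ?_
      rw [← sq_eq_sq₀ (norm_nonneg _) (norm_nonneg _), hptn, norm_smul, mul_pow, div_pow,
        Real.sq_sqrt hle]
      rw [norm_inv, inv_pow, Real.norm_eq_abs, sq_abs]
      field_simp
      ring
    rw [h1, ← hgev, hgc, Polynomial.expand_eval, Polynomial.eval_eq_sum_range' hcdeg, evalAt_sum,
      Finset.mul_sum]
    refine Finset.sum_congr rfl fun k hk => ?_
    have hk' : 2 * k ≤ m := by
      have := Finset.mem_range.1 hk
      omega
    have hxc : (x i₀ : ℂ) ≠ 0 := by exact_mod_cast hx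
    rw [evalAt_mul, evalAt_C, evalAt_mul, evalAt_pow, evalAt_pow, evalAt_X, evalAt_rsqErase,
      ← Complex.ofReal_pow (_ / _), div_pow, Real.sq_sqrt hle]
    have h3 : (x i₀ : ℂ) ^ m = (x i₀ : ℂ) ^ (m - 2 * k) * ((x i₀ : ℂ) ^ 2) ^ k := by
      rw [← pow_mul, ← pow_add]
      congr 1
      omega
    rw [h3, Complex.ofReal_div, Complex.ofReal_pow (x i₀), div_pow]
    field_simp

/-- A zonal harmonic polynomial which vanishes at the pole is zero. -/
lemma eq_zero_of_zonal (i₀ : Fin p) {m : ℕ} {h : MvPolynomial (Fin p) ℂ} (hh : h ∈ H p m)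
    (hinv : ∀ g : E p ≃ₗᵢ[ℝ] E p,
      g (EuclideanSpace.single i₀ 1) = EuclideanSpace.single i₀ 1 →
        ∀ x, evalAt h (g x) = evalAt h x)
    (h0 : evalAt h (EuclideanSpace.single i₀ 1) = 0) : h = 0 := by
  classical
  rw [mem_H] at hh
  by_cases hex : ∃ i₁ : Fin p, i₁ ≠ i₀
  swap
  · push Not at hex
    refine evalAt_injective fun x => ?_
    have hx : x = x i₀ • EuclideanSpace.single i₀ (1 : ℝ) := by
      ext i
      simp [hex i]
    rw [hx, evalAt_smul_of_isHomogeneous hh.1, h0]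
    simp [evalAt]
  obtain ⟨i₁, h01⟩ := hex
  have hp2 : 2 ≤ p := by
    have := i₁.2; have := i₀.2
    have : (i₁ : ℕ) ≠ i₀ := fun h => h01 (Fin.ext h)
    omega
  obtain ⟨c, hc0, hc⟩ := exists_zonal_expansion h01 hh.1 hinv
  rw [h0] at hc0
  set N := m / 2 with hN
  set α : ℕ → ℕ := fun k => (m - 2 * k) * (m - 2 * k - 1)
  set β : ℕ → ℕ := fun k => 4 * k * (k - 1) + 2 * k * (p - 1)
  -- The value at s is that of the Laplacian of h at the point at height 1 and distance √s from the
  -- axis. As this vanishes for all s ≥ 0, L = 0.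
  set L : Polynomial ℂ := ∑ k ∈ Finset.range (N + 1),
    (Polynomial.C (c k * α k) * Polynomial.X ^ k + Polynomial.C (c k * β k) *
      Polynomial.X ^ (k - 1)) with hL
  have hL0 : L = 0 := by
    refine Polynomial.eq_of_infinite_eval_eq _ _
      (((Set.Ici_infinite (0 : ℝ)).image Complex.ofReal_injective.injOn).mono ?_)
    rintro _ ⟨s, hs, rfl⟩
    have h1 := hh.2
    rw [hc, map_sum] at h1
    have h2 := congrArg (fun P => evalAt P
      (EuclideanSpace.single i₀ 1 + EuclideanSpace.single i₁ (Real.sqrt s))) h1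
    have hR : evalAt (rsqErase i₀)
        (EuclideanSpace.single i₀ 1 + EuclideanSpace.single i₁ (Real.sqrt s)) = s := by
      rw [evalAt_rsqErase, norm_single_add_single_sq h01, Real.sq_sqrt hs]
      simp [h01.symm]
    simp only [evalAt_sum] at h2
    simp only [Set.mem_ofPred_eq, hL, Polynomial.eval_finsetSum, Polynomial.eval_zero]
    refine Eq.trans (Finset.sum_congr rfl fun k _ => ?_) (h2.trans (by simp [evalAt]))
    rw [← smul_eq_C_mul, map_smul, laplacian_X_pow_mul_rsqErase_pow, smul_eq_C_mul]
    simp only [evalAt_mul, evalAt_add, evalAt_C, evalAt_pow, hR, evalAt_X, α, β]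
    simp [h01.symm]
    ring
  -- The coefficient of s^k in L is c k * α k + c (k + 1) * β (k + 1). Since p ≥ 2 makes β (k + 1)
  -- nonzero, c 0 = 0 propagates to all coefficients.
  have hall : ∀ k, k < N + 1 → c k = 0 := by
    intro k
    induction k with
    | zero => intro _; exact hc0
    | succ k ih =>
      intro hk
      have h1 := congrArg (fun P => Polynomial.coeff P k) hL0
      simp only [hL, Polynomial.finsetSum_coeff, Polynomial.coeff_add, Polynomial.coeff_C_mul,
        Polynomial.coeff_X_pow, Polynomial.coeff_zero, Finset.sum_add_distrib] at h1
      rw [Finset.sum_eq_single k, Finset.sum_eq_single (k + 1)] at h1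
      · rw [ih (by omega)] at h1
        have hβ : ((β (k + 1) : ℕ) : ℂ) ≠ 0 := by
          have : 0 < 2 * (k + 1) * (p - 1) := by
            have : 0 < p - 1 := by omega
            positivity
          exact_mod_cast (by simp only [β]; omega)
        simpa [hβ] using h1
      · intro j _ hj
        rcases j with _ | j
        · simp [β]
        · have : k ≠ j := by omega
          simp [this]
      · intro hj
        exact absurd (Finset.mem_range.2 hk) hj
      · intro j _ hj
        simp [hj.symm]
      · intro hj
        exact absurd (Finset.mem_range.2 (by omega)) hj
  rw [hc]
  exact Finset.sum_eq_zero fun k hk => by rw [hall k (Finset.mem_range.1 hk)]; simp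

end LightCone

/-! ### Products of spherical harmonics: density and dimension -/

namespace LightCone

open MvPolynomial

variable {p q : ℕ}

/-- The unit sphere in `ℝ^p`. -/
abbrev Sph (p : ℕ) : Type := Metric.sphere (0 : E p) (1 : ℝ)

/-- The product of the two unit spheres. -/
abbrev Om (p q : ℕ) : Type := Sph p × Sph q

lemma continuous_evalAt (P : MvPolynomial (Fin p) ℂ) : Continuous (evalAt P) :=
  (contDiff_evalAt P).continuous

/-- The restriction of polynomials to the unit sphere. -/
noncomputable def sphRes (p : ℕ) : MvPolynomial (Fin p) ℂ →ₗ[ℂ] C(Sph p, ℂ) where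
  toFun P := ⟨fun x => evalAt P x.1, (continuous_evalAt P).comp continuous_subtype_val⟩
  map_add' P Q := by ext x; simp [evalAt]
  map_smul' c P := by ext x; simp [evalAt]

@[simp] lemma sphRes_apply (P : MvPolynomial (Fin p) ℂ) (x : Sph p) :
    sphRes p P x = evalAt P x.1 := rfl

/-- The spherical harmonics of degree `m`. -/
noncomputable def Y (p m : ℕ) : Submodule ℂ C(Sph p, ℂ) := (H p m).map (sphRes p)

/-- The product of a function on the first sphere and a function on the second one. -/
noncomputable def extProd (p q : ℕ) : C(Sph p, ℂ) →ₗ[ℂ] C(Sph q, ℂ) →ₗ[ℂ] C(Om p q, ℂ) :=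
  LinearMap.mk₂ ℂ (fun u v => u.comp ContinuousMap.fst * v.comp ContinuousMap.snd)
    (fun u u' v => by ext w; simp [add_mul])
    (fun c u v => by ext w; simp [mul_assoc])
    (fun u v v' => by ext w; simp [mul_add])
    (fun c u v => by ext w; simp [mul_left_comm])

@[simp] lemma extProd_apply (u : C(Sph p, ℂ)) (v : C(Sph q, ℂ)) (w : Om p q) :
    extProd p q u v w = u w.1 * v w.2 := rfl

/-- The products of spherical harmonics of degrees `m` and `n`. -/
noncomputable def biharm (p q m n : ℕ) : Submodule ℂ C(Om p q, ℂ) :=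
  Submodule.map₂ (extProd p q) (Y p m) (Y q n)

/-- No case for scalars is needed: a scalar is absorbed by the harmonic polynomial in the first
factor. -/
lemma biharm_induction {m n : ℕ} {motive : C(Om p q, ℂ) → Prop}
    (tmul : ∀ h ∈ H p m, ∀ k ∈ H q n, motive (extProd p q (sphRes p h) (sphRes q k)))
    (zero : motive 0) (add : ∀ F G, motive F → motive G → motive (F + G))
    {F : C(Om p q, ℂ)} (hF : F ∈ biharm p q m n) : motive F := by
  rw [biharm, Submodule.map₂_eq_span_image2] at hF
  induction hF using Submodule.closure_induction with
  | zero => exact zero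
  | add F G _ _ h h' => exact add F G h h'
  | smul_mem c F hF =>
    obtain ⟨_, ⟨h, hh, rfl⟩, _, ⟨k, hk, rfl⟩, rfl⟩ := hF
    have := tmul (c • h) (Submodule.smul_mem _ _ hh) k hk
    simpa using this

lemma extProd_mem_biharm {m n : ℕ} {h : MvPolynomial (Fin p) ℂ} (hh : h ∈ H p m)
    {k : MvPolynomial (Fin q) ℂ} (hk : k ∈ H q n) :
    extProd p q (sphRes p h) (sphRes q k) ∈ biharm p q m n :=
  Submodule.apply_mem_map₂ _ (Submodule.mem_map_of_mem hh) (Submodule.mem_map_of_mem hk)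

/-- On the sphere r² = 1, so r^(2j) h restricts to the same function as h, whose degree is at most
k. -/
lemma sphRes_mem_iSup (hp : 1 ≤ p) {k : ℕ} {P : MvPolynomial (Fin p) ℂ} (hP : P.IsHomogeneous k) :
    sphRes p P ∈ ⨆ i : {i : ℕ // i ≤ k}, Y p i := by
  have h := mem_radialHarmonic hp k P hP
  clear hP
  induction h using Submodule.span_induction with
  | mem P hP =>
    obtain ⟨j, d, hjd, h, hh, rfl⟩ := hP
    refine Submodule.mem_iSup_of_mem (⟨d, by omega⟩ : {i : ℕ // i ≤ k}) ⟨h, hh, ?_⟩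
    ext x
    have hx : ‖(x : E p)‖ = 1 := by simp
    simp [evalAt_mul, evalAt_pow, evalAt_rsq, hx]
  | zero => rw [map_zero]; exact zero_mem _
  | add P Q _ _ h h' => rw [map_add]; exact add_mem h h'
  | smul c P _ h => rw [map_smul]; exact Submodule.smul_mem _ _ h

/-- The span of the `biharm p q m n` with `m + n ≤ k`. -/
noncomputable def biharmLE (p q k : ℕ) : Submodule ℂ C(Om p q, ℂ) :=
  ⨆ i : {i : ℕ × ℕ // i.1 + i.2 ≤ k}, biharm p q i.1.1 i.1.2

lemma extProd_mem_biharmLE (hp : 1 ≤ p) (hq : 1 ≤ q) {k l : ℕ}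
    {P : MvPolynomial (Fin p) ℂ} (hP : P.IsHomogeneous k)
    {Q : MvPolynomial (Fin q) ℂ} (hQ : Q.IsHomogeneous l) :
    extProd p q (sphRes p P) (sphRes q Q) ∈ biharmLE p q (k + l) := by
  have h := Submodule.apply_mem_map₂ (extProd p q) (sphRes_mem_iSup hp hP) (sphRes_mem_iSup hq hQ)
  simp only [Submodule.map₂_iSup_left, Submodule.map₂_iSup_right] at h
  refine (iSup_le fun i => iSup_le fun j => ?_ : _ ≤ biharmLE p q (k + l)) h
  exact le_iSup (fun i : {i : ℕ × ℕ // i.1 + i.2 ≤ k + l} => biharm p q i.1.1 i.1.2)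
    ⟨(j, i), by have := i.2; have := j.2; simp; omega⟩

/-- The restriction of polynomials on `ℝ^p ⊕ ℝ^q` to the product of the spheres. -/
noncomputable def omRes (p q : ℕ) : MvPolynomial (Fin p ⊕ Fin q) ℂ →ₐ[ℂ] C(Om p q, ℂ) :=
  aeval (Sum.elim
    (fun i => ⟨fun w => ((w.1.1 i : ℝ) : ℂ), by fun_prop⟩)
    (fun i => ⟨fun w => ((w.2.1 i : ℝ) : ℂ), by fun_prop⟩))

lemma omRes_apply (P : MvPolynomial (Fin p ⊕ Fin q) ℂ) (w : Om p q) :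
    omRes p q P w =
      eval (Sum.elim (fun i => ((w.1.1 i : ℝ) : ℂ)) (fun i => ((w.2.1 i : ℝ) : ℂ))) P := by
  induction P using MvPolynomial.induction_on with
  | C c => simp [omRes]
  | add P Q hP hQ => simp [hP, hQ]
  | mul_X P i hP =>
    rw [map_mul, ContinuousMap.mul_apply, hP, map_mul]
    congr 1
    rcases i with i | i <;> simp [omRes]

/-- A monomial in all variables is a product of monomials in the two groups of variables. The bound
on the degree is kept for the later use with Taylor polynomials. -/
lemma omRes_mem_biharmLE (hp : 1 ≤ p) (hq : 1 ≤ q) {k : ℕ}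
    {P : MvPolynomial (Fin p ⊕ Fin q) ℂ} (hP : P.totalDegree ≤ k) :
    omRes p q P ∈ biharmLE p q k := by
  rw [P.as_sum, map_sum]
  refine Submodule.sum_mem _ fun s hs => ?_
  have hdeg : ∑ i, s (Sum.inl i) + ∑ i, s (Sum.inr i) ≤ k := by
    have := (le_totalDegree hs).trans hP
    rwa [Finsupp.sum_fintype _ _ (by simp), Fintype.sum_sum_type] at this
  set a : Fin p →₀ ℕ := Finsupp.equivFunOnFinite.symm fun i => s (Sum.inl i) with ha
  set b : Fin q →₀ ℕ := Finsupp.equivFunOnFinite.symm fun i => s (Sum.inr i) with hb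
  have hP : (monomial a (coeff s P)).IsHomogeneous (∑ i, s (Sum.inl i)) := by
    refine isHomogeneous_monomial _ ?_
    rw [Finsupp.degree_eq_sum]
    simp [ha]
  have hQ : (monomial b (1 : ℂ)).IsHomogeneous (∑ i, s (Sum.inr i)) := by
    refine isHomogeneous_monomial _ ?_
    rw [Finsupp.degree_eq_sum]
    simp [hb]
  have h1 := extProd_mem_biharmLE hp hq hP hQ
  have h2 : omRes p q (monomial s (coeff s P)) =
      extProd p q (sphRes p (monomial a (coeff s P))) (sphRes q (monomial b 1)) := by
    ext w
    rw [omRes_apply, extProd_apply, sphRes_apply, sphRes_apply, evalAt, evalAt]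
    simp only [eval_monomial]
    rw [Finsupp.prod_fintype _ _ (by simp), Finsupp.prod_fintype _ _ (by simp),
      Finsupp.prod_fintype _ _ (by simp), Fintype.prod_sum_type]
    simp [ha, hb, mul_assoc]
  rw [h2]
  refine (iSup_le fun i => ?_ : biharmLE p q _ ≤ biharmLE p q k) h1
  exact le_iSup (fun i : {i : ℕ × ℕ // i.1 + i.2 ≤ k} => biharm p q i.1.1 i.1.2)
    ⟨i.1, i.2.trans hdeg⟩

lemma star_omRes_X (i : Fin p ⊕ Fin q) : star (omRes p q (X i)) = omRes p q (X i) := by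
  ext w
  rcases i with i | i <;> simp [omRes]

/-- Stone-Weierstrass: the coordinates are real, so the polynomials are stable under conjugation,
and they separate points. -/
lemma range_omRes_topologicalClosure :
    (omRes p q).range.topologicalClosure = ⊤ := by
  have hstar : ∀ f ∈ (omRes p q).range, star f ∈ (omRes p q).range := by
    rintro _ ⟨P, rfl⟩
    induction P using MvPolynomial.induction_on with
    | C c =>
      refine ⟨C (star c), ?_⟩
      ext w
      simp
    | add P Q hP hQ =>
      simp only [map_add, star_add] at *
      exact add_mem hP hQ
    | mul_X P i hP =>
      simp only [map_mul, star_mul'] at *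
      exact mul_mem hP ⟨X i, (star_omRes_X i).symm⟩
  set A : StarSubalgebra ℂ C(Om p q, ℂ) := { (omRes p q).range with star_mem' := hstar _ }
  have hsep : A.SeparatesPoints := by
    intro x y hxy
    by_contra hcon
    push Not at hcon
    have h : ∀ i, omRes p q (X i) x = omRes p q (X i) y := fun i =>
      hcon _ ⟨omRes p q (X i), ⟨X i, rfl⟩, rfl⟩
    refine hxy (Prod.ext (Subtype.ext ?_) (Subtype.ext ?_))
    · ext i
      simpa [omRes] using h (Sum.inl i)
    · ext i
      simpa [omRes] using h (Sum.inr i)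
  have := ContinuousMap.starSubalgebra_topologicalClosure_eq_top_of_separatesPoints A hsep
  refine top_le_iff.1 fun f _ => ?_
  have hf : f ∈ A.topologicalClosure := by rw [this]; trivial
  exact hf

lemma iSup_biharm_topologicalClosure (hp : 1 ≤ p) (hq : 1 ≤ q) :
    (⨆ i : ℕ × ℕ, biharm p q i.1 i.2).topologicalClosure = ⊤ := by
  refine top_le_iff.1 fun f _ => ?_
  have hf : f ∈ (omRes p q).range.topologicalClosure := by
    rw [range_omRes_topologicalClosure]; trivial
  have hle : ((omRes p q).range : Set C(Om p q, ℂ)) ⊆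
      ((⨆ i : ℕ × ℕ, biharm p q i.1 i.2 : Submodule ℂ C(Om p q, ℂ)) : Set C(Om p q, ℂ)) := by
    rintro _ ⟨P, rfl⟩
    exact (iSup_le fun i => le_iSup (fun i : ℕ × ℕ => biharm p q i.1 i.2) i.1 :
      biharmLE p q P.totalDegree ≤ _) (omRes_mem_biharmLE hp hq le_rfl)
  exact closure_mono hle hf

/-- The monomials with all exponents at most m suffice. This crude count is enough, since only
polynomial growth of the dimension is needed. -/
lemma Y_le_span (p m : ℕ) :
    ∃ G : (Fin p → Fin (m + 1)) → C(Sph p, ℂ), Y p m ≤ Submodule.span ℂ (Set.range G) := by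
  refine ⟨fun s => sphRes p (monomial (Finsupp.equivFunOnFinite.symm fun i => (s i : ℕ)) 1), ?_⟩
  rintro _ ⟨P, hP, rfl⟩
  rw [P.as_sum, map_sum]
  refine Submodule.sum_mem _ fun s hs => ?_
  have hs' : ∀ i, s i < m + 1 := by
    intro i
    have h1 := (mem_H.1 hP).1 (mem_support_iff.1 hs)
    rw [Finsupp.weight_apply, Finsupp.sum_fintype _ _ (by simp)] at h1
    have h2 : s i ≤ ∑ j, s j := Finset.single_le_sum (fun _ _ => Nat.zero_le _) (Finset.mem_univ i)
    simp at h1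
    omega
  have h3 : sphRes p (monomial s (coeff s P)) = coeff s P • sphRes p (monomial s 1) := by
    rw [← map_smul, smul_monomial, smul_eq_mul, mul_one]
  rw [h3]
  refine Submodule.smul_mem _ _ (Submodule.subset_span ⟨fun i => ⟨s i, hs' i⟩, ?_⟩)
  have h4 : (Finsupp.equivFunOnFinite.symm fun i => s i) = s := Finsupp.ext fun i => rfl
  simp only [h4]

lemma biharm_le_span (p q m n : ℕ) :
    ∃ F : (Fin p → Fin (m + 1)) × (Fin q → Fin (n + 1)) → C(Om p q, ℂ),
      biharm p q m n ≤ Submodule.span ℂ (Set.range F) := by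
  obtain ⟨G, hG⟩ := Y_le_span p m
  obtain ⟨G', hG'⟩ := Y_le_span q n
  refine ⟨fun s => extProd p q (G s.1) (G' s.2), ?_⟩
  refine (Submodule.map₂_le_map₂ hG hG').trans ?_
  rw [Submodule.map₂_span_span]
  refine Submodule.span_mono ?_
  rintro _ ⟨_, ⟨s, rfl⟩, _, ⟨s', rfl⟩, rfl⟩
  exact ⟨(s, s'), rfl⟩

instance (m n : ℕ) : FiniteDimensional ℂ (biharm p q m n) := by
  obtain ⟨F, hF⟩ := biharm_le_span p q m n
  have := FiniteDimensional.span_of_finite ℂ (Set.finite_range F)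
  exact Submodule.finiteDimensional_of_le hF

lemma finrank_biharm_le (p q m n : ℕ) :
    Module.finrank ℂ (biharm p q m n) ≤ (m + 1) ^ p * (n + 1) ^ q := by
  obtain ⟨F, hF⟩ := biharm_le_span p q m n
  have := FiniteDimensional.span_of_finite ℂ (Set.finite_range F)
  refine (Submodule.finrank_mono hF).trans ((finrank_range_le_card F).trans ?_)
  simp

end LightCone

/-! ### Invariant inner product, reproducing functions and irreducibility -/

namespace LightCone

open MvPolynomial MeasureTheory
open scoped Pointwise

variable {p q : ℕ}

/-- The action of linear isometries on the unit sphere. -/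
noncomputable def sphAct (g : E p ≃ₗᵢ[ℝ] E p) : C(Sph p, Sph p) where
  toFun x := ⟨g x.1, by simp⟩
  continuous_toFun := by fun_prop

@[simp] lemma sphAct_coe (g : E p ≃ₗᵢ[ℝ] E p) (x : Sph p) : (sphAct g x : E p) = g x.1 := rfl

/-- The action of `O(p) × O(q)` on the product of the unit spheres. -/
noncomputable def omAct (g : K p q) : C(Om p q, Om p q) := (sphAct g.1).prodMap (sphAct g.2)

@[simp] lemma omAct_apply (g : K p q) (w : Om p q) :
    omAct g w = (sphAct g.1 w.1, sphAct g.2 w.2) := rfl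

lemma omAct_inv_omAct (g : K p q) (w : Om p q) : omAct g⁻¹ (omAct g w) = w := by
  refine Prod.ext (Subtype.ext ?_) (Subtype.ext ?_)
  · exact g.1.symm_apply_apply _
  · exact g.2.symm_apply_apply _

lemma omAct_omAct_inv (g : K p q) (w : Om p q) : omAct g (omAct g⁻¹ w) = w := by
  refine Prod.ext (Subtype.ext ?_) (Subtype.ext ?_)
  · exact g.1.apply_symm_apply _
  · exact g.2.apply_symm_apply _

/-- Left translation of functions on the product of the unit spheres. -/
noncomputable def translateOm (g : K p q) : C(Om p q, ℂ) →ₗ[ℂ] C(Om p q, ℂ) where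
  toFun f := f.comp (omAct g⁻¹)
  map_add' _ _ := rfl
  map_smul' _ _ := rfl

lemma translateOm_apply (g : K p q) (f : C(Om p q, ℂ)) (w : Om p q) :
    translateOm g f w = f (omAct g⁻¹ w) := rfl

lemma translateOm_inv_translateOm (g : K p q) (f : C(Om p q, ℂ)) :
    translateOm g⁻¹ (translateOm g f) = f := by
  ext w
  rw [translateOm_apply, translateOm_apply, inv_inv, omAct_inv_omAct]

lemma translateOm_mem_biharm (g : K p q) {m n : ℕ} {F : C(Om p q, ℂ)} (hF : F ∈ biharm p q m n) :
    translateOm g F ∈ biharm p q m n := by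
  refine biharm_induction (motive := fun F => translateOm g F ∈ biharm p q m n) ?_ ?_ ?_ hF
  · intro h hh k hk
    have := extProd_mem_biharm (rotate_mem_H g.1⁻¹ hh) (rotate_mem_H g.2⁻¹ hk)
    convert this using 1
    ext w
    simp [translateOm_apply, evalAt_rotate]
  · rw [map_zero]; exact zero_mem _
  · intro F G hF hG
    rw [map_add]
    exact add_mem hF hG

/-- The surface measure of the sphere. -/
noncomputable def sphMeas (p : ℕ) : Measure (Sph p) := (volume : Measure (E p)).toSphere

instance : IsFiniteMeasure (sphMeas p) := by unfold sphMeas; infer_instance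

instance : (sphMeas p).IsOpenPosMeasure := by unfold sphMeas; infer_instance

/-- The surface measure of s is, up to a constant, the volume of the truncated cone over s;
isometries preserve volume and map cones to cones. -/
lemma measurePreserving_sphAct (g : E p ≃ₗᵢ[ℝ] E p) :
    MeasurePreserving (sphAct g) (sphMeas p) (sphMeas p) := by
  have hm : Measurable (sphAct g) := (sphAct g).continuous.measurable
  refine ⟨hm, Measure.ext fun s hs => ?_⟩
  rw [Measure.map_apply hm hs, sphMeas, Measure.toSphere_apply' _ hs,
    Measure.toSphere_apply' _ (hm hs)]
  congr 1
  have hpre := MeasurePreserving.measure_preimage_equiv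
    (f := g.toHomeomorph.toMeasurableEquiv) g.measurePreserving
    (Set.Ioo (0 : ℝ) 1 • ((↑) '' s : Set (E p)))
  rw [← hpre]
  congr 1
  ext x
  simp only [Set.mem_smul, Set.mem_preimage, Set.mem_image]
  constructor
  · rintro ⟨t, ht, _, ⟨y, hy, rfl⟩, rfl⟩
    exact ⟨t, ht, g y.1, ⟨sphAct g y, hy, rfl⟩, (g.map_smul t y.1).symm⟩
  · rintro ⟨t, ht, _, ⟨y, hy, rfl⟩, hx⟩
    refine ⟨t, ht, g.symm y.1, ⟨sphAct g.symm y, ?_, rfl⟩, ?_⟩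
    · have : sphAct g (sphAct g.symm y) = y := Subtype.ext (g.apply_symm_apply _)
      rwa [this]
    · have hx' : t • (y : E p) = g x := hx
      rw [← map_smul, hx', g.symm_apply_apply]

/-- The product of the surface measures. -/
noncomputable def omMeas (p q : ℕ) : Measure (Om p q) := (sphMeas p).prod (sphMeas q)

instance : IsFiniteMeasure (omMeas p q) := by unfold omMeas; infer_instance

instance : (omMeas p q).IsOpenPosMeasure := by unfold omMeas; infer_instance

lemma measurePreserving_omAct (g : K p q) :
    MeasurePreserving (omAct g) (omMeas p q) (omMeas p q) :=
  (measurePreserving_sphAct g.1).prod (measurePreserving_sphAct g.2)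

/-- The inclusion of the continuous functions into `L²`. -/
noncomputable def toL2 (p q : ℕ) : C(Om p q, ℂ) →L[ℂ] Lp ℂ 2 (omMeas p q) :=
  ContinuousMap.toLp 2 (omMeas p q) ℂ

lemma toL2_injective : Function.Injective (toL2 p q) :=
  ContinuousMap.toLp_injective (omMeas p q)

lemma inner_toL2 (f g : C(Om p q, ℂ)) :
    inner ℂ (toL2 p q f) (toL2 p q g) = ∫ w, g w * star (f w) ∂(omMeas p q) :=
  ContinuousMap.inner_toLp (omMeas p q) f g

lemma inner_toL2_translateOm (g : K p q) (f f' : C(Om p q, ℂ)) :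
    inner ℂ (toL2 p q (translateOm g f)) (toL2 p q (translateOm g f')) =
      inner ℂ (toL2 p q f) (toL2 p q f') := by
  rw [inner_toL2, inner_toL2]
  let e : Om p q ≃ₜ Om p q :=
    { toFun := omAct g⁻¹
      invFun := omAct g
      left_inv := omAct_omAct_inv g
      right_inv := omAct_inv_omAct g
      continuous_toFun := (omAct g⁻¹).continuous
      continuous_invFun := (omAct g).continuous }
  exact (measurePreserving_omAct g⁻¹).integral_comp e.measurableEmbedding
    (fun w => f' w * star (f w))

lemma inner_toL2_translateOm_left (g : K p q) (f f' : C(Om p q, ℂ)) :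
    inner ℂ (toL2 p q (translateOm g f)) (toL2 p q f') =
      inner ℂ (toL2 p q f) (toL2 p q (translateOm g⁻¹ f')) := by
  rw [← inner_toL2_translateOm g⁻¹, translateOm_inv_translateOm]

/-- Evaluation at a point is represented by the inner product on a finite-dimensional space of
continuous functions. -/
lemma exists_reproducing (W : Submodule ℂ C(Om p q, ℂ)) [FiniteDimensional ℂ W] (w : Om p q) :
    ∃ z ∈ W, ∀ f ∈ W, inner ℂ (toL2 p q z) (toL2 p q f) = f w := by
  let e := Submodule.equivMapOfInjective (toL2 p q).toLinearMap toL2_injective W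
  have : FiniteDimensional ℂ (W.map (toL2 p q).toLinearMap) := inferInstance
  have : CompleteSpace (W.map (toL2 p q).toLinearMap) := FiniteDimensional.complete ℂ _
  let ev : W →ₗ[ℂ] ℂ := { toFun := fun f => f.1 w, map_add' := fun _ _ => rfl,
                          map_smul' := fun _ _ => rfl }
  let φ : (W.map (toL2 p q).toLinearMap) →ₗ[ℂ] ℂ := ev ∘ₗ e.symm.toLinearMap
  let z := (InnerProductSpace.toDual ℂ _).symm (LinearMap.toContinuousLinearMap φ)
  refine ⟨(e.symm z).1, (e.symm z).2, fun f hf => ?_⟩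
  have h1 := InnerProductSpace.toDual_symm_apply (𝕜 := ℂ) (x := e ⟨f, hf⟩)
    (y := LinearMap.toContinuousLinearMap φ)
  have h2 : toL2 p q (e.symm z).1 = (z : Lp ℂ 2 (omMeas p q)) := by
    have := e.apply_symm_apply z
    exact congrArg Subtype.val this
  rw [h2]
  refine Eq.trans h1 ?_
  change ev (e.symm (e ⟨f, hf⟩)) = _
  rw [e.symm_apply_apply]
  rfl

/-- Freezing one variable reduces statements on the product to harmonic polynomials on a single
sphere. -/
lemma exists_slice_left {m n : ℕ} {F : C(Om p q, ℂ)} (hF : F ∈ biharm p q m n) (y : Sph q) :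
    ∃ h ∈ H p m, ∀ x : Sph p, F (x, y) = evalAt h x.1 := by
  refine biharm_induction (motive := fun F => ∃ h ∈ H p m, ∀ x : Sph p, F (x, y) = evalAt h x.1)
    ?_ ?_ ?_ hF
  · intro h hh k hk
    refine ⟨evalAt k y.1 • h, Submodule.smul_mem _ _ hh, fun x => ?_⟩
    simp [evalAt, mul_comm]
  · exact ⟨0, zero_mem _, fun x => by simp [evalAt]⟩
  · rintro F G ⟨h, hh, h1⟩ ⟨h', hh', h1'⟩
    exact ⟨h + h', add_mem hh hh', fun x => by simp [h1, h1', evalAt]⟩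

lemma exists_slice_right {m n : ℕ} {F : C(Om p q, ℂ)} (hF : F ∈ biharm p q m n) (x : Sph p) :
    ∃ k ∈ H q n, ∀ y : Sph q, F (x, y) = evalAt k y.1 := by
  refine biharm_induction (motive := fun F => ∃ k ∈ H q n, ∀ y : Sph q, F (x, y) = evalAt k y.1)
    ?_ ?_ ?_ hF
  · intro h hh k hk
    refine ⟨evalAt h x.1 • k, Submodule.smul_mem _ _ hk, fun y => ?_⟩
    simp [evalAt]
  · exact ⟨0, zero_mem _, fun x => by simp [evalAt]⟩
  · rintro F G ⟨h, hh, h1⟩ ⟨h', hh', h1'⟩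
    exact ⟨h + h', add_mem hh hh', fun x => by simp [h1, h1', evalAt]⟩

/-- A basis vector as a point of the sphere. -/
noncomputable def pole (i : Fin p) : Sph p := ⟨EuclideanSpace.single i 1, by simp⟩

/-- A homogeneous polynomial which transforms by a scalar on the sphere does so everywhere. -/
lemma evalAt_isometry_of_sphere {m : ℕ} {h : MvPolynomial (Fin p) ℂ} (hh : h ∈ H p m)
    (g : E p ≃ₗᵢ[ℝ] E p) (c : ℂ)
    (hS : ∀ x : Sph p, evalAt h (g x.1) = c * evalAt h x.1) (x : E p) (hc : x = 0 → c = 1) :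
    evalAt h (g x) = c * evalAt h x := by
  by_cases hx : x = 0
  · rw [hc hx, hx, map_zero, one_mul]
  · have hx' : ‖x‖ ≠ 0 := norm_ne_zero_iff.2 hx
    have h1 : x = ‖x‖ • (‖x‖⁻¹ • x) := by rw [smul_smul, mul_inv_cancel₀ hx', one_smul]
    have h2 := hS ⟨‖x‖⁻¹ • x, by simp [norm_smul, hx']⟩
    rw [h1, map_smul, evalAt_smul hh, evalAt_smul hh, h2]
    ring

lemma eq_zero_of_sphere {m : ℕ} {h : MvPolynomial (Fin p) ℂ} (hh : h ∈ H p m)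
    (hS : ∀ x : Sph p, evalAt h x.1 = 0) {x : E p} (hx : x ≠ 0) : evalAt h x = 0 := by
  have hx' : ‖x‖ ≠ 0 := norm_ne_zero_iff.2 hx
  have h1 : x = ‖x‖ • (‖x‖⁻¹ • x) := by rw [smul_smul, mul_inv_cancel₀ hx', one_smul]
  rw [h1, evalAt_smul hh, hS ⟨‖x‖⁻¹ • x, by simp [norm_smul, hx']⟩, mul_zero]

/-- A bizonal element of `biharm p q m n` which vanishes at the pole is zero. -/
lemma biharm_eq_zero_of_zonal (i : Fin p) (j : Fin q) {m n : ℕ} {F : C(Om p q, ℂ)}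
    (hF : F ∈ biharm p q m n)
    (hinv : ∀ g : K p q, omAct g (pole i, pole j) = (pole i, pole j) → translateOm g F = F)
    (h0 : F (pole i, pole j) = 0) : F = 0 := by
  have hinv' : ∀ (g : E p ≃ₗᵢ[ℝ] E p) (g' : E q ≃ₗᵢ[ℝ] E q),
      g (EuclideanSpace.single i 1) = EuclideanSpace.single i 1 →
      g' (EuclideanSpace.single j 1) = EuclideanSpace.single j 1 →
      ∀ x y, F (sphAct g x, sphAct g' y) = F (x, y) := by
    intro g g' hg hg' x y
    have h1 := hinv (g⁻¹, g'⁻¹) (Prod.ext (Subtype.ext ?_) (Subtype.ext ?_))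
    · have h2 := congrArg (fun f : C(Om p q, ℂ) => f (x, y)) h1
      exact h2
    · exact g.symm_apply_eq.2 hg.symm
    · exact g'.symm_apply_eq.2 hg'.symm
  -- The slice through the first pole is zonal in y and vanishes at the second pole. After that,
  -- every slice in x is zonal and vanishes at the first pole.
  have h1 : ∀ y, F (pole i, y) = 0 := by
    obtain ⟨k, hk, hkF⟩ := exists_slice_right hF (pole i)
    have : k = 0 := by
      refine eq_zero_of_zonal j hk (fun g hg x => ?_) ?_
      · have := evalAt_isometry_of_sphere hk g 1 (fun y => ?_) x (fun _ => rfl)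
        · rw [this, one_mul]
        · have := hinv' 1 g rfl hg (pole i) y
          rw [hkF] at this
          rw [one_mul, ← this]
          exact (hkF (sphAct g y)).symm
      · exact (hkF (pole j)).symm.trans h0
    intro y
    rw [hkF, this]
    simp [evalAt]
  ext ⟨x, y⟩
  obtain ⟨h, hh, hhF⟩ := exists_slice_left hF y
  have : h = 0 := by
    refine eq_zero_of_zonal i hh (fun g hg x => ?_) ?_
    · have := evalAt_isometry_of_sphere hh g 1 (fun x => ?_) x (fun _ => rfl)
      · rw [this, one_mul]
      · have := hinv' g 1 hg rfl x y
        rw [hhF] at this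
        rw [one_mul, ← this]
        exact (hhF (sphAct g x)).symm
    · exact (hhF (pole i)).symm.trans (h1 y)
  rw [hhF, this]
  simp [evalAt]

lemma exists_omAct_eq (w w' : Om p q) : ∃ g : K p q, omAct g w = w' := by
  have key : ∀ {r : ℕ} (x y : Sph r), ∃ g : E r ≃ₗᵢ[ℝ] E r, g x.1 = y.1 := fun x y =>
    ⟨(ℝ ∙ (x.1 - y.1))ᗮ.reflection, Submodule.reflection_sub (by simp)⟩
  obtain ⟨g, hg⟩ := key w.1 w'.1
  obtain ⟨g', hg'⟩ := key w.2 w'.2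
  exact ⟨(g, g'), Prod.ext (Subtype.ext hg) (Subtype.ext hg')⟩

/-- A nonzero invariant space contains a bizonal function which is nonzero at the pole. -/
lemma exists_zonal (W : Submodule ℂ C(Om p q, ℂ)) [FiniteDimensional ℂ W]
    (hW : ∀ g : K p q, ∀ f ∈ W, translateOm g f ∈ W) (hne : W ≠ ⊥) (w : Om p q) :
    ∃ z ∈ W, z w ≠ 0 ∧ ∀ g : K p q, omAct g w = w → translateOm g z = z := by
  obtain ⟨z, hz, hzW⟩ := exists_reproducing W w
  refine ⟨z, hz, ?_, ?_⟩
  · rw [← hzW z hz]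
    intro h0
    -- If z vanished, so would all values at w of functions in W. By transitivity and invariance all
    -- of W would vanish.
    have hz0 : toL2 p q z = 0 := inner_self_eq_zero.1 h0
    obtain ⟨f, hf, hf0⟩ := (Submodule.ne_bot_iff W).1 hne
    obtain ⟨w', hw'⟩ : ∃ w', f w' ≠ 0 := by
      by_contra hcon
      push Not at hcon
      exact hf0 (ContinuousMap.ext hcon)
    obtain ⟨g, hg⟩ := exists_omAct_eq w w'
    have h1 := hzW _ (hW g⁻¹ f hf)
    rw [hz0, inner_zero_left, translateOm_apply, inv_inv, hg] at h1
    exact hw' h1.symm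
  · intro g hg
    apply toL2_injective
    -- As g fixes w, the translate of z also represents evaluation at w, so the difference is
    -- orthogonal to itself.
    have hd : translateOm g z - z ∈ W := sub_mem (hW g z hz) hz
    have h1 : inner ℂ (toL2 p q (translateOm g z - z)) (toL2 p q (translateOm g z - z)) = (0 : ℂ) := by
      rw [map_sub, inner_sub_left, ← map_sub, inner_toL2_translateOm_left, hzW _ (hW _ _ hd),
        hzW _ hd, translateOm_apply, inv_inv, hg, sub_self]
    have h2 := inner_self_eq_zero.1 h1
    rwa [map_sub, sub_eq_zero] at h2

/-- Otherwise W and its orthogonal complement U in `biharm p q m n` are both nonzero and invariant.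
Each contains a bizonal function that is nonzero at the pole; the two are proportional, yet
orthogonal. -/
lemma biharm_irreducible (hp : 1 ≤ p) (hq : 1 ≤ q) {m n : ℕ} {W : Submodule ℂ C(Om p q, ℂ)}
    (hWle : W ≤ biharm p q m n) (hW : ∀ g : K p q, ∀ f ∈ W, translateOm g f ∈ W) :
    W = ⊥ ∨ W = biharm p q m n := by
  by_contra! hcon
  obtain ⟨hne, hlt⟩ := hcon
  have hWfin : FiniteDimensional ℂ W := Submodule.finiteDimensional_of_le hWle
  set i : Fin p := ⟨0, hp⟩
  set j : Fin q := ⟨0, hq⟩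
  set U : Submodule ℂ C(Om p q, ℂ) := biharm p q m n ⊓
    (W.map (toL2 p q).toLinearMap)ᗮ.comap (toL2 p q).toLinearMap with hU
  have hUmem : ∀ {f}, f ∈ U ↔ f ∈ biharm p q m n ∧
      ∀ u ∈ W, inner ℂ (toL2 p q u) (toL2 p q f) = 0 := by
    intro f
    simp [hU, Submodule.mem_orthogonal]
  have hUinv : ∀ g : K p q, ∀ f ∈ U, translateOm g f ∈ U := by
    intro g f hf
    rw [hUmem] at hf ⊢
    refine ⟨translateOm_mem_biharm g hf.1, fun u hu => ?_⟩
    have := hf.2 _ (hW g⁻¹ u hu)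
    rwa [inner_toL2_translateOm_left, inv_inv] at this
  have hUfin : FiniteDimensional ℂ U := Submodule.finiteDimensional_of_le inf_le_left
  have hUne : U ≠ ⊥ := by
    have : FiniteDimensional ℂ (W.map (toL2 p q).toLinearMap) := inferInstance
    obtain ⟨f, hf, hfW⟩ := SetLike.exists_of_lt (lt_of_le_of_ne hWle hlt)
    set P := (W.map (toL2 p q).toLinearMap).starProjection (toL2 p q f) with hP
    have hPm : P ∈ W.map (toL2 p q).toLinearMap := Submodule.starProjection_apply_mem _ _
    obtain ⟨u, hu, huP⟩ := hPm
    have huP' : toL2 p q u = P := huP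
    rw [Submodule.ne_bot_iff]
    refine ⟨f - u, hUmem.2 ⟨sub_mem hf (hWle hu), fun v hv => ?_⟩, ?_⟩
    · rw [map_sub, huP', hP]
      exact Submodule.sub_starProjection_mem_orthogonal _ _ ⟨v, hv, rfl⟩
    · intro h0
      rw [sub_eq_zero] at h0
      exact hfW (h0 ▸ hu)
  obtain ⟨z, hz, hz0, hzinv⟩ := exists_zonal W hW hne (pole i, pole j)
  obtain ⟨z', hz', hz0', hzinv'⟩ := exists_zonal U hUinv hUne (pole i, pole j)
  have h1 : z' (pole i, pole j) • z - z (pole i, pole j) • z' = 0 := by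
    refine biharm_eq_zero_of_zonal i j (sub_mem (Submodule.smul_mem _ _ (hWle hz))
      (Submodule.smul_mem _ _ (hUmem.1 hz').1)) (fun g hg => ?_) ?_
    · rw [map_sub, map_smul, map_smul, hzinv g hg, hzinv' g hg]
    · simp only [ContinuousMap.sub_apply, ContinuousMap.smul_apply, smul_eq_mul]
      ring
  have h2 := (hUmem.1 hz').2 z hz
  have h3 : z' (pole i, pole j) • z = z (pole i, pole j) • z' := sub_eq_zero.1 h1
  have h4 : inner ℂ (toL2 p q z) (toL2 p q (z' (pole i, pole j) • z)) = (0 : ℂ) := by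
    rw [h3, map_smul, inner_smul_right, h2, mul_zero]
  rw [map_smul, inner_smul_right] at h4
  rcases mul_eq_zero.1 h4 with h | h
  · exact hz0' h
  · have h5 : z = 0 := toL2_injective (by rw [map_zero]; exact inner_self_eq_zero.1 h)
    rw [h5] at hz0
    exact hz0 rfl

end LightCone

/-! ### Weights of plane rotations and inequivalence -/

namespace LightCone

open MvPolynomial MeasureTheory

variable {p q : ℕ}

/-- The rotation by the angle `θ` in the plane of two coordinates. -/
noncomputable def planeRotation {i j : Fin p} (hij : i ≠ j) (θ : ℝ) : E p ≃ₗᵢ[ℝ] E p :=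
  LinearIsometry.toLinearIsometryEquiv (F := E p)
    { toFun := fun x => x +
        (EuclideanSpace.single i ((Real.cos θ - 1) * x i - Real.sin θ * x j) +
          EuclideanSpace.single j (Real.sin θ * x i + (Real.cos θ - 1) * x j))
      map_add' := by
        intro x y
        ext k
        simp only [PiLp.add_apply, PiLp.single_apply]
        split_ifs <;> ring
      map_smul' := by
        intro c x
        ext k
        simp only [PiLp.add_apply, PiLp.smul_apply, PiLp.single_apply, smul_eq_mul,
          RingHom.id_apply]
        split_ifs <;> ring
      norm_map' := by
        intro x
        rw [← sq_eq_sq₀ (norm_nonneg _) (norm_nonneg _)]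
        change ‖x + (_ + _)‖ ^ 2 = _
        rw [norm_add_sq_real, norm_add_sq_real]
        simp only [inner_add_right, EuclideanSpace.inner_single_right, PiLp.norm_single,
          PiLp.single_apply, hij.symm, if_false, Real.norm_eq_abs, sq_abs]
        simp
        linear_combination ((x i) ^ 2 + (x j) ^ 2) * Real.sin_sq_add_cos_sq θ }
    rfl

lemma planeRotation_apply {i j : Fin p} (hij : i ≠ j) (θ : ℝ) (x : E p) :
    planeRotation hij θ x = x +
        (EuclideanSpace.single i ((Real.cos θ - 1) * x i - Real.sin θ * x j) +
          EuclideanSpace.single j (Real.sin θ * x i + (Real.cos θ - 1) * x j)) := rfl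

lemma planeRotation_apply_left {i j : Fin p} (hij : i ≠ j) (θ : ℝ) (x : E p) :
    planeRotation hij θ x i = Real.cos θ * x i - Real.sin θ * x j := by
  simp [planeRotation_apply, hij]
  ring

lemma planeRotation_apply_right {i j : Fin p} (hij : i ≠ j) (θ : ℝ) (x : E p) :
    planeRotation hij θ x j = Real.sin θ * x i + Real.cos θ * x j := by
  simp [planeRotation_apply, hij.symm]
  ring

lemma eval_mul_of_isHomogeneous {m : ℕ} {P : MvPolynomial (Fin p) ℂ} (hP : P.IsHomogeneous m)
    (u : ℂ) (y : Fin p → ℂ) : eval (fun i => u * y i) P = u ^ m * eval y P := by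
  simp only [MvPolynomial.eval_eq']
  rw [Finset.mul_sum]
  refine Finset.sum_congr rfl fun d hd => ?_
  have hdeg : ∑ i, d i = m := by
    have h2 := hP (MvPolynomial.mem_support_iff.1 hd)
    rw [Finsupp.weight_apply, Finsupp.sum_fintype _ _ (by simp)] at h2
    simpa using h2
  simp only [mul_pow]
  rw [Finset.prod_mul_distrib, Finset.prod_pow_eq_pow_sum, hdeg]
  ring

/-- Along a circle in a plane spanned by two vectors, a homogeneous polynomial of degree `m` is a
trigonometric polynomial of degree at most `m`. -/
lemma exists_trig_polynomial {m : ℕ} {P : MvPolynomial (Fin p) ℂ} (hP : P.IsHomogeneous m)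
    (x y z : E p) :
    ∃ Q : Polynomial ℂ, Q.natDegree ≤ 2 * m ∧ ∀ θ : ℝ,
      Q.eval (Complex.exp (θ * Complex.I)) = Complex.exp (θ * Complex.I) ^ m *
        evalAt P (z + (Real.cos θ • x + Real.sin θ • y)) := by
  -- With u = exp(iθ), the cosine is (u² + 1)/(2u) and the sine (u² - 1)/(2iu). Multiplying each
  -- coordinate by u clears denominators and, by homogeneity, costs the factor u^m.
  set f : Fin p → Polynomial ℂ := fun i =>
    Polynomial.C (z i : ℂ) * Polynomial.X + (Polynomial.C ((x i : ℂ) / 2) * (Polynomial.X ^ 2 + 1) +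
      Polynomial.C ((y i : ℂ) / (2 * Complex.I)) * (Polynomial.X ^ 2 - 1)) with hf
  refine ⟨aeval f P, ?_, fun θ => ?_⟩
  · have := MvPolynomial.aeval_natDegree_le P hP.totalDegree_le f (n := 2) (by
      intro i
      simp only [hf]
      compute_degree)
    omega
  · set u := Complex.exp (θ * Complex.I) with hu
    have hu0 : u ≠ 0 := Complex.exp_ne_zero _
    have huc : u ^ 2 + 1 = 2 * Complex.cos θ * u := by
      rw [Complex.cos, ← hu]
      have : Complex.exp (-θ * Complex.I) = u⁻¹ := by rw [hu, ← Complex.exp_neg]; ring_nf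
      rw [this]
      field_simp
    have hus : u ^ 2 - 1 = 2 * Complex.I * Complex.sin θ * u := by
      rw [Complex.sin, ← hu]
      have : Complex.exp (-θ * Complex.I) = u⁻¹ := by rw [hu, ← Complex.exp_neg]; ring_nf
      rw [this]
      field_simp
      linear_combination (u ^ 2 - 1) * Complex.I_sq
    rw [evalAt, ← eval_mul_of_isHomogeneous hP, ← Polynomial.coe_aeval_eq_eval, comp_aeval_apply,
      aeval_eq_eval]
    congr 2
    ext i
    have hI : Complex.I ≠ 0 := Complex.I_ne_zero
    simp only [hf, Polynomial.coe_aeval_eq_eval, Polynomial.eval_add, Polynomial.eval_mul,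
      Polynomial.eval_C, Polynomial.eval_X, Polynomial.eval_sub, Polynomial.eval_pow,
      Polynomial.eval_one, huc, hus, PiLp.add_apply, PiLp.smul_apply, smul_eq_mul,
      Complex.ofReal_add, Complex.ofReal_mul, Complex.ofReal_cos, Complex.ofReal_sin]
    field_simp

lemma infinite_range_exp_mul_I :
    (Set.range fun θ : ℝ => Complex.exp (θ * Complex.I)).Infinite := by
  refine Set.Infinite.mono (Set.image_subset_range _ (Set.Ioo (0 : ℝ) 1))
    ((Set.Ioo_infinite zero_lt_one).image ?_)
  intro a ha b hb hab
  have hπ := Real.pi_gt_three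
  have := Complex.exp_inj_of_neg_pi_lt_of_le_pi (x := a * Complex.I) (y := b * Complex.I)
    (by simp; linarith [ha.1]) (by simp; linarith [ha.2]) (by simp; linarith [hb.1])
    (by simp; linarith [hb.2]) hab
  simpa using this

/-- A polynomial of degree `m'` has no nonzero weight of a plane rotation above `m'`. -/
lemma eq_zero_of_weight {i j : Fin p} (hij : i ≠ j) {m m' : ℕ} (hm : m' < m)
    {P : MvPolynomial (Fin p) ℂ} (hP : P.IsHomogeneous m')
    (h : ∀ (θ : ℝ) (x : E p),
      evalAt P (planeRotation hij θ x) = Complex.exp (θ * Complex.I) ^ m * evalAt P x) : P = 0 := by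
  refine evalAt_injective fun x => ?_
  obtain ⟨Q, hQ, hQe⟩ := exists_trig_polynomial hP
    (EuclideanSpace.single i (x i) + EuclideanSpace.single j (x j))
    (EuclideanSpace.single i (-x j) + EuclideanSpace.single j (x i))
    (x - (EuclideanSpace.single i (x i) + EuclideanSpace.single j (x j)))
  -- The weight condition forces Q to be a monomial of degree m' + m, which exceeds the bound 2m' on
  -- its degree. So its coefficient, the value P(x), is zero.
  have h1 : Q = Polynomial.C (evalAt P x) * Polynomial.X ^ (m' + m) := by
    refine Polynomial.eq_of_infinite_eval_eq _ _ (infinite_range_exp_mul_I.mono ?_)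
    rintro _ ⟨θ, rfl⟩
    simp only [Set.mem_ofPred_eq, Polynomial.eval_mul, Polynomial.eval_C, Polynomial.eval_pow,
      Polynomial.eval_X, hQe]
    have : x - (EuclideanSpace.single i (x i) + EuclideanSpace.single j (x j)) +
        (Real.cos θ • (EuclideanSpace.single i (x i) + EuclideanSpace.single j (x j)) +
          Real.sin θ • (EuclideanSpace.single i (-x j) + EuclideanSpace.single j (x i))) =
        planeRotation hij θ x := by
      rw [planeRotation_apply]
      ext k
      simp only [PiLp.add_apply, PiLp.sub_apply, PiLp.smul_apply, PiLp.single_apply, smul_eq_mul]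
      split_ifs <;> ring
    rw [this, h, pow_add]
    ring
  have h2 := congrArg (fun R => Polynomial.coeff R (m' + m)) h1
  simp only [Polynomial.coeff_C_mul, Polynomial.coeff_X_pow, if_true, mul_one] at h2
  rw [← h2, Polynomial.coeff_eq_zero_of_natDegree_lt (by omega)]
  simp [evalAt]

/-- Some nonzero element of `H p m` is an eigenvector of a family of isometries, with eigenvalues
that do not occur in `H p m'`. -/
lemma exists_separating (hp : 1 ≤ p) {m m' : ℕ} (hm : p = 1 → m ≤ 1) (hmm : m' < m) :
    ∃ h ∈ H p m, h ≠ 0 ∧ ∃ (g : ℝ → E p ≃ₗᵢ[ℝ] E p) (χ : ℝ → ℂ),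
      (∀ θ x, evalAt h (g θ x) = χ θ * evalAt h x) ∧
      ∀ h' ∈ H p m', (∀ θ (x : Sph p), evalAt h' (g θ x) = χ θ * evalAt h' x) → h' = 0 := by
  rcases Nat.lt_or_ge 1 p with h2 | h2
  · have hij : (⟨0, hp⟩ : Fin p) ≠ ⟨1, h2⟩ := by simp
    set i : Fin p := ⟨0, hp⟩
    set j : Fin p := ⟨1, h2⟩
    refine ⟨(X i + C Complex.I * X j) ^ m, X_add_I_mul_X_pow_mem_H hij m, ?_,
      planeRotation hij, fun θ => Complex.exp (θ * Complex.I) ^ m, ?_, ?_⟩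
    · intro h0
      have := congrArg (fun P => evalAt P (EuclideanSpace.single i 1)) h0
      simp [evalAt, hij.symm] at this
    · intro θ x
      simp only [evalAt_pow, evalAt_add, evalAt_mul, evalAt_C, evalAt_X]
      rw [← mul_pow, planeRotation_apply_left, planeRotation_apply_right, Complex.exp_mul_I]
      push_cast
      congr 1
      linear_combination (-Complex.sin θ * x j) * Complex.I_sq
    · intro h' hh' hw
      refine eq_zero_of_weight hij hmm (mem_H.1 hh').1 fun θ x => ?_
      by_cases hx : x = 0
      · subst hx
        rw [map_zero]
        -- The hypothesis only concerns the sphere. At the origin a constant polynomial is compared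
        -- with its value at a pole, and one of positive degree vanishes.
        by_cases hm' : m' = 0
        · have hpole := hw θ ⟨EuclideanSpace.single i 1, by simp⟩
          have hh := (mem_H.1 hh').1
          rw [hm', ← totalDegree_zero_iff_isHomogeneous, totalDegree_eq_zero_iff_eq_C] at hh
          rw [hh] at hpole ⊢
          simpa using hpole
        · have := evalAt_smul_of_isHomogeneous (mem_H.1 hh').1 0 0
          rw [zero_smul, Complex.ofReal_zero, zero_pow hm', zero_mul] at this
          rw [this, mul_zero]
      · exact evalAt_isometry_of_sphere hh' _ _ (hw θ) x (fun h => absurd h hx)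
  -- On the line the only degrees are 1 and 0, and x ↦ -x separates them with eigenvalue -1.
  · obtain rfl : p = 1 := by omega
    have hm1 := hm rfl
    obtain rfl : m = 1 := by omega
    obtain rfl : m' = 0 := by omega
    refine ⟨X 0, mem_H.2 ⟨isHomogeneous_X _ _, laplacian_eq_zero_of_lt (isHomogeneous_X _ _)
      (by norm_num)⟩, X_ne_zero _, fun _ => LinearIsometryEquiv.neg ℝ, fun _ => -1, ?_, ?_⟩
    · intro _ x
      simp
    · intro h' hh' hw
      have hh := (mem_H.1 hh').1
      rw [← totalDegree_zero_iff_isHomogeneous, totalDegree_eq_zero_iff_eq_C] at hh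
      have := hw 0 ⟨EuclideanSpace.single 0 1, by simp⟩
      rw [hh] at this ⊢
      simp only [evalAt_C] at this
      have h0 : coeff 0 h' = 0 := by linear_combination this / 2
      rw [h0, map_zero]

lemma exists_ne_zero_mem_H (hp : 1 ≤ p) {m : ℕ} (hm : p = 1 → m ≤ 1) : ∃ h ∈ H p m, h ≠ 0 := by
  rcases Nat.eq_zero_or_pos m with rfl | h
  · exact ⟨1, mem_H.2 ⟨isHomogeneous_one _ _, laplacian_eq_zero_of_lt (isHomogeneous_one _ _)
      (by norm_num)⟩, one_ne_zero⟩
  · obtain ⟨h, hh, h0, -⟩ := exists_separating hp hm h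
    exact ⟨h, hh, h0⟩

lemma sphRes_ne_zero (hp : 1 ≤ p) {m : ℕ} {h : MvPolynomial (Fin p) ℂ} (hh : h ∈ H p m) (h0 : h ≠ 0) :
    sphRes p h ≠ 0 := by
  intro hS
  have hS' : ∀ x : Sph p, evalAt h x.1 = 0 := fun x => congrArg (fun f : C(Sph p, ℂ) => f x) hS
  -- Homogeneity gives vanishing only away from the origin; the factor X takes care of the origin.
  refine h0 (mul_left_cancel₀ (X_ne_zero (R := ℂ) (⟨0, hp⟩ : Fin p)) (evalAt_injective fun x => ?_))
  rw [evalAt_mul, evalAt_mul, evalAt_X]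
  by_cases hx : x = 0
  · simp [hx]
  · rw [eq_zero_of_sphere hh hS' hx]
    simp [evalAt]

lemma extProd_ne_zero {u : C(Sph p, ℂ)} {v : C(Sph q, ℂ)} (hu : u ≠ 0) (hv : v ≠ 0) :
    extProd p q u v ≠ 0 := by
  obtain ⟨x, hx⟩ : ∃ x, u x ≠ 0 := by
    by_contra! h
    exact hu (ContinuousMap.ext h)
  obtain ⟨y, hy⟩ : ∃ y, v y ≠ 0 := by
    by_contra! h
    exact hv (ContinuousMap.ext h)
  intro h
  exact mul_ne_zero hx hy (congrArg (fun f : C(Om p q, ℂ) => f (x, y)) h)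

lemma biharm_ne_bot (hp : 1 ≤ p) (hq : 1 ≤ q) {m n : ℕ} (hm : p = 1 → m ≤ 1)
    (hn : q = 1 → n ≤ 1) : biharm p q m n ≠ ⊥ := by
  obtain ⟨h, hh, h0⟩ := exists_ne_zero_mem_H hp hm
  obtain ⟨k, hk, k0⟩ := exists_ne_zero_mem_H hq hn
  exact (Submodule.ne_bot_iff _).2 ⟨_, extProd_mem_biharm hh hk,
    extProd_ne_zero (sphRes_ne_zero hp hh h0) (sphRes_ne_zero hq hk k0)⟩

lemma biharm_eq_bot {m n : ℕ} (h : ¬((p = 1 → m ≤ 1) ∧ (q = 1 → n ≤ 1))) :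
    biharm p q m n = ⊥ := by
  rw [not_and_or] at h
  push Not at h
  rcases h with ⟨rfl, hm⟩ | ⟨rfl, hn⟩
  · rw [biharm, Y, H_one_eq_bot hm, Submodule.map_bot, Submodule.map₂_bot_left]
  · rw [biharm, Y, Y, H_one_eq_bot hn, Submodule.map_bot, Submodule.map₂_bot_right]

/-- An injective equivariant map can only raise the degrees. -/
lemma le_of_equivariant (hp : 1 ≤ p) (hq : 1 ≤ q) {m n m' n' : ℕ} (hm : p = 1 → m ≤ 1)
    (hn : q = 1 → n ≤ 1) (T : biharm p q m n →ₗ[ℂ] C(Om p q, ℂ)) (hT : Function.Injective T)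
    (hTm : ∀ F, T F ∈ biharm p q m' n')
    (hTe : ∀ (g : K p q) F, T ⟨translateOm g F.1, translateOm_mem_biharm g F.2⟩ =
      translateOm g (T F)) : m ≤ m' ∧ n ≤ n' := by
  constructor
  · by_contra! hlt
    obtain ⟨h, hh, h0, g, χ, h1, h2⟩ := exists_separating hp hm hlt
    obtain ⟨k, hk, k0⟩ := exists_ne_zero_mem_H hq hn
    -- An eigenvector in the first variable. The slices in x of its image have the same eigenvalues
    -- but degree m' < m, so they vanish, against injectivity.
    set F : biharm p q m n := ⟨_, extProd_mem_biharm hh hk⟩ with hF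
    have hF0 : F ≠ 0 := fun h => extProd_ne_zero (sphRes_ne_zero hp hh h0) (sphRes_ne_zero hq hk k0)
      (congrArg Subtype.val h)
    have hFe : ∀ θ, (⟨translateOm ((g θ)⁻¹, 1) F.1, translateOm_mem_biharm _ F.2⟩ : biharm p q m n)
        = χ θ • F := by
      intro θ
      refine Subtype.ext (ContinuousMap.ext fun w => ?_)
      have h3 : (translateOm ((g θ)⁻¹, 1) F.1) w = evalAt h (g θ w.1) * evalAt k w.2.1 := rfl
      rw [h3, h1, mul_assoc]
      rfl
    refine hF0 (hT ?_)
    rw [map_zero]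
    ext ⟨x, y⟩
    obtain ⟨h', hh', hs⟩ := exists_slice_left (hTm F) y
    rw [hs, h2 h' hh' fun θ x => ?_]
    · simp [evalAt]
    · have h4 := hTe ((g θ)⁻¹, 1) F
      rw [hFe, map_smul] at h4
      have h5 := congrArg (fun f : C(Om p q, ℂ) => f (x, y)) h4
      have h6 : (translateOm ((g θ)⁻¹, 1) (T F)) (x, y) = T F (sphAct (g θ) x, y) := rfl
      simp only [h6, hs, ContinuousMap.smul_apply, smul_eq_mul] at h5
      exact h5.symm
  · by_contra! hlt
    obtain ⟨k, hk, k0, g, χ, h1, h2⟩ := exists_separating hq hn hlt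
    obtain ⟨h, hh, h0⟩ := exists_ne_zero_mem_H hp hm
    set F : biharm p q m n := ⟨_, extProd_mem_biharm hh hk⟩ with hF
    have hF0 : F ≠ 0 := fun h => extProd_ne_zero (sphRes_ne_zero hp hh h0) (sphRes_ne_zero hq hk k0)
      (congrArg Subtype.val h)
    have hFe : ∀ θ, (⟨translateOm (1, (g θ)⁻¹) F.1, translateOm_mem_biharm _ F.2⟩ : biharm p q m n)
        = χ θ • F := by
      intro θ
      refine Subtype.ext (ContinuousMap.ext fun w => ?_)
      have h3 : (translateOm (1, (g θ)⁻¹) F.1) w = evalAt h w.1.1 * evalAt k (g θ w.2) := rfl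
      rw [h3, h1, mul_left_comm]
      rfl
    refine hF0 (hT ?_)
    rw [map_zero]
    ext ⟨x, y⟩
    obtain ⟨k', hk', hs⟩ := exists_slice_right (hTm F) x
    rw [hs, h2 k' hk' fun θ y => ?_]
    · simp [evalAt]
    · have h4 := hTe (1, (g θ)⁻¹) F
      rw [hFe, map_smul] at h4
      have h5 := congrArg (fun f : C(Om p q, ℂ) => f (x, y)) h4
      have h6 : (translateOm (1, (g θ)⁻¹) (T F)) (x, y) = T F (x, sphAct (g θ) y) := rfl
      simp only [h6, hs, ContinuousMap.smul_apply, smul_eq_mul] at h5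
      exact h5.symm

end LightCone

/-! ### Orthogonal projections, expansions and comparison of norms -/

namespace LightCone

open MvPolynomial MeasureTheory

variable {p q : ℕ}

/-- The image of `biharm p q m n` in `L²`. -/
noncomputable abbrev biharmL2 (p q m n : ℕ) : Submodule ℂ (Lp ℂ 2 (omMeas p q)) :=
  (biharm p q m n).map (toL2 p q).toLinearMap

/-- The identification of `biharm p q m n` with its image in `L²`. -/
noncomputable def biharmEquivL2 (p q m n : ℕ) : biharm p q m n ≃ₗ[ℂ] biharmL2 p q m n :=
  Submodule.equivMapOfInjective (toL2 p q).toLinearMap toL2_injective _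

lemma biharmEquivL2_coe {m n : ℕ} (F : biharm p q m n) :
    (biharmEquivL2 p q m n F : Lp ℂ 2 (omMeas p q)) = toL2 p q F.1 := rfl

lemma toL2_biharmEquivL2_symm {m n : ℕ} (u : biharmL2 p q m n) :
    toL2 p q ((biharmEquivL2 p q m n).symm u).1 = u.1 := by
  rw [← biharmEquivL2_coe, LinearEquiv.apply_symm_apply]

/-- The orthogonal projection of a continuous function to `biharm p q m n`. -/
noncomputable def biharmProj (p q m n : ℕ) : C(Om p q, ℂ) →ₗ[ℂ] biharm p q m n :=
  (biharmEquivL2 p q m n).symm.toLinearMap ∘ₗ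
    (biharmL2 p q m n).orthogonalProjectionOnto.toLinearMap ∘ₗ (toL2 p q).toLinearMap

lemma toL2_biharmProj (m n : ℕ) (f : C(Om p q, ℂ)) :
    toL2 p q (biharmProj p q m n f).1 = (biharmL2 p q m n).starProjection (toL2 p q f) :=
  toL2_biharmEquivL2_symm _

lemma inner_biharmProj {m n : ℕ} {G : C(Om p q, ℂ)} (hG : G ∈ biharm p q m n) (f : C(Om p q, ℂ)) :
    inner ℂ (toL2 p q G) (toL2 p q (biharmProj p q m n f).1) =
      inner ℂ (toL2 p q G) (toL2 p q f) := by
  have h := Submodule.sub_starProjection_mem_orthogonal (K := biharmL2 p q m n) (toL2 p q f)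
    (toL2 p q G) ⟨G, hG, rfl⟩
  rw [inner_sub_right, sub_eq_zero] at h
  rw [toL2_biharmProj, h]

lemma eq_of_inner_eq {m n : ℕ} {F F' : C(Om p q, ℂ)} (hF : F ∈ biharm p q m n)
    (hF' : F' ∈ biharm p q m n)
    (h : ∀ G ∈ biharm p q m n,
      inner ℂ (toL2 p q G) (toL2 p q F) = inner ℂ (toL2 p q G) (toL2 p q F')) : F = F' := by
  apply toL2_injective
  rw [← sub_eq_zero, ← inner_self_eq_zero (𝕜 := ℂ), ← map_sub]
  conv_lhs => arg 3; rw [map_sub]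
  rw [inner_sub_right, h _ (sub_mem hF hF'), sub_self]

lemma biharmProj_translateOm (m n : ℕ) (g : K p q) (f : C(Om p q, ℂ)) :
    (biharmProj p q m n (translateOm g f)).1 = translateOm g (biharmProj p q m n f).1 := by
  refine eq_of_inner_eq (biharmProj p q m n _).2
    (translateOm_mem_biharm g (biharmProj p q m n f).2) fun G hG => ?_
  have h : ∀ f', inner ℂ (toL2 p q G) (toL2 p q (translateOm g f')) =
      inner ℂ (toL2 p q (translateOm g⁻¹ G)) (toL2 p q f') := by
    intro f'
    rw [inner_toL2_translateOm_left, inv_inv]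
  rw [inner_biharmProj hG, h, h, inner_biharmProj (translateOm_mem_biharm _ hG)]

/-- By Schur's lemma, two of the spaces `biharm p q m n` are orthogonal, or their degrees are
ordered. -/
lemma inner_eq_zero_or_le (hp : 1 ≤ p) (hq : 1 ≤ q) {m n m' n' : ℕ} (hm : p = 1 → m ≤ 1)
    (hn : q = 1 → n ≤ 1) :
    (∀ F ∈ biharm p q m n, ∀ G ∈ biharm p q m' n', inner ℂ (toL2 p q G) (toL2 p q F) = 0) ∨
      (m ≤ m' ∧ n ≤ n') := by
  -- The projection to the other component is equivariant, so by irreducibility its kernel on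
  -- `biharm p q m n` is zero or everything. In the first case it is injective and orders the
  -- degrees, in the second the spaces are orthogonal.
  set T : biharm p q m n →ₗ[ℂ] C(Om p q, ℂ) :=
    (biharm p q m' n').subtype ∘ₗ biharmProj p q m' n' ∘ₗ (biharm p q m n).subtype with hT
  have hTe : ∀ (g : K p q) F, T ⟨translateOm g F.1, translateOm_mem_biharm g F.2⟩ =
      translateOm g (T F) := fun g F => biharmProj_translateOm _ _ _ _
  set W := T.ker.map (biharm p q m n).subtype with hW
  have hWinv : ∀ g : K p q, ∀ f ∈ W, translateOm g f ∈ W := by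
    rintro g _ ⟨F, hF, rfl⟩
    refine ⟨⟨translateOm g F.1, translateOm_mem_biharm g F.2⟩, ?_, rfl⟩
    rw [SetLike.mem_coe, LinearMap.mem_ker] at hF ⊢
    rw [hTe, hF, map_zero]
  rcases biharm_irreducible hp hq (Submodule.map_subtype_le _ _) hWinv with h | h
  · right
    have hker : T.ker = ⊥ := Submodule.map_injective_of_injective (Submodule.subtype_injective _)
      (h.trans (Submodule.map_bot _).symm)
    have hinj : Function.Injective T := by
      intro F F' hFF
      have hFF' : T (F - F') = 0 := (LinearMap.map_sub T F F').trans (sub_eq_zero.2 hFF)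
      have : F - F' ∈ T.ker := hFF'
      rw [hker, Submodule.mem_bot] at this
      exact Subtype.ext (sub_eq_zero.1 (congrArg Subtype.val this))
    exact le_of_equivariant hp hq hm hn T hinj
      (fun F => (biharmProj p q m' n' F.1).2) hTe
  · left
    intro F hF G hG
    rw [← h] at hF
    obtain ⟨F, hF, rfl⟩ := hF
    have hF' : (biharmProj p q m' n' F.1).1 = 0 := hF
    rw [← inner_biharmProj hG]
    change inner ℂ _ (toL2 p q (biharmProj p q m' n' F.1).1) = (0 : ℂ)
    rw [hF', map_zero, inner_zero_right]

/-- If Schur's lemma gave orthogonality in neither direction, the degrees would be ordered both ways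
and hence equal. -/
lemma inner_eq_zero_of_ne (hp : 1 ≤ p) (hq : 1 ≤ q) {i j : ℕ × ℕ} (hij : i ≠ j)
    {F : C(Om p q, ℂ)} (hF : F ∈ biharm p q i.1 i.2) {G : C(Om p q, ℂ)}
    (hG : G ∈ biharm p q j.1 j.2) : inner ℂ (toL2 p q G) (toL2 p q F) = 0 := by
  by_cases hi : (p = 1 → i.1 ≤ 1) ∧ (q = 1 → i.2 ≤ 1)
  swap
  · rw [biharm_eq_bot hi, Submodule.mem_bot] at hF
    rw [hF, map_zero, inner_zero_right]
  by_cases hj : (p = 1 → j.1 ≤ 1) ∧ (q = 1 → j.2 ≤ 1)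
  swap
  · rw [biharm_eq_bot hj, Submodule.mem_bot] at hG
    rw [hG, map_zero, inner_zero_left]
  rcases inner_eq_zero_or_le hp hq hi.1 hi.2 (m' := j.1) (n' := j.2) with h | h
  · exact h F hF G hG
  rcases inner_eq_zero_or_le hp hq hj.1 hj.2 (m' := i.1) (n' := i.2) with h' | h'
  · rw [← inner_conj_symm, h' G hG F hF, map_zero]
  · exact absurd (Prod.ext (le_antisymm h.1 h'.1) (le_antisymm h.2 h'.2)) hij

/-- A uniformly convergent expansion has the orthogonal projections as its terms. -/
lemma biharmProj_eq_of_hasSum (hp : 1 ≤ p) (hq : 1 ≤ q) {F : ℕ × ℕ → C(Om p q, ℂ)}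
    (hF : ∀ i, F i ∈ biharm p q i.1 i.2) {f : C(Om p q, ℂ)} (hf : HasSum F f) (j : ℕ × ℕ) :
    (biharmProj p q j.1 j.2 f).1 = F j := by
  refine eq_of_inner_eq (biharmProj p q _ _ f).2 (hF j) fun G hG => ?_
  rw [inner_biharmProj hG]
  -- Uniform convergence implies L² convergence, so the inner product with G may be taken termwise,
  -- and orthogonality leaves only the term j.
  have h1 := ((innerSL ℂ (toL2 p q G)) ∘L (toL2 p q)).hasSum hf
  have h2 := hasSum_single (f := fun i => ((innerSL ℂ (toL2 p q G)) ∘L (toL2 p q)) (F i)) j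
    (fun i hi => inner_eq_zero_of_ne hp hq hi (hF i) hG)
  exact h1.unique h2

/-- If the projections of a continuous function are uniformly summable, then their sum is the
function. -/
lemma hasSum_biharmProj (hp : 1 ≤ p) (hq : 1 ≤ q) {f : C(Om p q, ℂ)}
    (hs : Summable fun i : ℕ × ℕ => (biharmProj p q i.1 i.2 f).1) :
    HasSum (fun i : ℕ × ℕ => (biharmProj p q i.1 i.2 f).1) f := by
  obtain ⟨g, hg⟩ := hs
  have h1 := fun j => biharmProj_eq_of_hasSum hp hq (fun i => (biharmProj p q i.1 i.2 f).2) hg j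
  -- The sum g has the same projections as f, so f - g is orthogonal to every component and, by
  -- density, to everything.
  have h2 : ∀ G : C(Om p q, ℂ), inner ℂ (toL2 p q G) (toL2 p q (f - g)) = 0 := by
    have hcl : IsClosed {G : C(Om p q, ℂ) | inner ℂ (toL2 p q G) (toL2 p q (f - g)) = 0} :=
      isClosed_eq ((toL2 p q).continuous.inner continuous_const) continuous_const
    intro G
    have hG : G ∈ (⨆ i : ℕ × ℕ, biharm p q i.1 i.2).topologicalClosure := by
      rw [iSup_biharm_topologicalClosure hp hq]; trivial
    refine closure_minimal (fun G hG => ?_) hcl hG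
    rw [Set.mem_ofPred_eq]
    induction hG using Submodule.iSup_induction' with
    | mem i G hG =>
      rw [map_sub, inner_sub_right, ← inner_biharmProj hG, ← inner_biharmProj hG g, h1 i, sub_self]
    | zero => rw [map_zero, inner_zero_left]
    | add G G' _ _ h h' => rw [map_add, inner_add_left, h, h', add_zero]
  have h3 : toL2 p q (f - g) = 0 := inner_self_eq_zero.1 (h2 (f - g))
  have h4 : f = g := sub_eq_zero.1 (toL2_injective (h3.trans (map_zero _).symm))
  rwa [← h4] at hg

lemma norm_toL2_translateOm (g : K p q) (f : C(Om p q, ℂ)) :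
    ‖toL2 p q (translateOm g f)‖ = ‖toL2 p q f‖ := by
  rw [@norm_eq_sqrt_re_inner ℂ, inner_toL2_translateOm, ← @norm_eq_sqrt_re_inner ℂ]

lemma norm_toL2_sq (f : C(Om p q, ℂ)) : ‖toL2 p q f‖ ^ 2 = ∫ w, ‖f w‖ ^ 2 ∂(omMeas p q) := by
  rw [@norm_sq_eq_re_inner ℂ, inner_toL2]
  have : ∀ w, f w * star (f w) = ((‖f w‖ ^ 2 : ℝ) : ℂ) := by
    intro w
    rw [Complex.star_def, Complex.mul_conj, Complex.normSq_eq_norm_sq]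
  simp only [this]
  rw [integral_complex_ofReal]
  simp

lemma sphere_nonempty (hp : 1 ≤ p) : Nonempty (Sph p) := ⟨pole ⟨0, hp⟩⟩

lemma omMeas_real_univ_pos (hp : 1 ≤ p) (hq : 1 ≤ q) : 0 < (omMeas p q).real Set.univ := by
  have := sphere_nonempty hp
  have := sphere_nonempty hq
  exact ENNReal.toReal_pos (isOpen_univ.measure_ne_zero _ Set.univ_nonempty) (measure_ne_top _ _)

/-- The reproducing kernel bounds the values by the `L²` norm. -/
lemma norm_apply_sq_le {m n : ℕ} {F : C(Om p q, ℂ)}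
    (hF : F ∈ biharm p q m n) (w : Om p q) :
    ‖F w‖ ^ 2 * (omMeas p q).real Set.univ ≤
      Module.finrank ℂ (biharm p q m n) * ‖toL2 p q F‖ ^ 2 := by
  choose z hz hzW using exists_reproducing (biharm p q m n)
  -- By transitivity the reproducing functions at different points are translates of each other,
  -- hence have equal norms.
  have hconst : ∀ w', ‖toL2 p q (z w')‖ = ‖toL2 p q (z w)‖ := by
    intro w'
    obtain ⟨g, hg⟩ := exists_omAct_eq w w'
    have : z w' = translateOm g (z w) := by
      refine eq_of_inner_eq (hz w') (translateOm_mem_biharm g (hz w)) fun G hG => ?_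
      rw [← inner_conj_symm, hzW _ _ hG, ← inner_conj_symm (toL2 p q G) (toL2 p q (translateOm _ _)),
        inner_toL2_translateOm_left,
        hzW _ _ (translateOm_mem_biharm _ hG), translateOm_apply, inv_inv, hg]
    rw [this, norm_toL2_translateOm]
  have hfin : FiniteDimensional ℂ (biharmL2 p q m n) := inferInstance
  let b := stdOrthonormalBasis ℂ (biharmL2 p q m n)
  let e : Fin (Module.finrank ℂ (biharmL2 p q m n)) → C(Om p q, ℂ) :=
    fun i => ((biharmEquivL2 p q m n).symm (b i)).1
  have heb : ∀ i, toL2 p q (e i) = (b i).1 := fun i => toL2_biharmEquivL2_symm _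
  have hsum : ∀ w', ∑ i, ‖e i w'‖ ^ 2 = ‖toL2 p q (z w)‖ ^ 2 := by
    intro w'
    have h1 := b.sum_sq_norm_inner_left ⟨toL2 p q (z w'), ⟨z w', hz w', rfl⟩⟩
    rw [← hconst w']
    refine Eq.trans (Finset.sum_congr rfl fun i _ => ?_) h1
    rw [← hzW w' (e i) ((biharmEquivL2 p q m n).symm (b i)).2, heb]
    rfl
  -- Integrating the sum of |e_i|² over an orthonormal basis: each term contributes 1, and the sum
  -- is the constant ‖z w‖².
  have hint : (Module.finrank ℂ (biharm p q m n) : ℝ) =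
      ‖toL2 p q (z w)‖ ^ 2 * (omMeas p q).real Set.univ := by
    have h1 : ∫ w', ∑ i, ‖e i w'‖ ^ 2 ∂(omMeas p q) =
        ‖toL2 p q (z w)‖ ^ 2 * (omMeas p q).real Set.univ := by
      simp only [hsum]
      rw [integral_const, smul_eq_mul, mul_comm]
    rw [← h1, integral_finsetSum]
    · have h2 : ∀ i, ∫ w', ‖e i w'‖ ^ 2 ∂(omMeas p q) = 1 := by
        intro i
        rw [← norm_toL2_sq, heb]
        have := b.orthonormal.1 i
        rw [Submodule.coe_norm] at this
        rw [this, one_pow]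
      simp only [h2]
      simp [(biharmEquivL2 p q m n).finrank_eq]
    · intro i _
      have : Continuous fun w' => ‖e i w'‖ ^ 2 := by fun_prop
      exact this.integrable_of_hasCompactSupport (HasCompactSupport.of_compactSpace _)
  rw [hint]
  have h1 : ‖F w‖ ≤ ‖toL2 p q (z w)‖ * ‖toL2 p q F‖ := by
    rw [← hzW w F hF]
    exact norm_inner_le_norm _ _
  have h2 : ‖F w‖ ^ 2 ≤ (‖toL2 p q (z w)‖ * ‖toL2 p q F‖) ^ 2 := by gcongr
  calc _ ≤ (‖toL2 p q (z w)‖ * ‖toL2 p q F‖) ^ 2 * (omMeas p q).real Set.univ := by gcongr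
    _ = _ := by ring

/-- The loss from L² to the supremum norm is polynomial in the degrees, so rapid decay passes from
one to the other. -/
lemma exists_norm_le_norm_toL2 (hp : 1 ≤ p) (hq : 1 ≤ q) : ∃ C : ℝ, 0 ≤ C ∧
    ∀ (m n : ℕ), ∀ F ∈ biharm p q m n,
      ‖F‖ ≤ C * ((m + 1) ^ p * (n + 1) ^ q) * ‖toL2 p q F‖ := by
  have hv := omMeas_real_univ_pos hp hq
  set v := (omMeas p q).real Set.univ
  refine ⟨Real.sqrt v⁻¹, Real.sqrt_nonneg _, fun m n F hF => ?_⟩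
  rw [ContinuousMap.norm_le _ (by positivity)]
  intro w
  have h1 := norm_apply_sq_le hF w
  have h2 : (Module.finrank ℂ (biharm p q m n) : ℝ) ≤ (m + 1) ^ p * (n + 1) ^ q := by
    exact_mod_cast finrank_biharm_le p q m n
  set D : ℝ := (m + 1) ^ p * (n + 1) ^ q with hD
  -- The kernel bound has the square of the norm on both sides and D to the first power; D ≤ D²
  -- allows a root to be taken.
  have hD1 : 1 ≤ D := by
    have h3 : (1 : ℝ) ≤ (m + 1) ^ p := one_le_pow₀ (by linarith [Nat.cast_nonneg (α := ℝ) m])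
    have h4 : (1 : ℝ) ≤ (n + 1) ^ q := one_le_pow₀ (by linarith [Nat.cast_nonneg (α := ℝ) n])
    nlinarith
  refine abs_le_of_sq_le_sq' (b := Real.sqrt v⁻¹ * D * ‖toL2 p q F‖) ?_ (by positivity) |>.2
  rw [mul_pow, mul_pow, Real.sq_sqrt (by positivity)]
  calc ‖F w‖ ^ 2 = v⁻¹ * (‖F w‖ ^ 2 * v) := by field_simp
    _ ≤ v⁻¹ * (Module.finrank ℂ (biharm p q m n) * ‖toL2 p q F‖ ^ 2) := by gcongr
    _ ≤ v⁻¹ * (D ^ 2 * ‖toL2 p q F‖ ^ 2) := by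
      gcongr
      nlinarith
    _ = _ := by ring

end LightCone

/-! ### Weak Bernstein inequalities and bounds for higher derivatives -/

namespace LightCone

open MvPolynomial MeasureTheory

variable {p q : ℕ}

/-- Cauchy's estimate on the unit circle: the k-th derivative at 0 is k! times the coefficient. -/
lemma norm_coeff_le_of_circle {Q : Polynomial ℂ} {M : ℝ}
    (h : ∀ θ : ℝ, ‖Q.eval (Complex.exp (θ * Complex.I))‖ ≤ M) (k : ℕ) : ‖Q.coeff k‖ ≤ M := by
  have h1 : ∀ n : ℕ, iteratedDeriv n (fun z : ℂ => Q.eval z) =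
      fun z => (Polynomial.derivative^[n] Q).eval z := by
    intro n
    induction n with
    | zero => simp
    | succ n ih =>
      rw [iteratedDeriv_succ, ih]
      ext z
      rw [Polynomial.deriv, Function.iterate_succ_apply']
  have h2 := Complex.norm_iteratedDeriv_le_of_forall_mem_sphere_norm_le (c := 0) (R := 1) (C := M)
    (f := fun z : ℂ => Q.eval z) k one_pos Q.differentiable.diffContOnCl (by
      intro z hz
      have hz1 : ‖z‖ = 1 := by simpa using hz
      have : z = Complex.exp (z.arg * Complex.I) := by
        conv_lhs => rw [← Complex.norm_mul_exp_arg_mul_I z, hz1]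
        simp
      rw [this]
      exact h _)
  rw [h1] at h2
  simp only [one_pow, div_one] at h2
  rw [← Polynomial.coeff_zero_eq_eval_zero, Polynomial.coeff_iterate_derivative, zero_add,
    Nat.descFactorial_self, nsmul_eq_mul, norm_mul, Complex.norm_natCast] at h2
  exact le_of_mul_le_mul_left h2 (by positivity)

/-- A weak form of Bernstein's inequality for trigonometric polynomials. -/
lemma norm_deriv_le_of_trig {m : ℕ} {Q : Polynomial ℂ} (hQ : Q.natDegree ≤ 2 * m) {T : ℝ → ℂ}
    (hT : ∀ θ : ℝ, Q.eval (Complex.exp (θ * Complex.I)) = Complex.exp (θ * Complex.I) ^ m * T θ)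
    {M : ℝ} (hM : ∀ θ, ‖T θ‖ ≤ M) {T' : ℂ} (hT' : HasDerivAt T T' 0) :
    ‖T'‖ ≤ (4 * m ^ 2 + 3 * m) * M := by
  have hexp : ∀ θ : ℝ, ‖Complex.exp (θ * Complex.I)‖ = 1 := Complex.norm_exp_ofReal_mul_I
  have hQM : ∀ θ : ℝ, ‖Q.eval (Complex.exp (θ * Complex.I))‖ ≤ M := by
    intro θ
    rw [hT, norm_mul, norm_pow, hexp, one_pow, one_mul]
    exact hM θ
  have hM0 : 0 ≤ M := (norm_nonneg _).trans (hM 0)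
  -- At most 2m + 1 coefficients occur, each bounded by 2m * M.
  have hd : ‖(Polynomial.derivative Q).eval 1‖ ≤ (2 * m) * (2 * m + 1) * M := by
    have hN : (Polynomial.derivative Q).natDegree < 2 * m + 1 := by
      have := Polynomial.natDegree_derivative_le Q
      omega
    rw [Polynomial.eval_eq_sum_range' hN]
    refine (norm_sum_le _ _).trans ?_
    have : ∀ i ∈ Finset.range (2 * m + 1),
        ‖(Polynomial.derivative Q).coeff i * 1 ^ i‖ ≤ (2 * m) * M := by
      intro i hi
      rw [Polynomial.coeff_derivative, one_pow, mul_one, norm_mul]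
      by_cases h : i + 1 ≤ 2 * m
      · have h1 : ‖((i : ℂ) + 1)‖ ≤ 2 * m := by
          have : ((i : ℂ) + 1) = ((i + 1 : ℕ) : ℂ) := by push_cast; ring
          rw [this, Complex.norm_natCast]
          exact_mod_cast h
        rw [mul_comm]
        exact mul_le_mul h1 (norm_coeff_le_of_circle hQM _) (norm_nonneg _) (by positivity)
      · rw [Polynomial.coeff_eq_zero_of_natDegree_lt (by omega), norm_zero, zero_mul]
        positivity
    refine (Finset.sum_le_sum this).trans ?_
    rw [Finset.sum_const, Finset.card_range, nsmul_eq_mul]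
    push_cast
    apply le_of_eq
    ring
  have he : HasDerivAt (fun θ : ℝ => Complex.exp (θ * Complex.I)) Complex.I 0 := by
    have h1 : HasDerivAt (fun θ : ℝ => (θ : ℂ) * Complex.I) (1 * Complex.I) 0 :=
      (Complex.ofRealCLM.hasDerivAt (x := (0 : ℝ))).mul_const _
    have := h1.cexp
    simpa using this
  have hA : HasDerivAt (fun θ : ℝ => Q.eval (Complex.exp (θ * Complex.I)))
      ((Polynomial.derivative Q).eval 1 * Complex.I) 0 := by
    have h1 := Q.hasDerivAt (Complex.exp ((0 : ℝ) * Complex.I))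
    have := HasDerivAt.scomp (0 : ℝ) h1 he
    simpa [mul_comm, Function.comp_def] using this
  have hB := (he.pow m).mul hT'
  -- This is the derivative of Q(exp(iθ)) = exp(imθ) T(θ) at θ = 0. The final constant is 2m(2m + 1)
  -- + m = 4m² + 3m.
  have hAB : (Polynomial.derivative Q).eval 1 * Complex.I = m * Complex.I * T 0 + T' := by
    have h2 := hA.unique (hB.congr_of_eventuallyEq (Filter.Eventually.of_forall hT))
    rw [h2]
    simp
  have : T' = (Polynomial.derivative Q).eval 1 * Complex.I - m * Complex.I * T 0 := by
    rw [hAB]; ring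
  rw [this]
  refine (norm_sub_le _ _).trans ?_
  rw [norm_mul, norm_mul, norm_mul, Complex.norm_I, mul_one, mul_one, Complex.norm_natCast]
  have h3 : (m : ℝ) * ‖T 0‖ ≤ m * M := by gcongr; exact hM 0
  nlinarith

/-- The functions on `ℝ^p ⊕ ℝ^q` which are sums of products of homogeneous polynomials of degrees
`m` and `n`. -/
noncomputable def bihom (p q m n : ℕ) : Submodule ℂ (E p × E q → ℂ) :=
  Submodule.span ℂ {F | ∃ (h : MvPolynomial (Fin p) ℂ) (k : MvPolynomial (Fin q) ℂ),
    h.IsHomogeneous m ∧ k.IsHomogeneous n ∧ F = fun w => evalAt h w.1 * evalAt k w.2}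

lemma mul_mem_bihom {m n : ℕ} {h : MvPolynomial (Fin p) ℂ} {k : MvPolynomial (Fin q) ℂ}
    (hh : h.IsHomogeneous m) (hk : k.IsHomogeneous n) :
    (fun w => evalAt h w.1 * evalAt k w.2) ∈ bihom p q m n :=
  Submodule.subset_span ⟨h, k, hh, hk, rfl⟩

lemma hasFDerivAt_evalAt (h : MvPolynomial (Fin p) ℂ) (x : E p) :
    ∃ L : E p →L[ℝ] ℂ, HasFDerivAt (evalAt h) L x ∧
      ∀ v, L v = ∑ i, (v i : ℂ) * evalAt (pderiv i h) x := by
  induction h using MvPolynomial.induction_on with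
  | C c =>
    refine ⟨0, ?_, fun v => by simp [evalAt]⟩
    have : evalAt (C c : MvPolynomial (Fin p) ℂ) = fun _ => c := by ext; simp
    rw [this]
    exact hasFDerivAt_const _ _
  | add f g hf hg =>
    obtain ⟨L, hL, h1⟩ := hf
    obtain ⟨L', hL', h1'⟩ := hg
    refine ⟨L + L', ?_, fun v => ?_⟩
    · have : evalAt (f + g) = fun x => evalAt f x + evalAt g x := by ext; rw [evalAt_add]
      rw [this]
      exact hL.add hL'
    · simp [h1, h1', evalAt_add, mul_add, Finset.sum_add_distrib]
  | mul_X f i hf =>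
    obtain ⟨L, hL, h1⟩ := hf
    have hX : HasFDerivAt (fun x : E p => ((x i : ℝ) : ℂ))
        (Complex.ofRealCLM ∘L (EuclideanSpace.proj i : E p →L[ℝ] ℝ)) x :=
      (Complex.ofRealCLM ∘L (EuclideanSpace.proj i : E p →L[ℝ] ℝ)).hasFDerivAt
    have : evalAt (f * X i) = fun x => evalAt f x * ((x i : ℝ) : ℂ) := by
      ext; rw [evalAt_mul, evalAt_X]
    refine ⟨_, by rw [this]; exact hL.mul hX, fun v => ?_⟩
    simp only [_root_.add_apply, _root_.smul_apply, h1,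
      Derivation.leibniz, evalAt_add, smul_eq_mul, evalAt_mul, evalAt_X, mul_add,
      Finset.sum_add_distrib, ContinuousLinearMap.comp_apply, Complex.ofRealCLM_apply,
      EuclideanSpace.coe_proj]
    congr 1
    · rw [Finset.sum_eq_single i]
      · rw [pderiv_X_self]
        simp [evalAt]; ring
      · intro j _ hj
        rw [pderiv_X_of_ne hj.symm]
        simp [evalAt]
      · simp
    · rw [Finset.mul_sum]
      exact Finset.sum_congr rfl fun j _ => by ring

lemma contDiff_of_mem_bihom {m n : ℕ} {G : E p × E q → ℂ} (hG : G ∈ bihom p q m n) :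
    ContDiff ℝ ∞ G := by
  induction hG using Submodule.span_induction with
  | mem G hG =>
    obtain ⟨h, k, -, -, rfl⟩ := hG
    exact ((contDiff_evalAt h).comp contDiff_fst).mul ((contDiff_evalAt k).comp contDiff_snd)
  | zero => exact contDiff_const
  | add F G _ _ hF hG => exact hF.add hG
  | smul c F _ hF => exact contDiff_const.smul hF

/-- Partial derivatives stay in the same class of functions, so first-order estimates can be
iterated. In degree 0 they vanish, so the truncated m - 1 is harmless. -/
lemma exists_fderiv_of_mem_bihom {m n : ℕ} {G : E p × E q → ℂ} (hG : G ∈ bihom p q m n) :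
    ∃ (D : Fin p → E p × E q → ℂ) (D' : Fin q → E p × E q → ℂ),
      (∀ i, D i ∈ bihom p q (m - 1) n) ∧ (∀ j, D' j ∈ bihom p q m (n - 1)) ∧
      ∀ w v, fderiv ℝ G w v = ∑ i, (v.1 i : ℂ) * D i w + ∑ j, (v.2 j : ℂ) * D' j w := by
  induction hG using Submodule.span_induction with
  | mem G hG =>
    obtain ⟨h, k, hh, hk, rfl⟩ := hG
    refine ⟨fun i w => evalAt (pderiv i h) w.1 * evalAt k w.2,
      fun j w => evalAt h w.1 * evalAt (pderiv j k) w.2,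
      fun i => mul_mem_bihom hh.pderiv hk, fun j => mul_mem_bihom hh hk.pderiv, fun w v => ?_⟩
    obtain ⟨L, hL, h1⟩ := hasFDerivAt_evalAt h w.1
    obtain ⟨L', hL', h1'⟩ := hasFDerivAt_evalAt k w.2
    have := (hL.comp w hasFDerivAt_fst).mul (hL'.comp w hasFDerivAt_snd)
    have h2 := this.fderiv
    change fderiv ℝ (fun w : E p × E q => evalAt h w.1 * evalAt k w.2) w = _ at h2
    rw [h2]
    simp only [Function.comp_apply, _root_.add_apply, _root_.smul_apply,
      ContinuousLinearMap.comp_apply, ContinuousLinearMap.coe_fst', ContinuousLinearMap.coe_snd',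
      h1, h1', smul_eq_mul, Finset.mul_sum]
    rw [add_comm]
    congr 1
    · exact Finset.sum_congr rfl fun _ _ => by ring
    · exact Finset.sum_congr rfl fun _ _ => by ring
  | zero =>
    refine ⟨0, 0, fun _ => zero_mem _, fun _ => zero_mem _, fun w v => ?_⟩
    rw [fderiv_zero]
    simp
  | add F G hFm hGm hF hG =>
    obtain ⟨D, D', h1, h2, h3⟩ := hF
    obtain ⟨B, B', g1, g2, g3⟩ := hG
    refine ⟨D + B, D' + B', fun i => add_mem (h1 i) (g1 i), fun i => add_mem (h2 i) (g2 i),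
      fun w v => ?_⟩
    rw [fderiv_add ((contDiff_of_mem_bihom hFm).differentiable (by simp) w)
      ((contDiff_of_mem_bihom hGm).differentiable (by simp) w), _root_.add_apply, h3, g3]
    simp only [Pi.add_apply, mul_add, Finset.sum_add_distrib]
    ring
  | smul c F hFm hF =>
    obtain ⟨D, D', h1, h2, h3⟩ := hF
    refine ⟨c • D, c • D', fun i => Submodule.smul_mem _ _ (h1 i),
      fun i => Submodule.smul_mem _ _ (h2 i), fun w v => ?_⟩
    rw [fderiv_const_smul ((contDiff_of_mem_bihom hFm).differentiable (by simp) w),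
      _root_.smul_apply, h3]
    simp only [Pi.smul_apply, smul_eq_mul, mul_add, Finset.mul_sum]
    congr 1
    · exact Finset.sum_congr rfl fun _ _ => by ring
    · exact Finset.sum_congr rfl fun _ _ => by ring

lemma bihom_smul {m n : ℕ} {G : E p × E q → ℂ} (hG : G ∈ bihom p q m n) (s t : ℝ) (w : E p × E q) :
    G (s • w.1, t • w.2) = (s : ℂ) ^ m * (t : ℂ) ^ n * G w := by
  induction hG using Submodule.span_induction with
  | mem G hG =>
    obtain ⟨h, k, hh, hk, rfl⟩ := hG
    simp only [evalAt_smul_of_isHomogeneous hh, evalAt_smul_of_isHomogeneous hk]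
    ring
  | zero => simp
  | add F G _ _ hF hG => simp only [Pi.add_apply, hF, hG]; ring
  | smul c F _ hF => simp only [Pi.smul_apply, hF, smul_eq_mul]; ring

lemma bihom_trig_left {m n : ℕ} {G : E p × E q → ℂ} (hG : G ∈ bihom p q m n) (x x' : E p)
    (y : E q) : ∃ Q : Polynomial ℂ, Q.natDegree ≤ 2 * m ∧ ∀ θ : ℝ,
      Q.eval (Complex.exp (θ * Complex.I)) = Complex.exp (θ * Complex.I) ^ m *
        G (Real.cos θ • x + Real.sin θ • x', y) := by
  induction hG using Submodule.span_induction with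
  | mem G hG =>
    obtain ⟨h, k, hh, hk, rfl⟩ := hG
    obtain ⟨Q, hQ, hQe⟩ := exists_trig_polynomial hh x x' 0
    refine ⟨Q * Polynomial.C (evalAt k y), (Polynomial.natDegree_mul_C_le _ _).trans hQ, fun θ => ?_⟩
    rw [Polynomial.eval_mul, hQe, Polynomial.eval_C, zero_add]
    ring
  | zero => exact ⟨0, by simp, by simp⟩
  | add F G _ _ hF hG =>
    obtain ⟨Q, hQ, hQe⟩ := hF
    obtain ⟨R, hR, hRe⟩ := hG
    refine ⟨Q + R, Polynomial.natDegree_add_le_of_degree_le hQ hR, fun θ => ?_⟩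
    rw [Polynomial.eval_add, hQe, hRe, Pi.add_apply]
    ring
  | smul c F _ hF =>
    obtain ⟨Q, hQ, hQe⟩ := hF
    refine ⟨c • Q, (Polynomial.natDegree_smul_le _ _).trans hQ, fun θ => ?_⟩
    rw [Polynomial.eval_smul, hQe, Pi.smul_apply, smul_eq_mul, smul_eq_mul]
    ring

lemma bihom_swap {m n : ℕ} {G : E p × E q → ℂ} (hG : G ∈ bihom p q m n) :
    (fun w : E q × E p => G w.swap) ∈ bihom q p n m := by
  induction hG using Submodule.span_induction with
  | mem G hG =>
    obtain ⟨h, k, hh, hk, rfl⟩ := hG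
    have := mul_mem_bihom hk hh
    simpa [mul_comm] using this
  | zero => exact zero_mem _
  | add F G _ _ hF hG => exact add_mem hF hG
  | smul c F _ hF => exact Submodule.smul_mem _ c hF

/-- A weak form of Bernstein's inequality for polynomials on the sphere. -/
lemma norm_fderiv_left_le {m n : ℕ} {G : E p × E q → ℂ} (hG : G ∈ bihom p q m n) {M : ℝ}
    (hM : ∀ w : Om p q, ‖G (w.1.1, w.2.1)‖ ≤ M) (w : Om p q) {e : E p} (he : ‖e‖ = 1) :
    ‖fderiv ℝ G (w.1.1, w.2.1) (e, 0)‖ ≤ 4 * (m + 1) ^ 2 * M := by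
  have hM0 : 0 ≤ M := (norm_nonneg _).trans (hM w)
  set x : E p := w.1.1 with hx
  set y : E q := w.2.1 with hy
  have hx1 : ‖x‖ = 1 := by simp [hx]
  have hdiff := (contDiff_of_mem_bihom hG).differentiable (by simp) (x, y)
  -- The radial derivative is given by Euler's identity.
  have hrad : fderiv ℝ G (x, y) (x, 0) = m * G (x, y) := by
    have hc : HasDerivAt (fun s : ℝ => ((s • x, y) : E p × E q)) (x, 0) 1 := by
      have := ((hasDerivAt_id (1 : ℝ)).smul_const x).prodMk (hasDerivAt_const (1 : ℝ) y)
      simpa using this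
    have h1 : HasDerivAt (fun s : ℝ => G (s • x, y)) (fderiv ℝ G (x, y) (x, 0)) 1 := by
      refine HasFDerivAt.comp_hasDerivAt (1 : ℝ) ?_ hc
      rw [one_smul]
      exact hdiff.hasFDerivAt
    have h2 : (fun s : ℝ => G (s • x, y)) = fun s : ℝ => (s : ℂ) ^ m * G (x, y) := by
      ext s
      have := bihom_smul hG s 1 (x, y)
      simpa using this
    have h3 : HasDerivAt (fun s : ℝ => (s : ℂ) ^ m * G (x, y)) (m * G (x, y)) 1 := by
      have := ((Complex.ofRealCLM.hasDerivAt (x := (1 : ℝ))).pow m).mul_const (G (x, y))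
      simpa using this
    rw [h2] at h1
    exact h1.unique h3
  -- The great circle through x with velocity v stays on the sphere, where G is bounded by M and is
  -- a trigonometric polynomial of degree at most m.
  have htan : ∀ v : E p, inner ℝ x v = 0 → ‖v‖ = 1 →
      ‖fderiv ℝ G (x, y) (v, 0)‖ ≤ (4 * m ^ 2 + 3 * m) * M := by
    intro v hv hv1
    obtain ⟨Q, hQ, hQe⟩ := bihom_trig_left hG x v y
    refine norm_deriv_le_of_trig hQ hQe (fun θ => ?_) ?_
    · have : ‖Real.cos θ • x + Real.sin θ • v‖ = 1 := by
        rw [← sq_eq_sq₀ (norm_nonneg _) zero_le_one, norm_add_sq_real, inner_smul_left,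
          inner_smul_right, hv, norm_smul, norm_smul, hx1, hv1]
        simp
      exact hM (⟨_, by simpa using this⟩, w.2)
    · have hc : HasDerivAt (fun θ : ℝ => ((Real.cos θ • x + Real.sin θ • v, y) : E p × E q))
          (v, 0) 0 := by
        have := (((Real.hasDerivAt_cos 0).smul_const x).add
          ((Real.hasDerivAt_sin 0).smul_const v)).prodMk (hasDerivAt_const (0 : ℝ) y)
        simpa using this
      refine HasFDerivAt.comp_hasDerivAt (0 : ℝ) ?_ hc
      simpa using hdiff.hasFDerivAt
  set c := inner ℝ x e with hc
  have hc1 : |c| ≤ 1 := by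
    have := abs_real_inner_le_norm x e
    rwa [hx1, he, one_mul] at this
  set v := e - c • x with hv
  have hxv : inner ℝ x v = 0 := by
    rw [hv, inner_sub_right, inner_smul_right, real_inner_self_eq_norm_sq, hx1]
    simp [hc]
  have hv1 : ‖v‖ ≤ 1 := by
    have h1 : ‖e‖ ^ 2 = ‖c • x‖ ^ 2 + ‖v‖ ^ 2 := by
      have : e = c • x + v := by rw [hv]; abel
      conv_lhs => rw [this]
      rw [norm_add_sq_real, inner_smul_left, hxv]
      simp
    rw [he] at h1
    nlinarith [sq_nonneg ‖c • x‖, norm_nonneg v]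
  have hvb : ‖fderiv ℝ G (x, y) (v, 0)‖ ≤ (4 * m ^ 2 + 3 * m) * M := by
    by_cases hv0 : v = 0
    · have : ((v, 0) : E p × E q) = 0 := by rw [hv0]; rfl
      rw [this, map_zero, norm_zero]
      positivity
    · have hv0' : ‖v‖ ≠ 0 := norm_ne_zero_iff.2 hv0
      have h1 := htan (‖v‖⁻¹ • v) (by rw [inner_smul_right, hxv, mul_zero])
        (by rw [norm_smul, norm_inv, norm_norm, inv_mul_cancel₀ hv0'])
      have h2 : ((v, 0) : E p × E q) = ‖v‖ • (‖v‖⁻¹ • v, 0) := by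
        rw [Prod.smul_mk, smul_smul, mul_inv_cancel₀ hv0', one_smul, smul_zero]
      rw [h2, map_smul, norm_smul, norm_norm]
      calc _ ≤ 1 * ((4 * m ^ 2 + 3 * m) * M) := by gcongr
        _ = _ := one_mul _
  have he' : ((e, 0) : E p × E q) = c • (x, 0) + (v, 0) := by
    rw [Prod.smul_mk, Prod.mk_add_mk, smul_zero, add_zero, hv]
    congr 1
    abel
  rw [he', map_add, map_smul, hrad]
  refine (norm_add_le _ _).trans ?_
  have h3 : ‖c • ((m : ℂ) * G (x, y))‖ ≤ m * M := by
    rw [norm_smul, norm_mul, Complex.norm_natCast, Real.norm_eq_abs]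
    calc |c| * (m * ‖G (x, y)‖) ≤ 1 * (m * M) := by gcongr; exact hM w
      _ = _ := one_mul _
  nlinarith

lemma norm_fderiv_right_le {m n : ℕ} {G : E p × E q → ℂ} (hG : G ∈ bihom p q m n) {M : ℝ}
    (hM : ∀ w : Om p q, ‖G (w.1.1, w.2.1)‖ ≤ M) (w : Om p q) {e : E q} (he : ‖e‖ = 1) :
    ‖fderiv ℝ G (w.1.1, w.2.1) (0, e)‖ ≤ 4 * (n + 1) ^ 2 * M := by
  have h1 := norm_fderiv_left_le (bihom_swap hG) (M := M) (fun w => hM w.swap) w.swap he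
  have h2 : HasFDerivAt (fun w : E q × E p => G w.swap)
      ((fderiv ℝ G (w.1.1, w.2.1)) ∘L
        (ContinuousLinearMap.snd ℝ (E q) (E p)).prod (ContinuousLinearMap.fst ℝ (E q) (E p)))
      (w.2.1, w.1.1) :=
    HasFDerivAt.comp (w.2.1, w.1.1)
      (((contDiff_of_mem_bihom hG).differentiable (by simp) (w.1.1, w.2.1)).hasFDerivAt)
      ((ContinuousLinearMap.snd ℝ (E q) (E p)).prod
        (ContinuousLinearMap.fst ℝ (E q) (E p))).hasFDerivAt
  have h3 : fderiv ℝ (fun w : E q × E p => G w.swap) (w.swap.1.1, w.swap.2.1) (e, 0) =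
      fderiv ℝ G (w.1.1, w.2.1) (0, e) := by
    change fderiv ℝ (fun w : E q × E p => G w.swap) (w.2.1, w.1.1) (e, 0) = _
    rw [h2.fderiv]
    rfl
  rwa [h3] at h1

/-- The derivatives of a bihomogeneous polynomial on the product of the spheres are bounded by its
maximum, with polynomial constants. -/
lemma norm_iteratedFDeriv_le_of_mem_bihom (k : ℕ) : ∀ {m n : ℕ} {G : E p × E q → ℂ},
    G ∈ bihom p q m n → ∀ {M : ℝ}, (∀ w : Om p q, ‖G (w.1.1, w.2.1)‖ ≤ M) → ∀ w : Om p q,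
      ‖iteratedFDeriv ℝ k G (w.1.1, w.2.1)‖ ≤ (4 * (p + q) * (m + n + 1) ^ 2) ^ k * M := by
  induction k with
  | zero =>
    intro m n G hG M hM w
    simpa using hM w
  | succ k ih =>
    intro m n G hG M hM w
    have hM0 : 0 ≤ M := (norm_nonneg _).trans (hM w)
    obtain ⟨D, D', hD, hD', hfd⟩ := exists_fderiv_of_mem_bihom hG
    have hDM : ∀ i (w : Om p q), ‖D i (w.1.1, w.2.1)‖ ≤ 4 * (m + n + 1) ^ 2 * M := by
      intro i w
      have h1 := norm_fderiv_left_le hG hM w (e := EuclideanSpace.single i 1) (by simp)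
      rw [hfd] at h1
      have h2 : (∑ i', ((EuclideanSpace.single i (1 : ℝ) i' : ℝ) : ℂ) * D i' (w.1.1, w.2.1) +
          ∑ j, (((0 : E q) j : ℝ) : ℂ) * D' j (w.1.1, w.2.1)) = D i (w.1.1, w.2.1) := by
        rw [Finset.sum_eq_single i]
        · simp
        · intro j _ hj; simp [hj]
        · simp
      rw [h2] at h1
      refine h1.trans ?_
      gcongr
      linarith [Nat.cast_nonneg (α := ℝ) n]
    have hDM' : ∀ i (w : Om p q), ‖D' i (w.1.1, w.2.1)‖ ≤ 4 * (m + n + 1) ^ 2 * M := by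
      intro i w
      have h1 := norm_fderiv_right_le hG hM w (e := EuclideanSpace.single i 1) (by simp)
      rw [hfd] at h1
      have h2 : (∑ j, (((0 : E p) j : ℝ) : ℂ) * D j (w.1.1, w.2.1) +
          ∑ i', ((EuclideanSpace.single i (1 : ℝ) i' : ℝ) : ℂ) * D' i' (w.1.1, w.2.1)) =
          D' i (w.1.1, w.2.1) := by
        rw [Finset.sum_eq_single (s := Finset.univ) (a := i)
          (f := fun i' => ((EuclideanSpace.single i (1 : ℝ) i' : ℝ) : ℂ) * D' i' (w.1.1, w.2.1))]
        · simp
        · intro j _ hj; simp [hj]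
        · simp
      rw [h2] at h1
      refine h1.trans ?_
      gcongr
      linarith [Nat.cast_nonneg (α := ℝ) m]
    let L : Fin p → E p × E q →L[ℝ] ℂ := fun i =>
      Complex.ofRealCLM ∘L (EuclideanSpace.proj i : E p →L[ℝ] ℝ) ∘L
        ContinuousLinearMap.fst ℝ (E p) (E q)
    let L' : Fin q → E p × E q →L[ℝ] ℂ := fun i =>
      Complex.ofRealCLM ∘L (EuclideanSpace.proj i : E q →L[ℝ] ℝ) ∘L
        ContinuousLinearMap.snd ℝ (E p) (E q)
    have hL : ∀ i, ‖L i‖ ≤ 1 := by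
      intro i
      refine ContinuousLinearMap.opNorm_le_bound _ zero_le_one fun v => ?_
      have h1 : ‖L i v‖ = ‖v.1 i‖ := by simp [L]
      rw [h1, one_mul]
      exact (PiLp.norm_apply_le v.1 i).trans (norm_fst_le v)
    have hL' : ∀ i, ‖L' i‖ ≤ 1 := by
      intro i
      refine ContinuousLinearMap.opNorm_le_bound _ zero_le_one fun v => ?_
      have h1 : ‖L' i v‖ = ‖v.2 i‖ := by simp [L']
      rw [h1, one_mul]
      exact (PiLp.norm_apply_le v.2 i).trans (norm_snd_le v)
    let B : (E p × E q →L[ℝ] ℂ) → ℂ →L[ℝ] (E p × E q →L[ℝ] ℂ) := fun l =>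
      (ContinuousLinearMap.lsmul ℝ ℂ).flip l
    have hB : ∀ l, ‖l‖ ≤ 1 → ‖B l‖ ≤ 1 := by
      intro l hl
      refine ContinuousLinearMap.opNorm_le_bound _ zero_le_one fun c => ?_
      change ‖c • l‖ ≤ _
      rw [norm_smul, one_mul]
      exact mul_le_of_le_one_right (norm_nonneg _) hl
    -- The derivative is a sum of p + q terms, each a linear map of norm at most 1 applied to a
    -- bihomogeneous function bounded by N on the spheres. The induction hypothesis applies to each
    -- term.
    have hfd' : fderiv ℝ G = fun w => ∑ i, (B (L i) ∘ D i) w + ∑ j, (B (L' j) ∘ D' j) w := by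
      funext w
      refine ContinuousLinearMap.ext fun v => ?_
      rw [hfd]
      simp [B, L, L', mul_comm]
    have hcD : ∀ i, ContDiff ℝ ∞ (B (L i) ∘ D i) := fun i =>
      (B (L i)).contDiff.comp (contDiff_of_mem_bihom (hD i))
    have hcD' : ∀ i, ContDiff ℝ ∞ (B (L' i) ∘ D' i) := fun i =>
      (B (L' i)).contDiff.comp (contDiff_of_mem_bihom (hD' i))
    set A : ℝ := 4 * (p + q) * (m + n + 1) ^ 2 with hA
    set N : ℝ := 4 * (m + n + 1) ^ 2 * M with hN
    have hA0 : 0 ≤ A := by positivity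
    have hN0 : 0 ≤ N := by positivity
    have key : ∀ {l : E p × E q →L[ℝ] ℂ} {F : E p × E q → ℂ} {m' n' : ℕ}, ‖l‖ ≤ 1 →
        F ∈ bihom p q m' n' → m' ≤ m → n' ≤ n → (∀ w : Om p q, ‖F (w.1.1, w.2.1)‖ ≤ N) →
        ‖iteratedFDeriv ℝ k (B l ∘ F) (w.1.1, w.2.1)‖ ≤ A ^ k * N := by
      intro l F m' n' hl hF hm hn hFN
      have hk : ((k : ℕ∞) : WithTop ℕ∞) ≤ ∞ := by exact_mod_cast le_top
      refine ((B l).norm_iteratedFDeriv_comp_left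
        (contDiff_of_mem_bihom hF).contDiffAt hk).trans ?_
      have h1 := ih hF hFN w
      calc _ ≤ 1 * ((4 * (p + q) * (m' + n' + 1) ^ 2) ^ k * N) := by
            gcongr
            exact hB l hl
        _ ≤ A ^ k * N := by
            rw [one_mul, hA]
            gcongr
    have hk : ((k : ℕ∞) : WithTop ℕ∞) ≤ ∞ := by exact_mod_cast le_top
    rw [← norm_iteratedFDeriv_fderiv, hfd']
    have hs1 : ContDiffAt ℝ k (fun w => ∑ i, (B (L i) ∘ D i) w) (w.1.1, w.2.1) :=
      (ContDiff.sum fun i _ => (hcD i).of_le hk).contDiffAt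
    have hs2 : ContDiffAt ℝ k (fun w => ∑ i, (B (L' i) ∘ D' i) w) (w.1.1, w.2.1) :=
      (ContDiff.sum fun i _ => (hcD' i).of_le hk).contDiffAt
    have h4 := iteratedFDeriv_add_apply hs1 hs2
    refine (congrArg norm h4).trans_le ?_
    rw [iteratedFDeriv_fun_sum_apply fun i _ => ((hcD i).of_le hk).contDiffAt,
      iteratedFDeriv_fun_sum_apply fun i _ => ((hcD' i).of_le hk).contDiffAt]
    refine (norm_add_le _ _).trans ((add_le_add (norm_sum_le _ _) (norm_sum_le _ _)).trans ?_)
    have h5 : ∑ i : Fin p, ‖iteratedFDeriv ℝ k (B (L i) ∘ D i) (w.1.1, w.2.1)‖ ≤ p * (A ^ k * N) := by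
      refine (Finset.sum_le_sum fun i _ => key (hL i) (hD i) (Nat.sub_le _ _) le_rfl (hDM i)).trans ?_
      simp
    have h6 : ∑ i : Fin q, ‖iteratedFDeriv ℝ k (B (L' i) ∘ D' i) (w.1.1, w.2.1)‖ ≤
        q * (A ^ k * N) := by
      refine (Finset.sum_le_sum fun i _ => key (hL' i) (hD' i) le_rfl (Nat.sub_le _ _) (hDM' i)).trans ?_
      simp
    refine (add_le_add h5 h6).trans (le_of_eq ?_)
    rw [hN, pow_succ, hA]
    ring

end LightCone

/-! ### Rapid decay of the components of a Schwartz function -/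

namespace LightCone

open MvPolynomial MeasureTheory
open scoped FourierTransform SchwartzMap

variable {p q : ℕ}

lemma inner_eq_zero_of_mem_biharmLE (hp : 1 ≤ p) (hq : 1 ≤ q) {m n k : ℕ} (hk : k < m + n)
    {G : C(Om p q, ℂ)} (hG : G ∈ biharm p q m n) {F : C(Om p q, ℂ)} (hF : F ∈ biharmLE p q k) :
    inner ℂ (toL2 p q G) (toL2 p q F) = 0 := by
  rw [biharmLE] at hF
  induction hF using Submodule.iSup_induction' with
  | mem i F hF =>
    refine inner_eq_zero_of_ne hp hq (i := i.1) (j := (m, n)) ?_ hF hG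
    intro h
    have := i.2
    rw [h] at this
    simp at this
    omega
  | zero => rw [map_zero, inner_zero_right]
  | add F F' _ _ h h' => rw [map_add, inner_add_right, h, h', add_zero]

/-- The space `ℝ^p ⊕ ℝ^q` with its Euclidean norm. -/
abbrev EE (p q : ℕ) : Type := WithLp 2 (E p × E q)

/-- The inclusion of the product of the spheres into `ℝ^p ⊕ ℝ^q`. -/
def omVec (w : Om p q) : EE p q := WithLp.toLp 2 (w.1.1, w.2.1)

lemma continuous_omVec : Continuous (omVec : Om p q → EE p q) := by
  unfold omVec
  fun_prop

lemma norm_omVec_le (w : Om p q) : ‖omVec w‖ ≤ 2 := by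
  have h : ‖omVec w‖ ^ 2 = 2 := by
    rw [WithLp.prod_norm_sq_eq_of_L2]
    simp [omVec]
    norm_num
  nlinarith [norm_nonneg (omVec w)]

/-- The restriction of a plane wave to the product of the spheres. -/
noncomputable def planeWave (ξ : EE p q) : C(Om p q, ℂ) where
  toFun w := Complex.exp ((2 * Real.pi * inner ℝ ξ (omVec w) : ℝ) * Complex.I)
  continuous_toFun := by
    have := continuous_omVec (p := p) (q := q)
    fun_prop

lemma planeWave_apply (ξ : EE p q) (w : Om p q) :
    planeWave ξ w = Complex.exp ((2 * Real.pi * inner ℝ ξ (omVec w) : ℝ) * Complex.I) := rfl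

/-- The exponent of a plane wave as a polynomial. -/
noncomputable def phasePoly (ξ : EE p q) : MvPolynomial (Fin p ⊕ Fin q) ℂ :=
  ∑ i, C (2 * Real.pi * ξ.fst i * Complex.I) * X (Sum.inl i) +
    ∑ j, C (2 * Real.pi * ξ.snd j * Complex.I) * X (Sum.inr j)

lemma omRes_phasePoly (ξ : EE p q) (w : Om p q) :
    omRes p q (phasePoly ξ) w = (2 * Real.pi * inner ℝ ξ (omVec w) : ℝ) * Complex.I := by
  rw [omRes_apply, WithLp.prod_inner_apply, PiLp.inner_apply, PiLp.inner_apply]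
  simp only [phasePoly, map_add, map_sum, map_mul, eval_C, eval_X, Sum.elim_inl, Sum.elim_inr,
    omVec]
  simp only [RCLike.inner_apply, conj_trivial]
  push_cast
  rw [mul_add, add_mul, Finset.mul_sum, Finset.mul_sum, Finset.sum_mul, Finset.sum_mul]
  congr 1 <;> refine Finset.sum_congr rfl fun i _ => ?_ <;> simp <;> ring

lemma totalDegree_phasePoly (ξ : EE p q) : (phasePoly ξ).totalDegree ≤ 1 := by
  have h : ∀ (c : ℂ) (i : Fin p ⊕ Fin q), (C c * X i : MvPolynomial _ ℂ).totalDegree ≤ 1 :=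
    fun c i => (isHomogeneous_C_mul_X c i).totalDegree_le
  refine (totalDegree_add _ _).trans (max_le ?_ ?_)
  · exact totalDegree_finsetSum_le fun i _ => h _ _
  · exact totalDegree_finsetSum_le fun i _ => h _ _

/-- The exponential series gives (M + 1)^M / M! ≤ e^(M + 1) ≤ 3^(M + 1), and 3/8 ≤ 1/2. -/
lemma pow_div_factorial_le_half_pow (M : ℕ) :
    (((M : ℝ) + 1) / 8) ^ M / M.factorial ≤ 3 * (1 / 2) ^ M := by
  have h1 := Real.pow_div_factorial_le_exp ((M : ℝ) + 1) (by positivity) M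
  have h2 : Real.exp ((M : ℝ) + 1) ≤ 3 ^ (M + 1) := by
    have : (M : ℝ) + 1 = ((M + 1 : ℕ) : ℝ) * 1 := by push_cast; ring
    rw [this, Real.exp_nat_mul]
    gcongr
    linarith [Real.exp_one_lt_d9]
  calc (((M : ℝ) + 1) / 8) ^ M / M.factorial
      = ((M : ℝ) + 1) ^ M / M.factorial * (1 / 8) ^ M := by
        rw [div_pow, one_div_pow]; ring
    _ ≤ 3 ^ (M + 1) * (1 / 8) ^ M := by gcongr; exact h1.trans h2
    _ = 3 * (3 / 8) ^ M := by rw [pow_succ, div_pow, div_pow, one_pow]; ring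
    _ ≤ 3 * (1 / 2) ^ M :=
        mul_le_mul_of_nonneg_left (pow_le_pow_left₀ (by norm_num) (by norm_num) M) (by norm_num)

lemma exists_half_pow_le (N : ℕ) : ∃ C : ℝ, 0 ≤ C ∧
    ∀ M : ℕ, ((M : ℝ) + 1) ^ N * (1 / 2) ^ M ≤ C := by
  have h := (tendsto_pow_const_div_const_pow_of_one_lt N (r := (2 : ℝ)) (by norm_num)).comp
    (Filter.tendsto_add_atTop_nat 1)
  obtain ⟨C, hC⟩ := h.bddAbove_range
  refine ⟨2 * max C 0, by positivity, fun M => ?_⟩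
  have h1 := hC ⟨M, rfl⟩
  simp only [Function.comp_apply, Nat.cast_add, Nat.cast_one] at h1
  calc ((M : ℝ) + 1) ^ N * (1 / 2) ^ M = 2 * (((M : ℝ) + 1) ^ N / 2 ^ (M + 1)) := by
        rw [pow_succ, one_div_pow]; field_simp
    _ ≤ 2 * max C 0 := by gcongr; exact h1.trans (le_max_left _ _)

/-- Plane waves have rapidly decreasing components in the degree. -/
lemma exists_norm_inner_planeWave_le (hp : 1 ≤ p) (hq : 1 ≤ q) (N : ℕ) : ∃ C : ℝ, 0 ≤ C ∧
    ∀ (m n : ℕ), ∀ G ∈ biharm p q m n, ∀ ξ : EE p q,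
      ‖inner ℂ (toL2 p q G) (toL2 p q (planeWave ξ))‖ * ((m : ℝ) + n + 1) ^ N ≤
        C * (1 + ‖ξ‖ ^ N) * ‖toL2 p q G‖ := by
  obtain ⟨c, hc, hcM⟩ := exists_half_pow_le N
  set κ := ‖toL2 p q‖ with hκ
  have hκ0 : 0 ≤ κ := ContinuousLinearMap.opNorm_nonneg _
  refine ⟨κ * (6 * c + 128 ^ N), by positivity, fun m n G hG ξ => ?_⟩
  set M := m + n with hM
  have hMc : (m : ℝ) + n + 1 = (M : ℝ) + 1 := by rw [hM]; push_cast; ring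
  rw [hMc]
  -- For large frequencies the trivial bound suffices, as the power of M + 1 is absorbed by ‖ξ‖^N.
  by_cases hξ : (M : ℝ) + 1 ≤ 128 * ‖ξ‖
  · have h1 : ‖inner ℂ (toL2 p q G) (toL2 p q (planeWave ξ))‖ ≤ ‖toL2 p q G‖ * (κ * 1) := by
      refine (norm_inner_le_norm _ _).trans ?_
      gcongr
      refine ((toL2 p q).le_opNorm _).trans ?_
      gcongr
      rw [ContinuousMap.norm_le _ zero_le_one]
      intro w
      rw [planeWave_apply, Complex.norm_exp_ofReal_mul_I]
    calc _ ≤ ‖toL2 p q G‖ * (κ * 1) * (128 * ‖ξ‖) ^ N := by gcongr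
      _ = κ * (0 + 128 ^ N) * (0 + ‖ξ‖ ^ N) * ‖toL2 p q G‖ := by rw [mul_pow]; ring
      _ ≤ _ := by gcongr <;> positivity
  · push Not at hξ
    -- The Taylor polynomial of the plane wave, of degree less than M and therefore orthogonal to G.
    -- For M = 0 it is the empty sum.
    set T : C(Om p q, ℂ) := omRes p q (∑ k ∈ Finset.range M, C ((k.factorial : ℂ)⁻¹) *
      phasePoly ξ ^ k) with hT
    have hTG : inner ℂ (toL2 p q G) (toL2 p q T) = 0 := by
      rcases Nat.eq_zero_or_pos M with h0 | hpos
      · rw [hT, h0]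
        simp
      · refine inner_eq_zero_of_mem_biharmLE hp hq (k := M - 1) (by omega) hG
          (omRes_mem_biharmLE hp hq (totalDegree_finsetSum_le fun k hk => ?_))
        have hk' := Finset.mem_range.1 hk
        refine (totalDegree_mul _ _).trans ?_
        rw [totalDegree_C, zero_add]
        refine (totalDegree_pow _ _).trans ?_
        have := totalDegree_phasePoly ξ
        exact (Nat.mul_le_mul_left k this).trans (by omega)
    have hTn : ‖planeWave ξ - T‖ ≤ 6 * (1 / 2) ^ M := by
      rw [ContinuousMap.norm_le _ (by positivity)]
      intro w
      set z : ℂ := (2 * Real.pi * inner ℝ ξ (omVec w) : ℝ) * Complex.I with hz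
      have hTw : T w = ∑ k ∈ Finset.range M, z ^ k / k.factorial := by
        rw [hT, map_sum, ContinuousMap.sum_apply]
        refine Finset.sum_congr rfl fun k _ => ?_
        rw [map_mul, map_pow, ContinuousMap.mul_apply, ContinuousMap.pow_apply, omRes_phasePoly,
          omRes_apply, eval_C, ← hz]
        field_simp
      -- From 2π ≤ 8 and `norm_omVec_le`. With ‖ξ‖ < (M + 1)/128 this becomes ‖z‖ ≤ (M + 1)/8, as
      -- required for the remainder.
      have hzn : ‖z‖ ≤ 16 * ‖ξ‖ := by
        rw [hz, norm_mul, Complex.norm_I, mul_one, Complex.norm_real, norm_mul, Real.norm_eq_abs,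
          abs_of_pos Real.two_pi_pos]
        have h1 : ‖inner ℝ ξ (omVec w)‖ ≤ ‖ξ‖ * 2 :=
          (norm_inner_le_norm _ _).trans (by gcongr; exact norm_omVec_le w)
        have h2 : 2 * Real.pi ≤ 8 := by linarith [Real.pi_le_four]
        calc _ ≤ 8 * (‖ξ‖ * 2) := by gcongr
          _ = _ := by ring
      have hz8 : ‖z‖ ≤ ((M : ℝ) + 1) / 8 := by linarith
      rw [ContinuousMap.sub_apply, planeWave_apply, hTw]
      have hMp : (0 : ℝ) < (M : ℝ) + 1 := by positivity
      have h2 := Complex.exp_bound' (x := z) (n := M) (by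
        rw [Nat.cast_succ, div_le_iff₀ hMp]
        linarith)
      refine h2.trans ?_
      calc ‖z‖ ^ M / M.factorial * 2 ≤ (((M : ℝ) + 1) / 8) ^ M / M.factorial * 2 := by gcongr
        _ ≤ 3 * (1 / 2) ^ M * 2 := by gcongr; exact pow_div_factorial_le_half_pow M
        _ = _ := by ring
    have h1 : ‖inner ℂ (toL2 p q G) (toL2 p q (planeWave ξ))‖ ≤
        ‖toL2 p q G‖ * (κ * (6 * (1 / 2) ^ M)) := by
      have : inner ℂ (toL2 p q G) (toL2 p q (planeWave ξ)) =
          inner ℂ (toL2 p q G) (toL2 p q (planeWave ξ - T)) := by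
        rw [map_sub, inner_sub_right, hTG, sub_zero]
      rw [this]
      refine (norm_inner_le_norm _ _).trans ?_
      gcongr
      refine ((toL2 p q).le_opNorm _).trans ?_
      gcongr
    calc _ ≤ ‖toL2 p q G‖ * (κ * (6 * (1 / 2) ^ M)) * ((M : ℝ) + 1) ^ N := by gcongr
      _ = κ * (6 * (((M : ℝ) + 1) ^ N * (1 / 2) ^ M)) * ‖toL2 p q G‖ := by ring
      _ ≤ κ * (6 * c) * ‖toL2 p q G‖ := by gcongr; exact hcM M
      _ = κ * (6 * c + 0) * (1 + 0) * ‖toL2 p q G‖ := by ring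
      _ ≤ _ := by gcongr <;> positivity

/-- The restriction of a Schwartz function to the product of the spheres. -/
noncomputable def schwartzRes (f : 𝓢(EE p q, ℂ)) : C(Om p q, ℂ) :=
  ⟨fun w => f (omVec w), f.continuous.comp continuous_omVec⟩

/-- Fourier inversion on ℝ^p ⊕ ℝ^q, restricted to the spheres. Fubini applies since plane waves have
modulus 1 and the Fourier transform is integrable. -/
lemma inner_schwartzRes (f : 𝓢(EE p q, ℂ)) (G : C(Om p q, ℂ)) :
    inner ℂ (toL2 p q G) (toL2 p q (schwartzRes f)) =
      ∫ ξ, (𝓕 f) ξ * inner ℂ (toL2 p q G) (toL2 p q (planeWave ξ)) := by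
  have hinv : ∀ w, f (omVec w) = ∫ ξ, planeWave ξ w * (𝓕 f) ξ := by
    intro w
    have h1 : 𝓕⁻ (𝓕 f) = f := FourierTransform.fourierInv_fourier_eq f
    conv_lhs => rw [← h1, SchwartzMap.fourierInv_coe, Real.fourierInv_eq']
    rfl
  have hcont : Continuous fun x : Om p q × EE p q =>
      planeWave x.2 x.1 * (𝓕 f) x.2 * star (G x.1) := by
    have h1 : Continuous fun x : Om p q × EE p q => planeWave x.2 x.1 := by
      simp only [planeWave_apply]
      have := continuous_omVec (p := p) (q := q)
      fun_prop
    have h2 : Continuous fun x : Om p q × EE p q => (𝓕 f) x.2 :=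
      (𝓕 f).continuous.comp continuous_snd
    exact (h1.mul h2).mul (G.continuous.comp continuous_fst).star
  have hint : Integrable (fun x : Om p q × EE p q =>
      planeWave x.2 x.1 * (𝓕 f) x.2 * star (G x.1)) ((omMeas p q).prod volume) := by
    have hG : Integrable (fun w => ‖G w‖) (omMeas p q) :=
      G.continuous.norm.integrable_of_hasCompactSupport (HasCompactSupport.of_compactSpace _)
    refine (hG.mul_prod (𝓕 f).integrable.norm).mono' hcont.aestronglyMeasurable
      (Filter.Eventually.of_forall fun x => ?_)
    rw [norm_mul, norm_mul, planeWave_apply, Complex.norm_exp_ofReal_mul_I, one_mul, norm_star,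
      mul_comm]
  rw [inner_toL2]
  have h1 : ∀ w, schwartzRes f w * star (G w) =
      ∫ ξ, planeWave ξ w * (𝓕 f) ξ * star (G w) := by
    intro w
    rw [integral_mul_const, ← hinv]
    rfl
  simp only [h1]
  rw [integral_integral_swap hint]
  congr 1
  ext ξ
  rw [inner_toL2, ← integral_const_mul]
  congr 1
  ext w
  ring

/-- The restriction of a Schwartz function has rapidly decreasing components. -/
lemma exists_norm_biharmProj_schwartzRes_le (hp : 1 ≤ p) (hq : 1 ≤ q) (f : 𝓢(EE p q, ℂ)) (N : ℕ) :
    ∃ C : ℝ, 0 ≤ C ∧ ∀ m n : ℕ,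
      ‖toL2 p q (biharmProj p q m n (schwartzRes f)).1‖ * ((m : ℝ) + n + 1) ^ N ≤ C := by
  obtain ⟨c, hc, hcG⟩ := exists_norm_inner_planeWave_le hp hq N
  have hi : Integrable (fun ξ => c * ((1 + ‖ξ‖ ^ N) * ‖(𝓕 f) ξ‖)) := by
    have h1 := (𝓕 f).integrable_pow_mul volume N
    have h2 := (𝓕 f).integrable.norm (μ := volume)
    refine Integrable.const_mul ?_ c
    refine (h2.add h1).congr (Filter.Eventually.of_forall fun ξ => ?_)
    simp only [Pi.add_apply]
    ring
  refine ⟨∫ ξ, c * ((1 + ‖ξ‖ ^ N) * ‖(𝓕 f) ξ‖), integral_nonneg fun ξ => by positivity,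
    fun m n => ?_⟩
  set G := (biharmProj p q m n (schwartzRes f)).1 with hG
  have hGm : G ∈ biharm p q m n := (biharmProj p q m n (schwartzRes f)).2
  set A : ℝ := ((m : ℝ) + n + 1) ^ N with hA
  have hA0 : 0 < A := by positivity
  have h1 : ‖inner ℂ (toL2 p q G) (toL2 p q (schwartzRes f))‖ * A ≤
      (∫ ξ, c * ((1 + ‖ξ‖ ^ N) * ‖(𝓕 f) ξ‖)) * ‖toL2 p q G‖ := by
    rw [inner_schwartzRes, ← le_div_iff₀ hA0]
    have h2 : (∫ ξ, c * ((1 + ‖ξ‖ ^ N) * ‖(𝓕 f) ξ‖)) * ‖toL2 p q G‖ / A =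
        ∫ ξ, c * ((1 + ‖ξ‖ ^ N) * ‖(𝓕 f) ξ‖) * (‖toL2 p q G‖ / A) := by
      rw [integral_mul_const, mul_div_assoc]
    rw [h2]
    refine norm_integral_le_of_norm_le (hi.mul_const _) (Filter.Eventually.of_forall fun ξ => ?_)
    rw [norm_mul, mul_div_assoc', le_div_iff₀ hA0]
    calc _ = ‖(𝓕 f) ξ‖ * (‖inner ℂ (toL2 p q G) (toL2 p q (planeWave ξ))‖ * A) := by ring
      _ ≤ ‖(𝓕 f) ξ‖ * (c * (1 + ‖ξ‖ ^ N) * ‖toL2 p q G‖) :=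
          mul_le_mul_of_nonneg_left (hcG m n G hGm ξ) (norm_nonneg _)
      _ = _ := by ring
  -- Testing against the component itself gives the square of its norm, and one factor cancels at
  -- the end.
  have h2 : ‖inner ℂ (toL2 p q G) (toL2 p q (schwartzRes f))‖ = ‖toL2 p q G‖ ^ 2 := by
    rw [← inner_biharmProj hGm, ← hG, inner_self_eq_norm_sq_to_K, norm_pow]
    simp
  rw [h2] at h1
  by_cases h0 : ‖toL2 p q G‖ = 0
  · rw [h0, zero_mul]
    exact integral_nonneg fun ξ => by positivity
  · have h0' : 0 < ‖toL2 p q G‖ := lt_of_le_of_ne (norm_nonneg _) (Ne.symm h0)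
    refine le_of_mul_le_mul_right ?_ h0'
    calc _ = ‖toL2 p q G‖ ^ 2 * A := by ring
      _ ≤ _ := h1

end LightCone

/-! ### The topology of S^a and the restriction to the spheres -/

namespace LightCone

variable {p q : ℕ}

/-- The extension of a function on the cone by zero. -/
noncomputable def extendZero (f : X0 p q → ℂ) (w : E p × E q) : ℂ :=
  open Classical in if h : w ∈ X0 p q then f ⟨w, h⟩ else 0

lemma extendZero_coe (f : X0 p q → ℂ) (w : X0 p q) : extendZero f w.1 = f w :=
  dif_pos w.2

/-- Extension by zero gives sense to the composition with a map that takes values in the cone only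
near u; there it agrees with a smooth local extension of f. -/
lemma IsSmooth.contDiffAt_comp {f : X0 p q → ℂ} (hf : IsSmooth f) {W : Type*}
    [NormedAddCommGroup W] [NormedSpace ℝ W] {N : W → E p × E q} {u : W}
    (hN : ContDiffAt ℝ ∞ N u) (hmem : ∀ᶠ v in 𝓝 u, N v ∈ X0 p q) :
    ContDiffAt ℝ ∞ (fun v => extendZero f (N v)) u := by
  obtain ⟨U, F, hU, huU, hF, hFf⟩ := hf ⟨N u, hmem.self_of_nhds⟩
  have h1 : ContDiffAt ℝ ∞ (fun v => F (N v)) u :=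
    (hF.contDiffAt (hU.mem_nhds huU)).comp u hN
  refine h1.congr_of_eventuallyEq ?_
  filter_upwards [hmem, hN.continuousAt.eventually (hU.mem_nhds huU)] with v hv hvU
  exact (extendZero_coe f ⟨N v, hv⟩).trans (hFf ⟨N v, hv⟩ hvU).symm

lemma IsSmooth.contDiff_comp {f : X0 p q → ℂ} (hf : IsSmooth f) {W : Type*}
    [NormedAddCommGroup W] [NormedSpace ℝ W] {φ : W → X0 p q}
    (hφ : ContDiff ℝ ∞ fun u => (φ u).1) : ContDiff ℝ ∞ (f ∘ φ) := by
  rw [contDiff_iff_contDiffAt]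
  intro u
  refine (hf.contDiffAt_comp hφ.contDiffAt
    (Filter.Eventually.of_forall fun v => (φ v).2)).congr_of_eventuallyEq
      (Filter.Eventually.of_forall fun v => ?_)
  exact (extendZero_coe f (φ v)).symm

lemma IsSmooth.continuous {f : X0 p q → ℂ} (hf : IsSmooth f) : Continuous f := by
  rw [continuous_iff_continuousAt]
  intro w
  obtain ⟨U, F, hU, hwU, hF, hFf⟩ := hf w
  have h1 : ContinuousAt (fun z : X0 p q => F z.1) w :=
    (hF.continuousOn.continuousAt (hU.mem_nhds hwU)).comp continuousAt_subtype_val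
  refine h1.congr ?_
  filter_upwards [continuousAt_subtype_val.eventually (hU.mem_nhds hwU)] with z hz
  exact hFf z hz

lemma Smooth.isSmooth (f : Smooth p q) : IsSmooth f.fn := f.2

lemma Smooth.fn_add (f g : Smooth p q) : (f + g).fn = f.fn + g.fn := rfl

lemma Smooth.fn_smul (c : ℂ) (f : Smooth p q) : (c • f).fn = c • f.fn := rfl

lemma Smooth.fn_sum {ι : Type*} (s : Finset ι) (f : ι → Smooth p q) :
    (∑ i ∈ s, f i).fn = ∑ i ∈ s, (f i).fn := by
  have := map_sum (smoothSubmodule p q).subtype f s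
  exact this

/-- The derivatives of order `k` along a smooth parametrization. -/
noncomputable def derivAlong {d : ℕ} {φ : E d → X0 p q} (hφ : ContDiff ℝ ∞ fun u => (φ u).1)
    (k : ℕ) : Smooth p q →ₗ[ℂ] E d → (E d [×k]→L[ℝ] ℂ) where
  toFun f := iteratedFDeriv ℝ k (f.fn ∘ φ)
  map_add' f g := by
    ext1 u
    rw [Smooth.fn_add, Pi.add_apply]
    exact iteratedFDeriv_add_apply
      ((f.isSmooth.contDiff_comp hφ).of_le (by exact_mod_cast le_top)).contDiffAt
      ((g.isSmooth.contDiff_comp hφ).of_le (by exact_mod_cast le_top)).contDiffAt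
  map_smul' c f := by
    ext1 u
    rw [Smooth.fn_smul, Pi.smul_apply]
    exact iteratedFDeriv_const_smul_apply
      ((f.isSmooth.contDiff_comp hφ).of_le (by exact_mod_cast le_top)).contDiffAt

/-- A vector space topology is needed so that linear maps from the finite-dimensional components
into S^a are continuous. -/
instance : IsTopologicalAddGroup (Smooth p q) := by
  refine topologicalAddGroup_iInf fun d => topologicalAddGroup_iInf fun φ =>
    topologicalAddGroup_iInf fun hφ => topologicalAddGroup_iInf fun k => ?_
  let L : Smooth p q →+ (E d →ᵤ[{C : Set (E d) | IsCompact C}] (E d [×k]→L[ℝ] ℂ)) :=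
    { toFun := fun f => UniformOnFun.ofFun _ (derivAlong hφ k f)
      map_zero' := by rw [map_zero]; rfl
      map_add' := fun f g => by rw [map_add]; rfl }
  exact topologicalAddGroup_induced L

lemma continuousSMul_induced_uniformOnFun {A F V : Type*} [AddCommGroup V] [Module ℂ V]
    [NormedAddCommGroup F] [NormedSpace ℂ F] (𝔖 : Set (Set A)) (L : V →ₗ[ℂ] A → F)
    (hL : ∀ v, ∀ s ∈ 𝔖, Bornology.IsVonNBounded ℂ (L v '' s)) :
    @ContinuousSMul ℂ V _ _ (TopologicalSpace.induced (fun v => UniformOnFun.ofFun 𝔖 (L v))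
      inferInstance) := by
  let _ : TopologicalSpace V :=
    TopologicalSpace.induced (fun v => UniformOnFun.ofFun 𝔖 (L v)) inferInstance
  exact UniformOnFun.continuousSMul_induced_of_image_bounded _ _ _ _ L ⟨rfl⟩ hL

/-- Uniform convergence on compact sets is compatible with scalars only for functions bounded there;
the derivatives are bounded on compact sets because they are continuous. -/
instance : ContinuousSMul ℂ (Smooth p q) := by
  refine continuousSMul_iInf fun d => continuousSMul_iInf fun φ =>
    continuousSMul_iInf fun hφ => continuousSMul_iInf fun k => ?_
  refine continuousSMul_induced_uniformOnFun _ (derivAlong hφ k) fun f C hC => ?_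
  have h1 : Continuous (derivAlong hφ k f) :=
    (f.isSmooth.contDiff_comp hφ).continuous_iteratedFDeriv (by exact_mod_cast le_top)
  exact (IsCompact.image hC h1).isVonNBounded ℂ

lemma tendsto_smooth_iff {ι : Type*} {l : Filter ι} {F : ι → Smooth p q} {f : Smooth p q} :
    Filter.Tendsto F l (𝓝 f) ↔ ∀ (d : ℕ) (φ : E d → X0 p q),
      ContDiff ℝ ∞ (fun u => (φ u).1) → ∀ (k : ℕ) (C : Set (E d)), IsCompact C →
        TendstoUniformlyOn (fun i => iteratedFDeriv ℝ k ((F i).fn ∘ φ))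
          (iteratedFDeriv ℝ k (f.fn ∘ φ)) l C := by
  have h : 𝓝 f = ⨅ (d : ℕ) (φ : E d → X0 p q) (_ : ContDiff ℝ ∞ (fun u => (φ u).1)) (k : ℕ),
      Filter.comap (fun f : Smooth p q =>
        UniformOnFun.ofFun {C : Set (E d) | IsCompact C} (iteratedFDeriv ℝ k (f.fn ∘ φ)))
        (𝓝 (UniformOnFun.ofFun {C : Set (E d) | IsCompact C}
          (iteratedFDeriv ℝ k (f.fn ∘ φ)))) := by
    simp only [nhds_iInf, nhds_induced]
  rw [h]
  simp only [Filter.tendsto_iInf, Filter.tendsto_comap_iff,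
    UniformOnFun.tendsto_iff_tendstoUniformlyOn]
  rfl

/-- The product of the unit spheres as a subset of the cone. -/
def omPt (w : Om p q) : X0 p q :=
  ⟨(w.1.1, w.2.1), by
    have h1 : ‖w.1.1‖ = 1 := by simp
    have h2 : ‖w.2.1‖ = 1 := by simp
    refine ⟨fun h => ?_, by rw [h1, h2]⟩
    have h3 : w.1.1 = 0 := congrArg Prod.fst h
    rw [h3, norm_zero] at h1
    exact zero_ne_one h1⟩

lemma continuous_omPt : Continuous (omPt : Om p q → X0 p q) := by
  unfold omPt
  fun_prop

lemma norm_snd_eq (w : X0 p q) : ‖w.1.2‖ = ‖w.1.1‖ :=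
  ((sq_eq_sq₀ (norm_nonneg _) (norm_nonneg _)).1 w.2.2).symm

lemma norm_fst_pos (w : X0 p q) : 0 < ‖w.1.1‖ := norm_pos_iff.2 (fst_ne_zero w.2)

/-- The point of the product of the unit spheres on the ray through a point of the cone. -/
noncomputable def dir (w : X0 p q) : Om p q :=
  (⟨‖w.1.1‖⁻¹ • w.1.1, by simp [norm_smul, (norm_fst_pos w).ne']⟩,
    ⟨‖w.1.1‖⁻¹ • w.1.2, by simp [norm_smul, norm_snd_eq, (norm_fst_pos w).ne']⟩)

lemma dil_omPt_dir (w : X0 p q) : dil ‖w.1.1‖ (norm_fst_pos w) (omPt (dir w)) = w := by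
  have := (norm_fst_pos w).ne'
  refine Subtype.ext (Prod.ext ?_ ?_) <;> simp [dil, omPt, dir, smul_smul, this]

variable (p q) in
/-- The restriction of a homogeneous function to the product of the unit spheres. -/
noncomputable def resOm (a : ℂ) : S p q a →ₗ[ℂ] C(Om p q, ℂ) where
  toFun f := ⟨fun w => f.1.fn (omPt w), f.1.isSmooth.continuous.comp continuous_omPt⟩
  map_add' _ _ := rfl
  map_smul' _ _ := rfl

lemma resOm_apply {a : ℂ} (f : S p q a) (w : Om p q) : resOm p q a f w = f.1.fn (omPt w) := rfl

lemma fn_eq_resOm {a : ℂ} (f : S p q a) (w : X0 p q) :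
    f.1.fn w = (‖w.1.1‖ : ℂ) ^ a * resOm p q a f (dir w) := by
  conv_lhs => rw [← dil_omPt_dir w, f.2]
  rfl

lemma resOm_injective (a : ℂ) : Function.Injective (resOm p q a) := by
  intro f g hfg
  refine Subtype.ext (Subtype.ext (funext fun w => ?_))
  change f.1.fn w = g.1.fn w
  rw [fn_eq_resOm, fn_eq_resOm, hfg]

lemma resOm_rho {a : ℂ} (g : K p q) (f : S p q a) :
    resOm p q a (rho p q a g f) = translateOm g (resOm p q a f) := rfl

/-- A local smooth parametrization of the unit sphere by the ambient space. -/
lemma exists_chart_sphere (x₀ : Sph p) : ∃ (φ : E p → Sph p) (C : Set (E p)),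
    ContDiff ℝ ∞ (fun u => (φ u).1) ∧ IsCompact C ∧ ∀ᶠ x in 𝓝 x₀, ∃ u ∈ C, φ u = x := by
  have hx₀ : ‖x₀.1‖ = 1 := by simp
  -- Orthogonal projection to the affine tangent plane at x₀; normalizing it projects centrally to
  -- the sphere. The chart is defined on all of the ambient space and need not be injective.
  set N : E p → E p := fun u => x₀.1 + (u - (inner ℝ u x₀.1) • x₀.1) with hN
  have hin : ∀ u, inner ℝ (N u) x₀.1 = 1 := by
    intro u
    simp only [hN, inner_add_left, inner_sub_left, real_inner_smul_left,
      real_inner_self_eq_norm_sq, hx₀]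
    ring
  have hne : ∀ u, N u ≠ 0 := by
    intro u h
    have := hin u
    rw [h, inner_zero_left] at this
    exact zero_ne_one this
  have hNd : ContDiff ℝ ∞ N :=
    contDiff_const.add (contDiff_id.sub ((contDiff_id.inner ℝ contDiff_const).smul contDiff_const))
  refine ⟨fun u => ⟨‖N u‖⁻¹ • N u, by simp [norm_smul, hne u]⟩, Metric.closedBall 0 3, ?_,
    isCompact_closedBall _ _, ?_⟩
  · exact ((hNd.norm ℝ hne).inv fun u => norm_ne_zero_iff.2 (hne u)).smul hNd
  · have hc : ContinuousAt (fun x : Sph p => inner ℝ x.1 x₀.1) x₀ := by fun_prop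
    have h0 : (1 / 2 : ℝ) < inner ℝ x₀.1 x₀.1 := by
      rw [real_inner_self_eq_norm_sq, hx₀]; norm_num
    filter_upwards [hc.eventually (lt_mem_nhds h0)] with x hx
    set t := inner ℝ x.1 x₀.1 with ht
    have ht0 : 0 < t := by linarith
    have hx1 : ‖x.1‖ = 1 := by simp
    have hNx : N (t⁻¹ • x.1 - x₀.1) = t⁻¹ • x.1 := by
      have h1 : inner ℝ (t⁻¹ • x.1 - x₀.1) x₀.1 = 0 := by
        rw [inner_sub_left, real_inner_smul_left, ← ht, real_inner_self_eq_norm_sq, hx₀]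
        field_simp
        ring
      simp [hN, h1]
    refine ⟨t⁻¹ • x.1 - x₀.1, ?_, Subtype.ext ?_⟩
    · rw [mem_closedBall_zero_iff]
      refine (norm_sub_le _ _).trans ?_
      rw [norm_smul, hx1, hx₀, norm_inv, Real.norm_of_nonneg ht0.le]
      have : t⁻¹ ≤ 2 := by
        rw [inv_le_comm₀ ht0 two_pos]; linarith
      linarith
    · change ‖N _‖⁻¹ • N _ = x.1
      rw [hNx, norm_smul, hx1, mul_one, smul_smul, norm_inv, inv_inv,
        Real.norm_of_nonneg ht0.le, mul_inv_cancel₀ ht0.ne', one_smul]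

/-- A local smooth parametrization of the product of the unit spheres. -/
lemma exists_chart (w₀ : Om p q) : ∃ (φ : E (p + q) → X0 p q) (C : Set (E (p + q))),
    ContDiff ℝ ∞ (fun u => (φ u).1) ∧ IsCompact C ∧ ∀ᶠ w in 𝓝 w₀, ∃ u ∈ C, φ u = omPt w := by
  obtain ⟨φ₁, C₁, h₁, hC₁, hw₁⟩ := exists_chart_sphere w₀.1
  obtain ⟨φ₂, C₂, h₂, hC₂, hw₂⟩ := exists_chart_sphere w₀.2
  -- The test maps of the topology start from some `E d`, so the parameter spaces are combined by a
  -- linear isomorphism.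
  let e : E (p + q) ≃L[ℝ] E p × E q := ContinuousLinearEquiv.ofFinrankEq (by simp)
  refine ⟨fun u => omPt (φ₁ (e u).1, φ₂ (e u).2), e.symm '' (C₁ ×ˢ C₂), ?_,
    (hC₁.prod hC₂).image e.symm.continuous, ?_⟩
  · exact (h₁.comp (contDiff_fst.comp e.contDiff)).prodMk
      (h₂.comp (contDiff_snd.comp e.contDiff))
  · rw [nhds_prod_eq]
    filter_upwards [hw₁.prod_mk hw₂] with w hw
    obtain ⟨⟨u, hu, hu'⟩, v, hv, hv'⟩ := hw
    refine ⟨e.symm (u, v), ⟨(u, v), ⟨hu, hv⟩, rfl⟩, ?_⟩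
    simp only [ContinuousLinearEquiv.apply_symm_apply, hu', hv']

/-- Order zero of the topology suffices: the chart images of compact sets contain a neighbourhood of
each point of the product of spheres. -/
lemma continuous_resOm (a : ℂ) : Continuous (resOm p q a) := by
  rw [continuous_iff_continuousAt]
  intro f
  rw [ContinuousAt, ContinuousMap.tendsto_iff_tendstoLocallyUniformly,
    Metric.tendstoLocallyUniformly_iff]
  intro ε hε w₀
  obtain ⟨φ, C, hφ, hC, hw⟩ := exists_chart w₀
  refine ⟨_, hw, ?_⟩
  have h1 := tendsto_smooth_iff.1 (continuous_subtype_val.tendsto f) _ φ hφ 0 C hC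
  rw [Metric.tendstoUniformlyOn_iff] at h1
  filter_upwards [h1 ε hε] with g hg w hw
  obtain ⟨u, hu, huw⟩ := hw
  have := hg u hu
  rw [iteratedFDeriv_zero_eq_comp, iteratedFDeriv_zero_eq_comp] at this
  simp only [Function.comp_apply, LinearIsometryEquiv.dist_map, huw] at this
  exact this

end LightCone

/-! ### Rapid decay in S^a and growth of derivatives along parametrizations -/

namespace LightCone

open scoped SchwartzMap

variable {p q : ℕ}

/-- Homogeneous functions extend from the product of the unit spheres to Schwartz functions. -/
lemma exists_schwartzRes_eq_resOm {a : ℂ} (f : S p q a) :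
    ∃ F : 𝓢(EE p q, ℂ), schwartzRes F = resOm p q a f := by
  -- A cutoff equal to 1 at 1 and supported in [1/2, 3/2]. Applied to both squared norms, it avoids
  -- the singularities of the radial extension and makes the support compact.
  let χ : ContDiffBump (1 : ℝ) := ⟨1 / 4, 1 / 2, by norm_num, by norm_num⟩
  have hχ0 : ∀ t : ℝ, t < 1 / 2 → χ t = 0 := fun t ht => χ.zero_of_le_dist (by
    rw [Real.dist_eq, abs_of_neg (by linarith)]
    change 1 / 2 ≤ _
    linarith)
  have hχ1 : ∀ t : ℝ, 2 ≤ t → χ t = 0 := fun t ht => χ.zero_of_le_dist (by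
    rw [Real.dist_eq, abs_of_pos (by linarith)]
    change 1 / 2 ≤ _
    linarith)
  let e : EE p q ≃L[ℝ] E p × E q := WithLp.prodContinuousLinearEquiv 2 ℝ (E p) (E q)
  let N : EE p q → E p × E q := fun z => (‖z.fst‖⁻¹ • z.fst, ‖z.snd‖⁻¹ • z.snd)
  let B : EE p q → ℝ := fun z => χ (‖z.fst‖ ^ 2) * χ (‖z.snd‖ ^ 2)
  let F : EE p q → ℂ := fun z => (B z : ℂ) * extendZero f.1.fn (N z)
  have hfst : ContDiff ℝ ∞ fun z : EE p q => z.fst := contDiff_fst.comp e.contDiff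
  have hsnd : ContDiff ℝ ∞ fun z : EE p q => z.snd := contDiff_snd.comp e.contDiff
  have hB : ContDiff ℝ ∞ B :=
    (χ.contDiff.comp (hfst.norm_sq ℝ)).mul (χ.contDiff.comp (hsnd.norm_sq ℝ))
  have hF : ContDiff ℝ ∞ F := by
    rw [contDiff_iff_contDiffAt]
    intro z
    by_cases hz : z.fst = 0 ∨ z.snd = 0
    · have h0 : F =ᶠ[𝓝 z] fun _ => 0 := by
        rcases hz with hz | hz
        · have h1 : ∀ᶠ z' : EE p q in 𝓝 z, ‖z'.fst‖ ^ 2 < 1 / 2 :=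
            (hfst.continuous.norm.pow 2).continuousAt.eventually (gt_mem_nhds (by simp [hz]))
          filter_upwards [h1] with z' hz'
          simp [F, B, hχ0 _ hz']
        · have h1 : ∀ᶠ z' : EE p q in 𝓝 z, ‖z'.snd‖ ^ 2 < 1 / 2 :=
            (hsnd.continuous.norm.pow 2).continuousAt.eventually (gt_mem_nhds (by simp [hz]))
          filter_upwards [h1] with z' hz'
          simp [F, B, hχ0 _ hz']
      exact contDiffAt_const.congr_of_eventuallyEq h0
    · push Not at hz
      have hN : ContDiffAt ℝ ∞ N z :=
        (((hfst.contDiffAt.norm ℝ hz.1).inv (norm_ne_zero_iff.2 hz.1)).smul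
          hfst.contDiffAt).prodMk
        (((hsnd.contDiffAt.norm ℝ hz.2).inv (norm_ne_zero_iff.2 hz.2)).smul hsnd.contDiffAt)
      refine (Complex.ofRealCLM.contDiff.comp hB).contDiffAt.mul
        (f.1.isSmooth.contDiffAt_comp hN ?_)
      filter_upwards [hfst.continuous.continuousAt.eventually_ne hz.1,
        hsnd.continuous.continuousAt.eventually_ne hz.2] with z' h1 h2
      refine ⟨fun h => ?_, ?_⟩
      · have h3 : ‖z'.fst‖⁻¹ • z'.fst = 0 := congrArg Prod.fst h
        simp [h1] at h3
      · simp [N, norm_smul, h1, h2]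
  have hc : HasCompactSupport F := by
    refine HasCompactSupport.intro (isCompact_closedBall (0 : EE p q) 2) fun z hz => ?_
    rw [mem_closedBall_zero_iff, not_le] at hz
    have h1 : 4 < ‖z.fst‖ ^ 2 + ‖z.snd‖ ^ 2 := by
      rw [← WithLp.prod_norm_sq_eq_of_L2]
      nlinarith
    have h2 : B z = 0 := by
      rcases le_total 2 (‖z.fst‖ ^ 2) with h | h
      · simp [B, hχ1 _ h]
      · simp [B, hχ1 (‖z.snd‖ ^ 2) (by linarith)]
    simp [F, h2]
  refine ⟨hc.toSchwartzMap hF, ?_⟩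
  ext w
  have h1 : χ 1 = 1 := χ.one_of_mem_closedBall (by
    rw [Metric.mem_closedBall, dist_self]
    exact χ.rIn_pos.le)
  change F (omVec w) = f.1.fn (omPt w)
  have h2 : N (omVec w) = (omPt w).1 := by simp [N, omVec, omPt]
  have h3 : B (omVec w) = 1 := by simp [B, omVec, h1]
  simp only [F]
  rw [h2, h3, extendZero_coe, Complex.ofReal_one, one_mul]

/-- The components of a smooth homogeneous function are rapidly decreasing. -/
lemma exists_norm_biharmProj_resOm_le (hp : 1 ≤ p) (hq : 1 ≤ q) {a : ℂ} (f : S p q a) (N : ℕ) :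
    ∃ C : ℝ, 0 ≤ C ∧ ∀ m n : ℕ,
      ‖(biharmProj p q m n (resOm p q a f)).1‖ * ((m : ℝ) + n + 1) ^ N ≤ C := by
  obtain ⟨F, hF⟩ := exists_schwartzRes_eq_resOm f
  rw [← hF]
  -- The additional exponent p + q pays for the passage from L² to the supremum norm.
  obtain ⟨C, hC, h⟩ := exists_norm_biharmProj_schwartzRes_le hp hq F (p + q + N)
  obtain ⟨c, hc, h'⟩ := exists_norm_le_norm_toL2 hp hq
  refine ⟨c * C, by positivity, fun m n => ?_⟩
  set G := biharmProj p q m n (schwartzRes F)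
  have h1 : ((m : ℝ) + 1) ^ p ≤ (m + n + 1) ^ p := by gcongr; linarith [Nat.cast_nonneg (α := ℝ) n]
  have h2 : ((n : ℝ) + 1) ^ q ≤ (m + n + 1) ^ q := by gcongr; linarith [Nat.cast_nonneg (α := ℝ) m]
  calc ‖G.1‖ * ((m : ℝ) + n + 1) ^ N
      ≤ c * ((m + 1) ^ p * (n + 1) ^ q) * ‖toL2 p q G.1‖ * ((m : ℝ) + n + 1) ^ N := by
        gcongr; exact h' m n _ G.2
    _ ≤ c * ((m + n + 1) ^ p * (m + n + 1) ^ q) * ‖toL2 p q G.1‖ * ((m : ℝ) + n + 1) ^ N := by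
        gcongr
    _ = c * (‖toL2 p q G.1‖ * ((m : ℝ) + n + 1) ^ (p + q + N)) := by rw [pow_add, pow_add]; ring
    _ ≤ c * C := by gcongr; exact h m n

lemma exists_bihom_eq {m n : ℕ} {F : C(Om p q, ℂ)} (hF : F ∈ biharm p q m n) :
    ∃ G ∈ bihom p q m n, ∀ w : Om p q, G (w.1.1, w.2.1) = F w := by
  refine biharm_induction (motive := fun F => ∃ G ∈ bihom p q m n,
    ∀ w : Om p q, G (w.1.1, w.2.1) = F w) ?_ ?_ ?_ hF
  · intro h hh k hk
    exact ⟨_, mul_mem_bihom hh.1 hk.1, fun w => rfl⟩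
  · exact ⟨0, zero_mem _, fun w => rfl⟩
  · rintro F F' ⟨G, hG, h⟩ ⟨G', hG', h'⟩
    exact ⟨G + G', add_mem hG hG', fun w => by simp [h, h']⟩

/-- After subtraction of the constant the support is compact, and continuous derivatives with
compact support are bounded. -/
lemma exists_norm_iteratedFDeriv_le {V W : Type*} [NormedAddCommGroup V] [NormedSpace ℝ V]
    [ProperSpace V] [NormedAddCommGroup W] [NormedSpace ℝ W] {f : V → W} (hf : ContDiff ℝ ∞ f)
    {c : W} {R : ℝ} (hR : ∀ u, R < ‖u‖ → f u = c) (k : ℕ) :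
    ∃ B : ℝ, 0 ≤ B ∧ ∀ u, ‖iteratedFDeriv ℝ k f u‖ ≤ B := by
  have h1 : HasCompactSupport fun u => f u - c :=
    HasCompactSupport.intro (isCompact_closedBall (0 : V) R) fun u hu => by
      rw [mem_closedBall_zero_iff, not_le] at hu
      rw [hR u hu, sub_self]
  have h2 : ContDiff ℝ ∞ fun u => f u - c := hf.sub contDiff_const
  obtain ⟨B, hB⟩ := (h1.iteratedFDeriv (𝕜 := ℝ) k).exists_bound_of_continuous
    (h2.continuous_iteratedFDeriv (by exact_mod_cast le_top))
  have h3 : f = (fun u => f u - c) + fun _ => c := by ext u; simp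
  have h4 : ∀ u, ‖iteratedFDeriv ℝ k (fun _ : V => c) u‖ ≤ ‖c‖ := by
    intro u
    rcases Nat.eq_zero_or_pos k with rfl | hk
    · rw [norm_iteratedFDeriv_zero]
    · rw [iteratedFDeriv_const_of_ne hk.ne', Pi.zero_apply, norm_zero]
      exact norm_nonneg _
  refine ⟨B + ‖c‖, add_nonneg ((norm_nonneg _).trans (hB 0)) (norm_nonneg _), fun u => ?_⟩
  rw [h3, iteratedFDeriv_add_apply (h2.of_le (by exact_mod_cast le_top)).contDiffAt
    contDiffAt_const]
  exact (norm_add_le _ _).trans (add_le_add (hB u) (h4 u))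

/-- The derivatives of bihomogeneous functions along bounded maps into the product of the unit
spheres grow polynomially with the degree. -/
lemma exists_norm_iteratedFDeriv_mul_comp_le (hp : 1 ≤ p) {V : Type*} [NormedAddCommGroup V]
    [NormedSpace ℝ V] {A : V → ℂ} {N : V → E p × E q} (hA : ContDiff ℝ ∞ A)
    (hN : ContDiff ℝ ∞ N) (hNm : ∀ u, ∃ w : Om p q, N u = (w.1.1, w.2.1))
    (hAb : ∀ k, ∃ B : ℝ, 0 ≤ B ∧ ∀ u, ‖iteratedFDeriv ℝ k A u‖ ≤ B)
    (hNb : ∀ k, ∃ B : ℝ, 0 ≤ B ∧ ∀ u, ‖iteratedFDeriv ℝ k N u‖ ≤ B) (k : ℕ) :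
    ∃ C : ℝ, 0 ≤ C ∧ ∀ {m n : ℕ} {G : E p × E q → ℂ}, G ∈ bihom p q m n → ∀ {M : ℝ}, 0 ≤ M →
      (∀ w : Om p q, ‖G (w.1.1, w.2.1)‖ ≤ M) → ∀ u,
        ‖iteratedFDeriv ℝ k (fun u => A u * G (N u)) u‖ ≤ C * ((m : ℝ) + n + 1) ^ (2 * k) * M := by
  choose a ha ha' using hAb
  choose b hb hb' using hNb
  -- A common bound D ≥ 1 satisfies D ≤ D^i for i ≥ 1, the form required by the estimate for
  -- derivatives of a composition.
  set D : ℝ := 1 + ∑ l ∈ Finset.range (k + 1), b l with hD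
  have hD1 : 1 ≤ D := by
    have := Finset.sum_nonneg fun l (_ : l ∈ Finset.range (k + 1)) => hb l
    linarith
  have hbD : ∀ l, l ≤ k → b l ≤ D := by
    intro l hl
    have := Finset.single_le_sum (fun l _ => hb l) (Finset.mem_range.2 (Nat.lt_succ_of_le hl))
    linarith
  set κ : ℝ := 4 * (p + q) with hκ
  have hκ1 : 1 ≤ κ := by
    have : (1 : ℝ) ≤ p := by exact_mod_cast hp
    have := Nat.cast_nonneg (α := ℝ) q
    linarith
  refine ⟨∑ l ∈ Finset.range (k + 1), k.choose l * a l * (k.factorial * κ ^ k * D ^ k),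
    Finset.sum_nonneg fun l _ => by have := ha l; positivity, fun {m n G} hG {M} hM hGM u => ?_⟩
  have hG' : ContDiff ℝ ∞ G := contDiff_of_mem_bihom hG
  have hmn : 1 ≤ ((m : ℝ) + n + 1) ^ 2 := by
    have : (1 : ℝ) ≤ (m : ℝ) + n + 1 := by
      have := Nat.cast_nonneg (α := ℝ) m
      have := Nat.cast_nonneg (α := ℝ) n
      linarith
    exact one_le_pow₀ this
  have hcomp : ∀ l, l ≤ k → ‖iteratedFDeriv ℝ l (fun u => G (N u)) u‖ ≤
      k.factorial * κ ^ k * D ^ k * (((m : ℝ) + n + 1) ^ (2 * k) * M) := by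
    intro l hl
    have h1 := norm_iteratedFDeriv_comp_le (n := l) hG' hN (by exact_mod_cast le_top) u
      (C := (κ * ((m : ℝ) + n + 1) ^ 2) ^ k * M) (D := D) (by
        intro i hi
        obtain ⟨w, hw⟩ := hNm u
        rw [hw]
        refine (norm_iteratedFDeriv_le_of_mem_bihom i hG hGM w).trans ?_
        gcongr
        · nlinarith
        · exact hi.trans hl) (by
        intro i hi hi'
        refine ((hb' i u).trans (hbD i (hi'.trans hl))).trans ?_
        exact le_self_pow₀ hD1 (by omega))
    refine h1.trans ?_
    calc (l.factorial : ℝ) * ((κ * ((m : ℝ) + n + 1) ^ 2) ^ k * M) * D ^ l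
        ≤ k.factorial * ((κ * ((m : ℝ) + n + 1) ^ 2) ^ k * M) * D ^ k := by
          gcongr
      _ = _ := by rw [mul_pow, ← pow_mul]; ring
  refine (norm_iteratedFDeriv_mul_le hA (hG'.comp hN) u (n := k)
    (by exact_mod_cast le_top)).trans ?_
  rw [Finset.sum_mul, Finset.sum_mul]
  refine Finset.sum_le_sum fun l hl => ?_
  have := ha l
  calc _ ≤ (k.choose l : ℝ) * a l *
        (k.factorial * κ ^ k * D ^ k * (((m : ℝ) + n + 1) ^ (2 * k) * M)) := by
        gcongr
        · exact ha' l u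
        · exact hcomp (k - l) (Nat.sub_le _ _)
    _ = _ := by ring

lemma summable_inv_add_add_one_pow_four :
    Summable fun i : ℕ × ℕ => (((i.1 : ℝ) + i.2 + 1) ^ 4)⁻¹ := by
  have h1 : Summable fun m : ℕ => (((m : ℝ) + 1) ^ 2)⁻¹ := by
    have := (summable_nat_add_iff 1).2 (Real.summable_nat_pow_inv.2 (by norm_num : 1 < 2))
    simpa using this
  refine Summable.of_nonneg_of_le (fun i => by positivity) (fun i => ?_)
    (h1.mul_of_nonneg h1 (fun m => by positivity) (fun m => by positivity))
  rw [← mul_inv]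
  gcongr
  rw [show (4 : ℕ) = 2 + 2 from rfl, pow_add]
  gcongr <;> linarith [Nat.cast_nonneg (α := ℝ) i.1, Nat.cast_nonneg (α := ℝ) i.2]

end LightCone

/-! ### Convergence of the expansion and the theorem -/

namespace LightCone

variable {p q : ℕ}

lemma fn_sum {a : ℂ} {ι : Type*} (s : Finset ι) (F : ι → S p q a) :
    (∑ i ∈ s, F i).1.fn = ∑ i ∈ s, (F i).1.fn := by
  rw [Submodule.coe_sum, Smooth.fn_sum]

/-- The expansion into components converges in the topology of `S^a(X⁰)`, uniformly along smooth
parametrizations that are constant near infinity. -/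
lemma tendstoUniformly_iteratedFDeriv (hp : 1 ≤ p) (hq : 1 ≤ q) {a : ℂ} {f : S p q a}
    {F : ℕ × ℕ → S p q a}
    (hF : ∀ i, resOm p q a (F i) = (biharmProj p q i.1 i.2 (resOm p q a f)).1)
    {d : ℕ} {φ : E d → X0 p q} (hφ : ContDiff ℝ ∞ fun u => (φ u).1) {R : ℝ} {w₀ : X0 p q}
    (hR : ∀ u, R < ‖u‖ → φ u = w₀) (k : ℕ) :
    TendstoUniformly (fun s : Finset (ℕ × ℕ) => iteratedFDeriv ℝ k ((∑ i ∈ s, F i).1.fn ∘ φ))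
      (iteratedFDeriv ℝ k (f.1.fn ∘ φ)) Filter.atTop := by
  -- Homogeneity factors each component along φ as A * (G ∘ N), with G bihomogeneous and N with
  -- values in the product of spheres. The factors A and N do not depend on the degrees.
  set A : E d → ℂ := fun u => (‖(φ u).1.1‖ : ℂ) ^ a with hA
  set N : E d → E p × E q := fun u => ((dir (φ u)).1.1, (dir (φ u)).2.1) with hN
  have hfst : ContDiff ℝ ∞ fun u => (φ u).1.1 := contDiff_fst.comp hφ
  have hsnd : ContDiff ℝ ∞ fun u => (φ u).1.2 := contDiff_snd.comp hφ
  have hnorm : ContDiff ℝ ∞ fun u => ‖(φ u).1.1‖ := hfst.norm ℝ fun u => fst_ne_zero (φ u).2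
  have hinv : ContDiff ℝ ∞ fun u => ‖(φ u).1.1‖⁻¹ := hnorm.inv fun u => (norm_fst_pos (φ u)).ne'
  have hAd : ContDiff ℝ ∞ A := by
    have h1 : A = fun u => Complex.exp ((Real.log ‖(φ u).1.1‖ : ℂ) * a) := by
      ext u
      have := norm_fst_pos (φ u)
      simp only [hA]
      rw [Complex.cpow_def_of_ne_zero (by exact_mod_cast this.ne'), Complex.ofReal_log this.le]
    rw [h1]
    exact ((Complex.ofRealCLM.contDiff.comp (hnorm.log fun u => (norm_fst_pos (φ u)).ne')).mul
      contDiff_const).cexp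
  have hNd : ContDiff ℝ ∞ N := (hinv.smul hfst).prodMk (hinv.smul hsnd)
  have hAb := exists_norm_iteratedFDeriv_le hAd (R := R) (c := (‖w₀.1.1‖ : ℂ) ^ a)
    (fun u hu => by simp only [hA, hR u hu])
  have hNb := exists_norm_iteratedFDeriv_le hNd (R := R) (c := ((dir w₀).1.1, (dir w₀).2.1))
    (fun u hu => by simp only [hN, hR u hu])
  have hbound : ∀ l : ℕ, ∃ C : ℝ, ∀ (i : ℕ × ℕ) (u : E d),
      ‖iteratedFDeriv ℝ l ((F i).1.fn ∘ φ) u‖ ≤ C * (((i.1 : ℝ) + i.2 + 1) ^ 4)⁻¹ := by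
    intro l
    obtain ⟨c, hc, hcG⟩ := exists_norm_iteratedFDeriv_mul_comp_le hp hAd hNd
      (fun u => ⟨dir (φ u), rfl⟩) hAb hNb l
    -- The power 2l compensates for the growth of the l-th derivative, and 4 makes the double series
    -- converge.
    obtain ⟨C, hC, hCf⟩ := exists_norm_biharmProj_resOm_le hp hq f (2 * l + 4)
    refine ⟨c * C, fun i u => ?_⟩
    obtain ⟨G, hG, hGF⟩ := exists_bihom_eq (biharmProj p q i.1 i.2 (resOm p q a f)).2
    have h1 : (F i).1.fn ∘ φ = fun u => A u * G (N u) := by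
      ext u
      rw [Function.comp_apply, fn_eq_resOm, hF, ← hGF]
    have hpos : 0 < ((i.1 : ℝ) + i.2 + 1) := by positivity
    rw [h1]
    refine (hcG hG (norm_nonneg _) (fun w => by
      rw [hGF]; exact ContinuousMap.norm_coe_le_norm _ w) u).trans ?_
    rw [← div_eq_mul_inv, le_div_iff₀ (by positivity)]
    calc _ = c * (‖(biharmProj p q i.1 i.2 (resOm p q a f)).1‖ *
          ((i.1 : ℝ) + i.2 + 1) ^ (2 * l + 4)) := by rw [pow_add]; ring
      _ ≤ c * C := by gcongr; exact hCf _ _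
  choose C hC using hbound
  have hsum : ∀ l, Summable fun i : ℕ × ℕ => C l * (((i.1 : ℝ) + i.2 + 1) ^ 4)⁻¹ := fun l =>
    summable_inv_add_add_one_pow_four.mul_left _
  have hres : HasSum (fun i : ℕ × ℕ => (biharmProj p q i.1 i.2 (resOm p q a f)).1) (resOm p q a f) := by
    obtain ⟨c, hc, hcf⟩ := exists_norm_biharmProj_resOm_le hp hq f 4
    refine hasSum_biharmProj hp hq (Summable.of_norm_bounded
      (summable_inv_add_add_one_pow_four.mul_left c) fun i => ?_)
    rw [← div_eq_mul_inv, le_div_iff₀ (by positivity)]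
    exact hcf _ _
  have hpt : ∀ u, HasSum (fun i => ((F i).1.fn ∘ φ) u) ((f.1.fn ∘ φ) u) := by
    intro u
    have h1 := (ContinuousMap.hasSum_apply hres (dir (φ u))).mul_left (A u)
    rw [Function.comp_apply, fn_eq_resOm]
    refine h1.congr_fun fun i => ?_
    rw [Function.comp_apply, fn_eq_resOm, hF]
  have hFd : ∀ i, ContDiff ℝ ∞ ((F i).1.fn ∘ φ) := fun i => (F i).1.isSmooth.contDiff_comp hφ
  have h1 : iteratedFDeriv ℝ k (f.1.fn ∘ φ) =
      fun u => ∑' i, iteratedFDeriv ℝ k ((F i).1.fn ∘ φ) u := by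
    have h2 : f.1.fn ∘ φ = fun u => ∑' i, ((F i).1.fn ∘ φ) u := by
      ext u
      exact (hpt u).tsum_eq.symm
    rw [h2]
    -- All orders have summable bounds uniform on the whole of `E d`, so the series may be
    -- differentiated term by term.
    exact iteratedFDeriv_tsum (N := ⊤) hFd (fun l _ => hsum l) (fun l i u _ => hC l i u) le_top
  have h3 : ∀ s : Finset (ℕ × ℕ), iteratedFDeriv ℝ k ((∑ i ∈ s, F i).1.fn ∘ φ) =
      fun u => ∑ i ∈ s, iteratedFDeriv ℝ k ((F i).1.fn ∘ φ) u := by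
    intro s
    have h4 : (∑ i ∈ s, F i).1.fn ∘ φ = fun u => ∑ i ∈ s, ((F i).1.fn ∘ φ) u := by
      ext u
      rw [fn_sum]
      simp
    rw [h4]
    ext1 u
    exact iteratedFDeriv_fun_sum_apply fun i _ =>
      ((hFd i).of_le (by exact_mod_cast le_top)).contDiffAt
  rw [h1]
  simp only [h3]
  exact tendstoUniformly_tsum (hsum k) fun i u => hC k i u

/-- The expansion into components converges in `S^a(X⁰)`. -/
lemma hasSum_of_resOm_eq (hp : 1 ≤ p) (hq : 1 ≤ q) {a : ℂ} {f : S p q a} {F : ℕ × ℕ → S p q a}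
    (hF : ∀ i, resOm p q a (F i) = (biharmProj p q i.1 i.2 (resOm p q a f)).1) : HasSum F f := by
  rw [HasSum, SummationFilter.unconditional_filter,
    Topology.IsInducing.subtypeVal.tendsto_nhds_iff, tendsto_smooth_iff]
  intro d φ hφ k C hC
  obtain ⟨R, hR, hCR⟩ := hC.isBounded.subset_ball_lt 0 0
  -- Precomposition with u ↦ χ(u) u makes the test map constant near infinity, which yields global
  -- bounds. On an open ball around C nothing changes, so derivatives on C agree.
  let χ : ContDiffBump (0 : E d) := ⟨R, R + 1, hR, by linarith⟩
  have hψ : ContDiff ℝ ∞ fun u : E d => χ u • u := χ.contDiff.smul contDiff_id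
  have h1 := tendstoUniformly_iteratedFDeriv hp hq hF (φ := fun u => φ (χ u • u))
    (hφ.comp hψ) (R := R + 1) (w₀ := φ 0) (fun u hu => by
      have : χ u = 0 := χ.zero_of_le_dist (by rw [dist_zero_right]; exact hu.le)
      simp only [this, zero_smul]) k
  have h2 : ∀ (g : X0 p q → ℂ), ∀ u ∈ C, iteratedFDeriv ℝ k (g ∘ fun u => φ (χ u • u)) u =
      iteratedFDeriv ℝ k (g ∘ φ) u := by
    intro g u hu
    refine Filter.EventuallyEq.eq_of_nhds (Filter.EventuallyEq.iteratedFDeriv ℝ ?_ k)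
    filter_upwards [Metric.isOpen_ball.mem_nhds (hCR hu)] with v hv
    have : χ v = 1 := χ.one_of_mem_closedBall (Metric.ball_subset_closedBall hv)
    simp only [Function.comp_apply, this, one_smul]
  refine ((h1.tendstoUniformlyOn (s := C)).congr
    (Filter.Eventually.of_forall fun s u hu => h2 _ u hu)).congr_right fun u hu => h2 _ u hu

/-- The power of r_p² is 1 on the unit spheres, so the dependence on a disappears. -/
lemma resOm_j_tmul (a : ℂ) {m n : ℕ} (h : H p m) (k : H q n) :
    resOm p q a (j p q a m n (h ⊗ₜ k)) = extProd p q (sphRes p h.1) (sphRes q k.1) := by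
  ext w
  rw [resOm_apply, j_tmul]
  simp [omPt]

lemma map_resOm_range_j (a : ℂ) (m n : ℕ) :
    (LinearMap.range (j p q a m n)).map (resOm p q a) = biharm p q m n := by
  apply le_antisymm
  · rintro _ ⟨_, ⟨t, rfl⟩, rfl⟩
    induction t using TensorProduct.induction_on with
    | zero => simp
    | tmul h k =>
      rw [resOm_j_tmul]
      exact extProd_mem_biharm h.2 k.2
    | add t t' ht ht' =>
      rw [map_add, map_add]
      exact add_mem ht ht'
  · intro F hF
    refine biharm_induction
      (motive := fun F => F ∈ (LinearMap.range (j p q a m n)).map (resOm p q a)) ?_ ?_ ?_ hF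
    · intro h hh k hk
      exact ⟨_, ⟨_, rfl⟩, resOm_j_tmul a ⟨h, hh⟩ ⟨k, hk⟩⟩
    · exact zero_mem _
    · exact fun F G => add_mem

lemma mem_range_j_iff {a : ℂ} {m n : ℕ} {f : S p q a} :
    f ∈ LinearMap.range (j p q a m n) ↔ resOm p q a f ∈ biharm p q m n := by
  rw [← map_resOm_range_j a]
  exact ((resOm_injective a).mem_set_image).symm

variable (p q) in
/-- The subrepresentation `V_{m,n}` of `S^a(X⁰)`. -/
noncomputable def harmonicRep (a : ℂ) (m n : ℕ) : Subrepresentation (rho p q a) where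
  toSubmodule := LinearMap.range (j p q a m n)
  apply_mem_toSubmodule g f hf := by
    rw [mem_range_j_iff] at hf ⊢
    rw [resOm_rho]
    exact translateOm_mem_biharm g hf

variable (p q) in
/-- The restriction to the product of the unit spheres as an isomorphism on `V_{m,n}`. -/
noncomputable def harmonicRepEquiv (a : ℂ) (m n : ℕ) :
    (harmonicRep p q a m n).toSubmodule ≃ₗ[ℂ] biharm p q m n :=
  (Submodule.equivMapOfInjective (resOm p q a) (resOm_injective a) _).trans
    (LinearEquiv.ofEq _ _ (map_resOm_range_j a m n))

lemma harmonicRepEquiv_coe {a : ℂ} {m n : ℕ} (f : (harmonicRep p q a m n).toSubmodule) :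
    (harmonicRepEquiv p q a m n f).1 = resOm p q a f.1 := rfl

lemma resOm_harmonicRepEquiv_symm {a : ℂ} {m n : ℕ} (F : biharm p q m n) :
    resOm p q a ((harmonicRepEquiv p q a m n).symm F).1 = F.1 := by
  rw [← harmonicRepEquiv_coe, LinearEquiv.apply_symm_apply]

lemma continuous_biharmProj (m n : ℕ) : Continuous (biharmProj p q m n) := by
  have h : Continuous (biharmEquivL2 p q m n).symm :=
    LinearMap.continuous_of_finiteDimensional (𝕜 := ℂ) (E := biharmL2 p q m n)
      (F' := biharm p q m n) (biharmEquivL2 p q m n).symm.toLinearMap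
  exact h.comp ((biharmL2 p q m n).orthogonalProjectionOnto.continuous.comp (toL2 p q).continuous)

variable (p q) in
/-- The projection of `S^a(X⁰)` to `V_{m,n}`. -/
noncomputable def harmonicProj (a : ℂ) (m n : ℕ) : S p q a →L[ℂ] S p q a where
  toLinearMap := (harmonicRep p q a m n).toSubmodule.subtype ∘ₗ
    (harmonicRepEquiv p q a m n).symm.toLinearMap ∘ₗ biharmProj p q m n ∘ₗ resOm p q a
  cont := continuous_subtype_val.comp ((harmonicRepEquiv p q a
    m n).symm.toLinearMap.continuous_of_finiteDimensional.comp
      ((continuous_biharmProj m n).comp (continuous_resOm a)))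

lemma harmonicProj_mem {a : ℂ} {m n : ℕ} (f : S p q a) :
    harmonicProj p q a m n f ∈ (harmonicRep p q a m n).toSubmodule :=
  ((harmonicRepEquiv p q a m n).symm (biharmProj p q m n (resOm p q a f))).2

lemma resOm_harmonicProj {a : ℂ} {m n : ℕ} (f : S p q a) :
    resOm p q a (harmonicProj p q a m n f) = (biharmProj p q m n (resOm p q a f)).1 :=
  resOm_harmonicRepEquiv_symm _

lemma isTopologicalDirectSum_harmonicRep (hp : 1 ≤ p) (hq : 1 ≤ q) (a : ℂ) :
    IsTopologicalDirectSum fun i : ℕ × ℕ => (harmonicRep p q a i.1 i.2).toSubmodule := by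
  refine ⟨fun i => harmonicProj p q a i.1 i.2, fun f => ⟨fun i => harmonicProj_mem f,
    hasSum_of_resOm_eq hp hq fun i => resOm_harmonicProj f, fun w hw hs i => ?_⟩⟩
  apply resOm_injective a
  rw [resOm_harmonicProj]
  exact (biharmProj_eq_of_hasSum hp hq (fun i => mem_range_j_iff.1 (hw i))
    (hs.map (resOm p q a) (continuous_resOm a)) i).symm

lemma isIrreducible_harmonicRep (hp : 1 ≤ p) (hq : 1 ≤ q) (a : ℂ) {m n : ℕ} (hm : p = 1 → m ≤ 1)
    (hn : q = 1 → n ≤ 1) : (harmonicRep p q a m n).toRepresentation.IsIrreducible := by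
  have hinj : Function.Injective (resOm p q a ∘ₗ (harmonicRep p q a m n).toSubmodule.subtype) :=
    (resOm_injective a).comp Subtype.val_injective
  have hrange : (⊤ : Submodule ℂ (harmonicRep p q a m n).toSubmodule).map
      (resOm p q a ∘ₗ (harmonicRep p q a m n).toSubmodule.subtype) = biharm p q m n := by
    rw [Submodule.map_comp, Submodule.map_top, Submodule.range_subtype]
    exact map_resOm_range_j a m n
  have hnt : (⊥ : Subrepresentation (harmonicRep p q a m n).toRepresentation) ≠ ⊤ := by
    intro h
    have h1 : (⊥ : Submodule ℂ (harmonicRep p q a m n).toSubmodule) = ⊤ :=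
      congrArg Subrepresentation.toSubmodule h
    rw [← h1, Submodule.map_bot] at hrange
    exact biharm_ne_bot hp hq hm hn hrange.symm
  refine { exists_pair_ne := ⟨⊥, ⊤, hnt⟩, eq_bot_or_eq_top := fun W => ?_ }
  have h1 := biharm_irreducible hp hq (W := W.toSubmodule.map
    (resOm p q a ∘ₗ (harmonicRep p q a m n).toSubmodule.subtype))
    ((Submodule.map_mono le_top).trans hrange.le) (by
      rintro g _ ⟨f, hf, rfl⟩
      exact ⟨_, W.apply_mem_toSubmodule g hf, rfl⟩)
  refine h1.imp (fun h => ?_) (fun h => ?_)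
  · apply Subrepresentation.toSubmodule_injective
    apply Submodule.map_injective_of_injective hinj
    rw [h]
    exact (Submodule.map_bot _).symm
  · apply Subrepresentation.toSubmodule_injective
    apply Submodule.map_injective_of_injective hinj
    rw [h, ← hrange]
    rfl

lemma harmonicRep_eq_bot (a : ℂ) {m n : ℕ} (h : ¬((p = 1 → m ≤ 1) ∧ (q = 1 → n ≤ 1))) :
    harmonicRep p q a m n = ⊥ := by
  apply Subrepresentation.toSubmodule_injective
  apply Submodule.map_injective_of_injective (resOm_injective a)
  exact (map_resOm_range_j a m n).trans ((biharm_eq_bot h).trans (Submodule.map_bot _).symm)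

lemma harmonicRepEquiv_symm_translateOm {a : ℂ} {m n : ℕ} (g : K p q) (F : biharm p q m n) :
    (harmonicRepEquiv p q a m n).symm ⟨translateOm g F.1, translateOm_mem_biharm g F.2⟩ =
      (harmonicRep p q a m n).toRepresentation g ((harmonicRepEquiv p q a m n).symm F) := by
  apply Subtype.ext
  apply resOm_injective a
  rw [resOm_harmonicRepEquiv_symm]
  change _ = resOm p q a (rho p q a g ((harmonicRepEquiv p q a m n).symm F).1)
  rw [resOm_rho, resOm_harmonicRepEquiv_symm]

lemma le_of_equiv (hp : 1 ≤ p) (hq : 1 ≤ q) {a : ℂ} {m n m' n' : ℕ} (hm : p = 1 → m ≤ 1)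
    (hn : q = 1 → n ≤ 1) (e : (harmonicRep p q a m n).toRepresentation.Equiv
      (harmonicRep p q a m' n').toRepresentation) : m ≤ m' ∧ n ≤ n' := by
  refine le_of_equivariant hp hq hm hn (resOm p q a ∘ₗ
    (harmonicRep p q a m' n').toSubmodule.subtype ∘ₗ e.toLinearMap ∘ₗ
      (harmonicRepEquiv p q a m n).symm.toLinearMap) ?_ ?_ ?_
  · exact (resOm_injective a).comp (Subtype.val_injective.comp
      (e.toLinearEquiv.injective.comp (harmonicRepEquiv p q a m n).symm.injective))
  · exact fun F => mem_range_j_iff.1 (e.toLinearMap ((harmonicRepEquiv p q a m n).symm F)).2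
  · intro g F
    have h1 := LinearMap.congr_fun (e.isIntertwining' g) ((harmonicRepEquiv p q a m n).symm F)
    change resOm p q a (e.toLinearMap ((harmonicRepEquiv p q a m n).symm _)).1 = _
    rw [harmonicRepEquiv_symm_translateOm]
    exact congrArg (fun f => resOm p q a f.1) h1

end LightCone

theorem lemma2p2 (p q : ℕ) (hp : 1 ≤ p) (hq : 1 ≤ q) (a : ℂ) :
    ∃ V : ℕ × ℕ → Subrepresentation (LightCone.rho p q a),
      (∀ m n : ℕ, (V (m, n)).toSubmodule = LinearMap.range (LightCone.j p q a m n)) ∧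
      LightCone.IsTopologicalDirectSum (fun i : ℕ × ℕ => (V i).toSubmodule) ∧
      (∀ m n : ℕ, (p = 1 → m ≤ 1) → (q = 1 → n ≤ 1) →
        (V (m, n)).toRepresentation.IsIrreducible) ∧
      (∀ m n : ℕ, ¬ ((p = 1 → m ≤ 1) ∧ (q = 1 → n ≤ 1)) → V (m, n) = ⊥) ∧
      (∀ m n m' n' : ℕ, (p = 1 → m ≤ 1) → (q = 1 → n ≤ 1) → (p = 1 → m' ≤ 1) →
        (q = 1 → n' ≤ 1) → (m, n) ≠ (m', n') →
        IsEmpty ((V (m, n)).toRepresentation.Equiv (V (m', n')).toRepresentation)) := by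
  refine ⟨fun i => LightCone.harmonicRep p q a i.1 i.2, fun m n => rfl,
    LightCone.isTopologicalDirectSum_harmonicRep hp hq a,
    fun m n hm hn => LightCone.isIrreducible_harmonicRep hp hq a hm hn,
    fun m n h => LightCone.harmonicRep_eq_bot a h, fun m n m' n' hm hn hm' hn' hne => ⟨fun e => ?_⟩⟩
  -- An equivalence and its inverse order the degrees in both directions.
  have h1 := LightCone.le_of_equiv hp hq hm hn e
  have h2 := LightCone.le_of_equiv hp hq hm' hn' e.symm
  exact hne (Prod.ext (le_antisymm h1.1 h2.1) (le_antisymm h1.2 h2.2))
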